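/- Let $n\ge 3$, let $M$ be a compact smooth manifold with (possibly empty) boundary, of dimension $n$, and let $g$ be a Riemannian metric on $M$ of class $W^{1,p'}$ for some $p'\in(n,\infty]$; that is, $g$ is a continuous, everywhere positive definite section of $S_2M$ (since $p'>n$, every element of $W^{1,p'}$ has a unique continuous representative) whose components in each smooth chart have weak first derivatives and belong to $L^{p'}$, together with these derivatives, on compact subsets of the chart (which may touch $\partial M$). Let $\mu^g$ be the Riemannian measure of $g$, let $\nabla$ be its Levi-Civita connection, given in charts by the weakly defined Christoffel symbols, and for a vector field $W$ let $$(\mathbb{L}W)_{ij}=\nabla_iW_j+\nabla_jW_i-\frac2n\,\nabla^kW_k\,g_{ij}$$ be the conformal Killing operator. Let $W^{1,2}(M,TM)$ be the space of vector fields $W\in L^2(M,TM)$ whose chart components belong to $W^{1,2}$ on compact subsets of each chart, with weak covariant derivative $\nabla W\in L^2$, normed by $\|W\|_{W^{1,2}}^2=\int_M|W|_g^2\,d\mu^g+\int_M|\nabla W|_g^2\,d\mu^g$. Then there exist constants $c_1>0$ and $c_2>0$ such that for every $W\in W^{1,2}(M,TM)$ $$c_1\|W\|_{W^{1,2}(M,TM)}^2-c_2\|W\|_{L^2(M,TM)}^2\le\|\mathbb{L}W\|_{L^2(M,\mathring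 S_2M)}^2 .$$ -/

import Mathlib

open scoped Manifold ContDiff ENNReal Topology

noncomputable section

namespace LowRegKorn

open MeasureTheory Set

/-! ### First order Sobolev functions on (relatively open subsets of) a half space -/

section Euclidean

variable {n : ℕ}

/-- `v` is a weak partial derivative `∂ᵢ u` of `u` on the open set `Ω ⊆ ℝⁿ`. -/
def IsWeakPartial (Ω : Set (EuclideanSpace ℝ (Fin n))) (i : Fin n)
    (u v : EuclideanSpace ℝ (Fin n) → ℝ) : Prop :=
  LocallyIntegrableOn u Ω ∧ LocallyIntegrableOn v Ω ∧
    ∀ η : EuclideanSpace ℝ (Fin n) → ℝ, ContDiff ℝ ∞ η → HasCompactSupport η → tsupport η ⊆ Ω →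
      ∫ y, u y * fderiv ℝ η y (EuclideanSpace.single i 1) = -∫ y, v y * η y

open Classical in
/-- A representative of the weak partial derivative `∂ᵢ u` on `Ω` (unique almost everywhere on `Ω`);
zero if `u` has no weak partial derivative there. -/
def weakPartial (Ω : Set (EuclideanSpace ℝ (Fin n))) (i : Fin n)
    (u : EuclideanSpace ℝ (Fin n) → ℝ) : EuclideanSpace ℝ (Fin n) → ℝ :=
  if h : ∃ v, IsWeakPartial Ω i u v then h.choose else 0

/-- `u ∈ W^{1,p}_loc(T)`, for a relatively open subset `T` of a closed half space: `u` has weak first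
derivatives in the interior of `T`, and `u` and its weak derivatives are `p`-integrable on every
compact subset of `T`. Such compact sets may touch the boundary hyperplane, so the integrability is
up to the boundary. -/
def MemW1pLoc (p : ℝ≥0∞) (T : Set (EuclideanSpace ℝ (Fin n)))
    (u : EuclideanSpace ℝ (Fin n) → ℝ) : Prop :=
  (∀ K ⊆ T, IsCompact K → MemLp u p (volume.restrict K)) ∧
    ∀ i, ∃ v, IsWeakPartial (interior T) i u v ∧
      ∀ K ⊆ T, IsCompact K → MemLp v p (volume.restrict K)

end Euclidean

section Manifold

variable {n : ℕ} [NeZero n] {M : Type*} [TopologicalSpace M] [ChartedSpace (EuclideanHalfSpace n) M]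

/-- Continuous Riemannian metrics on a manifold with boundary `M` of dimension `n`. -/
abbrev Metric (n : ℕ) [NeZero n] (M : Type*) [TopologicalSpace M]
    [ChartedSpace (EuclideanHalfSpace n) M] [IsManifold (𝓡∂ n) ∞ M] : Type _ :=
  Bundle.ContinuousRiemannianMetric (EuclideanSpace ℝ (Fin n))
    (fun x : M => TangentSpace (𝓡∂ n) x)

/-! ### Components in a chart

A chart `e` has values in the half space; `e.extend (𝓡∂ n)` has values in `ℝⁿ`, and its target is a
relatively open subset of `{y | 0 ≤ y 0}`. Components are regarded as functions of the coordinates. -/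

/-- The coordinate vector `∂ᵢ` of the chart `e` at the point with coordinates `y`. -/
def coordVec (e : OpenPartialHomeomorph M (EuclideanHalfSpace n)) (i : Fin n)
    (y : EuclideanSpace ℝ (Fin n)) : TangentSpace (𝓡∂ n) ((e.extend (𝓡∂ n)).symm y) :=
  mfderivWithin 𝓘(ℝ, EuclideanSpace ℝ (Fin n)) (𝓡∂ n) (e.extend (𝓡∂ n)).symm (range (𝓡∂ n)) y
    (EuclideanSpace.single i (1 : ℝ) : EuclideanSpace ℝ (Fin n))

/-- The `k`-th component, in the chart `e`, of a tangent vector at the point `x`. -/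
def vecCoord (e : OpenPartialHomeomorph M (EuclideanHalfSpace n)) (k : Fin n) (x : M)
    (w : TangentSpace (𝓡∂ n) x) : ℝ :=
  let v : EuclideanSpace ℝ (Fin n) :=
    mfderiv (𝓡∂ n) 𝓘(ℝ, EuclideanSpace ℝ (Fin n)) (e.extend (𝓡∂ n)) x w
  v k

/-- The components `Wᵏ` of a vector field `W`. -/
def fieldCoord (e : OpenPartialHomeomorph M (EuclideanHalfSpace n))
    (W : ∀ x : M, TangentSpace (𝓡∂ n) x) (k : Fin n) (y : EuclideanSpace ℝ (Fin n)) : ℝ :=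
  vecCoord e k _ (W ((e.extend (𝓡∂ n)).symm y))

/-- The components `Dᵏᵢ = (D ∂ᵢ)ᵏ` of a field `D` of endomorphisms of the tangent spaces. -/
def endCoord (e : OpenPartialHomeomorph M (EuclideanHalfSpace n))
    (D : ∀ x : M, TangentSpace (𝓡∂ n) x →L[ℝ] TangentSpace (𝓡∂ n) x) (k i : Fin n)
    (y : EuclideanSpace ℝ (Fin n)) : ℝ :=
  vecCoord e k _ (D ((e.extend (𝓡∂ n)).symm y) (coordVec e i y))

variable [IsManifold (𝓡∂ n) ∞ M]

/-- The components `gᵢⱼ` of the metric. -/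
def metricCoord (g : Metric n M) (e : OpenPartialHomeomorph M (EuclideanHalfSpace n)) (i j : Fin n)
    (y : EuclideanSpace ℝ (Fin n)) : ℝ :=
  g.inner ((e.extend (𝓡∂ n)).symm y) (coordVec e i y) (coordVec e j y)

/-- The metric is of class `W^{1,p}`: so are its components in every smooth chart. -/
def IsW1p (g : Metric n M) (p : ℝ≥0∞) : Prop :=
  ∀ e ∈ IsManifold.maximalAtlas (𝓡∂ n) ∞ M, ∀ i j,
    MemW1pLoc p (e.extend (𝓡∂ n)).target (metricCoord g e i j)

/-- The Christoffel symbols `Γᵏᵢⱼ = ½ gᵏˡ (∂ᵢ gₗⱼ + ∂ⱼ gᵢₗ - ∂ₗ gᵢⱼ)` of the metric in the chart `e`,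
the derivatives being weak. -/
def christoffel (g : Metric n M) (e : OpenPartialHomeomorph M (EuclideanHalfSpace n))
    (k i j : Fin n) (y : EuclideanSpace ℝ (Fin n)) : ℝ :=
  1 / 2 * ∑ l, (Matrix.of fun a b => metricCoord g e a b y)⁻¹ k l *
    (weakPartial (interior (e.extend (𝓡∂ n)).target) i (metricCoord g e l j) y
      + weakPartial (interior (e.extend (𝓡∂ n)).target) j (metricCoord g e i l) y
      - weakPartial (interior (e.extend (𝓡∂ n)).target) l (metricCoord g e i j) y)

/-! ### The Riemannian measure -/

/-- `∫_{e(A)} √(det gᵢⱼ) dy`, the volume of a set `A` contained in the domain of the chart `e`. -/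
def coordVol (g : Metric n M) (e : OpenPartialHomeomorph M (EuclideanHalfSpace n)) (A : Set M) :
    ℝ≥0∞ :=
  ∫⁻ y in e.extend (𝓡∂ n) '' A,
    ENNReal.ofReal (Real.sqrt (Matrix.of fun i j => metricCoord g e i j y).det)

/-- The outer measure generated by coordinate volumes: the infimum of `∑ₘ ∫_{eₘ(Aₘ)} √(det gᵢⱼ) dy`
over countable covers by sets `Aₘ`, each contained in the domain of a smooth chart `eₘ`. -/
def outerVol (g : Metric n M) : OuterMeasure M :=
  OuterMeasure.boundedBy fun A =>
    ⨅ e ∈ IsManifold.maximalAtlas (𝓡∂ n) ∞ M, ⨅ _ : A ⊆ e.source, coordVol g e A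

lemma borel_le_caratheodory (g : Metric n M) : borel M ≤ (outerVol g).caratheodory := by
  intro s hs
  borelize M
  refine OuterMeasure.boundedBy_caratheodory fun t => ?_
  refine le_iInf₂ fun e he => le_iInf fun ht => ?_
  refine (add_le_add
    (iInf₂_le_of_le e he (iInf_le_of_le (inter_subset_left.trans ht) le_rfl))
    (iInf₂_le_of_le e he (iInf_le_of_le (sdiff_subset.trans ht) le_rfl))).trans ?_
  set f := e.extend (𝓡∂ n) with hf
  have htarget : MeasurableSet f.target := by
    rw [hf, OpenPartialHomeomorph.extend_target]
    exact (e.open_target.preimage (𝓡∂ n).continuous_symm).measurableSet.inter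
      (𝓡∂ n).isClosed_range.measurableSet
  have hsymm : ContinuousOn f.symm f.target := e.continuousOn_extend_symm
  have hB : MeasurableSet (f.target ∩ f.symm ⁻¹' s) := by
    have h1 : MeasurableSet ((f.target.domRestrict f.symm) ⁻¹' s) :=
      (continuousOn_iff_continuous_domRestrict.1 hsymm).measurable hs
    have h2 := htarget.subtype_image h1
    have h3 : (Subtype.val : f.target → _) '' ((f.target.domRestrict f.symm) ⁻¹' s) = f.target ∩ f.symm ⁻¹' s := by
      rw [domRestrict_eq, preimage_comp, Subtype.image_preimage_coe]
    rwa [h3] at h2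
  have hsrc : ∀ x ∈ t, x ∈ f.source := fun x hx => by
    rw [hf, OpenPartialHomeomorph.extend_source]; exact ht hx
  have e1 : f '' (t ∩ s) = f '' t ∩ (f.target ∩ f.symm ⁻¹' s) := by
    ext y
    constructor
    · rintro ⟨x, ⟨hxt, hxs⟩, rfl⟩
      exact ⟨⟨x, hxt, rfl⟩, f.map_source (hsrc x hxt), by
        simpa [f.left_inv (hsrc x hxt)] using hxs⟩
    · rintro ⟨⟨x, hxt, rfl⟩, -, hxs⟩
      exact ⟨x, ⟨hxt, by simpa [f.left_inv (hsrc x hxt)] using hxs⟩, rfl⟩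
  have e2 : f '' (t \ s) = f '' t \ (f.target ∩ f.symm ⁻¹' s) := by
    ext y
    constructor
    · rintro ⟨x, ⟨hxt, hxs⟩, rfl⟩
      exact ⟨⟨x, hxt, rfl⟩, fun h => hxs (by simpa [f.left_inv (hsrc x hxt)] using h.2)⟩
    · rintro ⟨⟨x, hxt, rfl⟩, h⟩
      refine ⟨x, ⟨hxt, fun hxs => h ⟨f.map_source (hsrc x hxt), ?_⟩⟩, rfl⟩
      simpa [f.left_inv (hsrc x hxt)] using hxs
  unfold coordVol
  rw [← hf, e1, e2, lintegral_inter_add_sdiff _ _ hB]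

/-- The Riemannian measure `μ^g`, on the Borel sets of `M`. -/
def riemVol [MeasurableSpace M] [BorelSpace M] (g : Metric n M) : Measure M :=
  (outerVol g).toMeasure ((BorelSpace.measurable_eq (α := M)).le.trans (borel_le_caratheodory g))

/-! ### Weak covariant derivative, conformal Killing operator, norms -/

/-- `D` is a weak covariant derivative `∇W` of the vector field `W`, with `D x X = ∇_X W`: in every
smooth chart the components of `W` are locally (up to the boundary) of class `W^{1,2}`, and
`Dᵏᵢ = ∂ᵢ Wᵏ + Γᵏᵢₗ Wˡ` almost everywhere. -/
def IsWeakCovDeriv (g : Metric n M) (W : ∀ x : M, TangentSpace (𝓡∂ n) x)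
    (D : ∀ x : M, TangentSpace (𝓡∂ n) x →L[ℝ] TangentSpace (𝓡∂ n) x) : Prop :=
  ∀ e ∈ IsManifold.maximalAtlas (𝓡∂ n) ∞ M,
    (∀ k, MemW1pLoc 2 (e.extend (𝓡∂ n)).target (fieldCoord e W k)) ∧
    ∀ k i, ∀ᵐ y ∂(volume.restrict (e.extend (𝓡∂ n)).target),
      endCoord e D k i y =
        weakPartial (interior (e.extend (𝓡∂ n)).target) i (fieldCoord e W k) y
          + ∑ l, christoffel g e k i l y * fieldCoord e W l y

open Classical in
/-- A representative of the weak covariant derivative `∇W` (unique almost everywhere); zero if `W`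
has no weak covariant derivative. -/
def weakCovDeriv (g : Metric n M) (W : ∀ x : M, TangentSpace (𝓡∂ n) x) :
    ∀ x : M, TangentSpace (𝓡∂ n) x →L[ℝ] TangentSpace (𝓡∂ n) x :=
  if h : ∃ D, IsWeakCovDeriv g W D then h.choose else fun _ => 0

/-- `∇W` with the index lowered, `(X, Y) ↦ g(∇_X W, Y)`, that is `∇ᵢWⱼ`, where `D = ∇W`. -/
def lowered (g : Metric n M) (D : ∀ x : M, TangentSpace (𝓡∂ n) x →L[ℝ] TangentSpace (𝓡∂ n) x)
    (x : M) (X Y : TangentSpace (𝓡∂ n) x) : ℝ :=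
  g.inner x (D x X) Y

/-- The conformal Killing operator `(𝕃W)ᵢⱼ = ∇ᵢWⱼ + ∇ⱼWᵢ - (2/n) ∇ᵏWₖ gᵢⱼ`. -/
def confKilling (g : Metric n M) (W : ∀ x : M, TangentSpace (𝓡∂ n) x)
    (x : M) (X Y : TangentSpace (𝓡∂ n) x) : ℝ :=
  lowered g (weakCovDeriv g W) x X Y + lowered g (weakCovDeriv g W) x Y X
    - 2 / (n : ℝ) * LinearMap.trace ℝ (TangentSpace (𝓡∂ n) x) (weakCovDeriv g W x).toLinearMap
      * g.inner x X Y

/-- The standard basis of the tangent space at `x` (which is modelled on `ℝⁿ`). -/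
def tangentBasis (n : ℕ) [NeZero n] {M : Type*} [TopologicalSpace M]
    [ChartedSpace (EuclideanHalfSpace n) M] (x : M) (i : Fin n) : TangentSpace (𝓡∂ n) x :=
  (EuclideanSpace.single i (1 : ℝ) : EuclideanSpace ℝ (Fin n))

/-- `|T|²_g = gⁱᵏ gʲˡ Tᵢⱼ Tₖₗ` at the point `x`, for a bilinear form `T` on the tangent space. -/
def formNormSq (g : Metric n M) (x : M)
    (T : TangentSpace (𝓡∂ n) x → TangentSpace (𝓡∂ n) x → ℝ) : ℝ :=
  let b := tangentBasis n x
  let G : Matrix (Fin n) (Fin n) ℝ := Matrix.of fun i j => g.inner x (b i) (b j)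
  ∑ i, ∑ j, ∑ k, ∑ l, G⁻¹ i k * G⁻¹ j l * T (b i) (b j) * T (b k) (b l)

variable [MeasurableSpace M] [BorelSpace M]

/-- `W ∈ W^{1,2}(M, TM)`: the vector field `W` has a weak covariant derivative, and both are square
integrable. -/
def MemW12 (g : Metric n M) (W : ∀ x : M, TangentSpace (𝓡∂ n) x) : Prop :=
  Integrable (fun x => g.inner x (W x) (W x)) (riemVol g) ∧
    ∃ D, IsWeakCovDeriv g W D ∧ Integrable (fun x => formNormSq g x (lowered g D x)) (riemVol g)

/-- `‖W‖_{L²(M, TM)}`. -/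
def vecL2Norm (g : Metric n M) (W : ∀ x : M, TangentSpace (𝓡∂ n) x) : ℝ :=
  Real.sqrt (∫ x, g.inner x (W x) (W x) ∂(riemVol g))

/-- `‖T‖_{L²}` for a field `T` of bilinear forms on the tangent spaces. -/
def formL2Norm (g : Metric n M)
    (T : ∀ x : M, TangentSpace (𝓡∂ n) x → TangentSpace (𝓡∂ n) x → ℝ) : ℝ :=
  Real.sqrt (∫ x, formNormSq g x (T x) ∂(riemVol g))

/-- `‖W‖_{W^{1,2}(M, TM)} = (‖W‖²_{L²} + ‖∇W‖²_{L²})^{1/2}`. -/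
def w12Norm (g : Metric n M) (W : ∀ x : M, TangentSpace (𝓡∂ n) x) : ℝ :=
  Real.sqrt (vecL2Norm g W ^ 2 + formL2Norm g (lowered g (weakCovDeriv g W)) ^ 2)

end Manifold

end LowRegKorn

end

/-!
The inequality is local up to lower order terms: if every point of `M` has a neighbourhood `U`
with `∫_U |∇W|² ≤ C (∫_M |𝕃W|² + ∫_M |W|²)` (`exists_korn_nhds`), finitely many of them cover `M`,
the estimates add up (`exists_korn`), and the constants `c₁`, `c₂` are read off.

In a chart around a given point, interior or on the boundary, the metric is close to the constant
metric `G` it has there, the Christoffel symbols are in `Lⁿ`, since `g ∈ W^{1,p'}` with `p' > n`,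
and `Dᵏᵢ = ∂ᵢWᵏ + Γᵏᵢₗ Wˡ`. After multiplication by a cutoff function one works on the open half
space, and `exists_local_korn` compares with the operator of `G`:
* the error from `g - G` is small in `L^∞` and is absorbed;
* the error `Γ W` is absorbed too, as multiplication by a function in `Lⁿ` is bounded relative to
  the gradient with arbitrarily small relative bound (`exists_integral_mul_sq_le`). This follows
  from the Sobolev inequality `W^{1,2} ⊆ L^{2n/(n-2)}` on the half space, which the even
  reflection reduces to the one on `ℝⁿ` (`exists_sobolev_halfSpace`).

There remains the inequality `∫ |∂W|² ≤ C ∫ |𝕃W|²` on the half space for a constant metric, with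
no boundary condition (`exists_korn_halfSpace_of_isTest`; smoothing extends it to `W^{1,2}`). It
is a consequence of two facts.
* For `n ≥ 3` the second derivatives of `𝕃W` determine the third derivatives of `W`
  (`killingJet_injective`): the integrability conditions of the conformal Killing equation in
  dimension at least three, in the linear algebra of jets. So for each component `u = ∂ᵢWᵏ` all
  `∂ⱼ∂ⱼu` are combinations of second derivatives of the components `e` of `𝕃W`.
* Under this condition `‖u‖ ≤ C ‖e‖` in `L²` of the half space
  (`exists_integral_sq_le_of_pd_pd_eq`). This is proved by duality and without extension
  operators. The function `u`, extended by zero, is approximated in `L²(ℝⁿ)` by a Laplacian `Δφ`.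
  A combination of `Δφ` and its reflections `y ↦ (-(k+1) y₀, y')` agrees with `Δφ` on the half
  space up to the approximation error, and is `∑ⱼ ∂ⱼ∂ⱼψⱼ` with functions `ψⱼ` that vanish to
  second order on the boundary. Two integrations by parts move the derivatives to `u`, are undone
  after `∂ⱼ∂ⱼu` has been expressed by `e`, and leave no boundary terms; and the second derivatives
  of `ψⱼ` are controlled by `Δφ`, whose norm is that of `u`.

The passage to the manifold uses that in each chart the measure `riemVol g`, defined through an
outer measure, has density `√(det gᵢⱼ)` (`setLIntegral_riemVol`), and that on compact parts of the
chart the invariant norms are equivalent to the Euclidean ones of the components.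
-/

open scoped Manifold ContDiff ENNReal Topology

noncomputable section

namespace LowRegKorn

open MeasureTheory Set

/-! ### Partial derivatives and integration by parts on the half space -/

section HalfSpaceCalculus

variable {n : ℕ}

/-- The classical partial derivative `∂ᵢ f`. -/
def pd (i : Fin n) (f : EuclideanSpace ℝ (Fin n) → ℝ) : EuclideanSpace ℝ (Fin n) → ℝ :=
  fun x => fderiv ℝ f x (EuclideanSpace.single i 1)

/-- Smooth functions with compact support on `ℝⁿ`. -/
def IsTest (f : EuclideanSpace ℝ (Fin n) → ℝ) : Prop :=
  ContDiff ℝ ∞ f ∧ HasCompactSupport f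

lemma contDiff_pd {f : EuclideanSpace ℝ (Fin n) → ℝ} (hf : ContDiff ℝ ∞ f) (i : Fin n) :
    ContDiff ℝ ∞ (pd i f) :=
  (hf.fderiv_right (m := ∞) (by simp)).clm_apply contDiff_const

lemma IsTest.pd {f : EuclideanSpace ℝ (Fin n) → ℝ} (hf : IsTest f) (i : Fin n) :
    IsTest (pd i f) :=
  ⟨contDiff_pd hf.1 i, hf.2.fderiv_apply (𝕜 := ℝ) _⟩

lemma IsTest.continuous {f : EuclideanSpace ℝ (Fin n) → ℝ} (hf : IsTest f) : Continuous f :=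
  hf.1.continuous

lemma IsTest.mul_left {f g : EuclideanSpace ℝ (Fin n) → ℝ} (hf : IsTest f)
    (hg : ContDiff ℝ ∞ g) : IsTest (fun x => g x * f x) :=
  ⟨hg.mul hf.1, hf.2.mul_left⟩

lemma IsTest.mul_right {f g : EuclideanSpace ℝ (Fin n) → ℝ} (hf : IsTest f)
    (hg : ContDiff ℝ ∞ g) : IsTest (fun x => f x * g x) :=
  ⟨hf.1.mul hg, hf.2.mul_right⟩

lemma IsTest.add {f g : EuclideanSpace ℝ (Fin n) → ℝ} (hf : IsTest f) (hg : IsTest g) :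
    IsTest (fun x => f x + g x) :=
  ⟨hf.1.add hg.1, hf.2.add hg.2⟩

lemma IsTest.const_mul {f : EuclideanSpace ℝ (Fin n) → ℝ} (hf : IsTest f) (c : ℝ) :
    IsTest (fun x => c * f x) :=
  hf.mul_left contDiff_const

lemma IsTest.sum {ι : Type*} {s : Finset ι} {f : ι → EuclideanSpace ℝ (Fin n) → ℝ}
    (hf : ∀ i ∈ s, IsTest (f i)) : IsTest (fun x => ∑ i ∈ s, f i x) := by
  classical
  induction s using Finset.induction_on with
  | empty => exact ⟨by simpa using contDiff_const, by simpa using! HasCompactSupport.zero⟩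
  | insert a s ha ih =>
    simp only [Finset.sum_insert ha]
    exact (hf a (by simp)).add (ih fun i hi => hf i (by simp [hi]))

lemma IsTest.integrable {f : EuclideanSpace ℝ (Fin n) → ℝ} (hf : IsTest f) : Integrable f :=
  hf.continuous.integrable_of_hasCompactSupport hf.2

lemma IsTest.memLp {f : EuclideanSpace ℝ (Fin n) → ℝ} (hf : IsTest f) (p : ℝ≥0∞) :
    MemLp f p :=
  hf.continuous.memLp_of_hasCompactSupport hf.2

lemma pd_add {f g : EuclideanSpace ℝ (Fin n) → ℝ} (hf : ContDiff ℝ ∞ f) (hg : ContDiff ℝ ∞ g)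
    (i : Fin n) : pd i (fun x => f x + g x) = fun x => pd i f x + pd i g x := by
  funext x
  simp only [pd]
  rw [fderiv_fun_add (hf.differentiable (by simp) x) (hg.differentiable (by simp) x)]
  rfl

lemma pd_const_mul {f : EuclideanSpace ℝ (Fin n) → ℝ} (hf : ContDiff ℝ ∞ f) (c : ℝ)
    (i : Fin n) : pd i (fun x => c * f x) = fun x => c * pd i f x := by
  funext x
  simp only [pd]
  rw [fderiv_const_mul (hf.differentiable (by simp) x)]
  rfl

lemma pd_mul {f g : EuclideanSpace ℝ (Fin n) → ℝ} (hf : ContDiff ℝ ∞ f) (hg : ContDiff ℝ ∞ g)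
    (i : Fin n) : pd i (fun x => f x * g x) = fun x => pd i f x * g x + f x * pd i g x := by
  funext x
  simp only [pd]
  rw [fderiv_fun_mul (hf.differentiable (by simp) x) (hg.differentiable (by simp) x)]
  simp
  ring

lemma pd_sum {ι : Type*} {s : Finset ι} {f : ι → EuclideanSpace ℝ (Fin n) → ℝ}
    (hf : ∀ i ∈ s, ContDiff ℝ ∞ (f i)) (i : Fin n) :
    pd i (fun x => ∑ k ∈ s, f k x) = fun x => ∑ k ∈ s, pd i (f k) x := by
  funext x
  simp only [pd]
  rw [fderiv_fun_sum fun k hk => (hf k hk).differentiable (by simp) x]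
  simp

lemma pd_comm {f : EuclideanSpace ℝ (Fin n) → ℝ} (hf : ContDiff ℝ ∞ f) (i j : Fin n) :
    pd i (pd j f) = pd j (pd i f) := by
  funext x
  have h1 : Differentiable ℝ (fderiv ℝ f) :=
    (hf.fderiv_right (m := ∞) (by simp)).differentiable (by simp)
  have key : ∀ a b : Fin n, pd a (pd b f) x
      = fderiv ℝ (fderiv ℝ f) x (EuclideanSpace.single a 1) (EuclideanSpace.single b 1) := by
    intro a b
    have : pd b f = fun y => fderiv ℝ f y (EuclideanSpace.single b 1) := rfl
    rw [this, pd, fderiv_clm_apply (h1 x) (differentiableAt_const _)]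
    simp
  rw [key, key]
  exact ((contDiff_infty.1 hf 2).contDiffAt.isSymmSndFDerivAt (by simp)) _ _

lemma exists_isTest_eq_one {K : Set (EuclideanSpace ℝ (Fin n))} (hK : IsCompact K) :
    ∃ g : EuclideanSpace ℝ (Fin n) → ℝ, IsTest g ∧ ∃ U, IsOpen U ∧ K ⊆ U ∧ ∀ x ∈ U, g x = 1 := by
  obtain ⟨R, hR⟩ := hK.isBounded.subset_ball (0 : EuclideanSpace ℝ (Fin n))
  have hpos : 0 < max R 1 := lt_of_lt_of_le one_pos (le_max_right _ _)
  let b : ContDiffBump (0 : EuclideanSpace ℝ (Fin n)) := ⟨max R 1, max R 1 + 1, hpos, by linarith⟩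
  refine ⟨b, ⟨b.contDiff, b.hasCompactSupport⟩, Metric.ball 0 (max R 1), Metric.isOpen_ball,
    hR.trans (Metric.ball_subset_ball (le_max_left _ _)), fun x hx => ?_⟩
  exact b.one_of_mem_closedBall (Metric.ball_subset_closedBall hx)

variable [NeZero n]

/-- The open half space `{y | 0 < y₀}`. -/
def halfSpace (n : ℕ) [NeZero n] : Set (EuclideanSpace ℝ (Fin n)) := {y | 0 < y 0}

lemma isOpen_halfSpace : IsOpen (halfSpace n) :=
  isOpen_lt continuous_const (by fun_prop)

lemma measurableSet_halfSpace : MeasurableSet (halfSpace n) := isOpen_halfSpace.measurableSet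

/-- The boundary hyperplane is a null set. -/
lemma ae_coord_zero_ne : ∀ᵐ x : EuclideanSpace ℝ (Fin n), x 0 ≠ 0 := by
  let ℓ : EuclideanSpace ℝ (Fin n) →ₗ[ℝ] ℝ :=
    (EuclideanSpace.proj (𝕜 := ℝ) (0 : Fin n)).toLinearMap
  refine measure_mono_null (fun x hx => ?_) (Measure.addHaar_submodule volume (LinearMap.ker ℓ) ?_)
  · simpa [ℓ] using hx
  · intro htop
    have : (EuclideanSpace.single 0 1 : EuclideanSpace ℝ (Fin n)) ∈ LinearMap.ker ℓ := by
      rw [htop]; trivial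
    simp [ℓ] at this

/-- The integral over the half space of a tangential derivative vanishes, as does that of the normal
derivative of a function that vanishes on the boundary. -/
lemma setIntegral_halfSpace_pd {f : EuclideanSpace ℝ (Fin n) → ℝ} (hf : IsTest f) (i : Fin n)
    (h : i = 0 → ∀ x : EuclideanSpace ℝ (Fin n), x 0 = 0 → f x = 0) :
    ∫ x in halfSpace n, pd i f x = 0 := by
  -- The derivative is tested against a cutoff `χ`, constant near the support of `f`.
  obtain ⟨χ, hχ, U, hU, hKU, hχ1⟩ := exists_isTest_eq_one hf.2
  have hχ' : ∀ x ∈ tsupport f, pd i χ x = 0 := by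
    intro x hx
    have : χ =ᶠ[𝓝 x] fun _ => (1 : ℝ) :=
      Filter.eventuallyEq_of_mem (hU.mem_nhds (hKU hx)) hχ1
    simp [pd, this.fderiv_eq]
  have hdiff : ∀ x, DifferentiableAt ℝ f x := fun x => hf.1.differentiable (by simp) x
  have hsupp : ∀ x, pd i f x ≠ 0 → x ∈ tsupport f := fun x hx =>
    (tsupport_fderiv_apply_subset ℝ _) (subset_tsupport _ hx)
  rw [← integral_indicator measurableSet_halfSpace]
  have e1 : (halfSpace n).indicator (pd i f)
      = fun x => χ x * (halfSpace n).indicator (pd i f) x := by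
    funext x
    by_cases hx : x ∈ halfSpace n
    · by_cases h0 : pd i f x = 0
      · simp [hx, h0]
      · simp [hχ1 x (hKU (hsupp x h0))]
    · simp [hx]
  rw [e1]
  have e2 : (fun x => pd i χ x * (halfSpace n).indicator f x) = fun _ => 0 := by
    funext x
    by_cases h0 : f x = 0
    · by_cases hx : x ∈ halfSpace n <;> simp [hx, h0]
    · simp [hχ' x (subset_tsupport _ h0)]
  by_cases hi : i = 0
  · subst hi
    -- The extension by zero is Lipschitz, so that Rademacher's integration by parts applies.
    have hb := h rfl
    obtain ⟨C, hC⟩ := hf.1.lipschitzWith_of_hasCompactSupport hf.2 (by simp)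
    have hlip : LipschitzWith C ((halfSpace n).indicator f) := by
      have hbd : ∀ x y : EuclideanSpace ℝ (Fin n), x ∈ halfSpace n → y ∉ halfSpace n →
          dist (f x) 0 ≤ C * dist x y := by
        intro x y hx hy
        simp only [halfSpace, mem_ofPred_eq, not_lt] at hx hy
        set z : EuclideanSpace ℝ (Fin n) := x - EuclideanSpace.single 0 (x 0) with hz
        have hz0 : z 0 = 0 := by simp [hz]
        have := hC.dist_le_mul x z
        rw [hb z hz0] at this
        refine this.trans (mul_le_mul_of_nonneg_left ?_ C.2)
        have h1 : dist x z = |x 0| := by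
          rw [dist_eq_norm, hz, sub_sub_cancel]; simp
        rw [h1, abs_of_pos hx, dist_eq_norm]
        have h2 : ‖(x - y) 0‖ ≤ ‖x - y‖ := PiLp.norm_apply_le _ _
        refine le_trans ?_ h2
        simp only [PiLp.sub_apply, Real.norm_eq_abs]
        exact le_trans (by linarith) (le_abs_self _)
      refine LipschitzWith.of_dist_le_mul fun x y => ?_
      by_cases hx : x ∈ halfSpace n <;> by_cases hy : y ∈ halfSpace n
      · simpa [hx, hy] using hC.dist_le_mul x y
      · simpa [hx, hy] using hbd x y hx hy
      · simpa [hx, hy, dist_comm] using hbd y x hy hx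
      · simp only [hx, hy, not_false_eq_true, indicator_of_notMem, dist_self]; positivity
    obtain ⟨Cχ, hCχ⟩ := hχ.1.lipschitzWith_of_hasCompactSupport hχ.2 (by simp)
    have key := hlip.integral_lineDeriv_mul_eq hCχ hχ.2 (μ := volume)
      (EuclideanSpace.single 0 1)
    have hL : (∫ x, χ x * (halfSpace n).indicator (pd 0 f) x)
        = ∫ x, lineDeriv ℝ ((halfSpace n).indicator f) x (EuclideanSpace.single 0 1) * χ x := by
      refine integral_congr_ae ?_
      filter_upwards [ae_coord_zero_ne (n := n)] with x hx
      rw [mul_comm]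
      congr 1
      rcases lt_or_gt_of_ne hx with hx | hx
      · have hmem : {y : EuclideanSpace ℝ (Fin n) | y 0 < 0} ∈ 𝓝 x :=
          (isOpen_lt (by fun_prop) continuous_const).mem_nhds hx
        have : (halfSpace n).indicator f =ᶠ[𝓝 x] fun _ => 0 := by
          filter_upwards [hmem] with y hy
          have : y ∉ halfSpace n := not_lt.2 (le_of_lt hy)
          simp [this]
        rw [this.lineDeriv_eq]
        have : x ∉ halfSpace n := not_lt.2 (le_of_lt hx)
        simp [this, lineDeriv]
      · have : (halfSpace n).indicator f =ᶠ[𝓝 x] f := by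
          filter_upwards [isOpen_halfSpace.mem_nhds hx] with y hy
          simp [hy]
        rw [this.lineDeriv_eq, (hdiff x).lineDeriv_eq_fderiv]
        have : x ∈ halfSpace n := hx
        simp [this, pd]
    rw [hL, key]
    have : (fun x => lineDeriv ℝ χ x (-EuclideanSpace.single 0 1) * (halfSpace n).indicator f x)
        = fun _ => 0 := by
      funext x
      rw [(hχ.1.differentiable (by simp) x).lineDeriv_eq_fderiv, map_neg]
      have := congrFun e2 x
      simp only [pd] at this
      rw [neg_mul, this, neg_zero]
    rw [this]; simp
  -- Tangential lines do not leave the half space, so that the extension by zero is differentiable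
  -- along them.
  · have hmem : ∀ (x : EuclideanSpace ℝ (Fin n)) (t : ℝ),
        x + t • EuclideanSpace.single i 1 ∈ halfSpace n ↔ x ∈ halfSpace n := by
      intro x t
      simp [halfSpace, Ne.symm hi]
    have hline : ∀ x, HasLineDerivAt ℝ ((halfSpace n).indicator f)
        ((halfSpace n).indicator (pd i f) x) x (EuclideanSpace.single i 1) := by
      intro x
      by_cases hx : x ∈ halfSpace n
      · have h1 : HasLineDerivAt ℝ f (pd i f x) x (EuclideanSpace.single i 1) :=
          (hdiff x).hasFDerivAt.hasLineDerivAt _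
        simp only [hx, indicator_of_mem]
        unfold HasLineDerivAt at h1 ⊢
        convert! h1 using 2 with t
        simp only [indicator, hmem, hx, if_true]
      · simp only [hx, not_false_eq_true, indicator_of_notMem]
        unfold HasLineDerivAt
        have : (fun t : ℝ => (halfSpace n).indicator f (x + t • EuclideanSpace.single i 1))
            = fun _ => 0 := by
          funext t
          simp only [indicator, hmem, hx, if_false]
        rw [this]
        exact hasDerivAt_const _ _
    have hIf : Integrable ((halfSpace n).indicator (pd i f)) :=
      (hf.pd i).integrable.indicator measurableSet_halfSpace
    have key := integral_bilinear_hasLineDerivAt_right_eq_neg_left_of_integrable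
      (μ := (volume : Measure (EuclideanSpace ℝ (Fin n)))) (B := ContinuousLinearMap.mul ℝ ℝ)
      (f := χ) (f' := pd i χ) (g := (halfSpace n).indicator f)
      (g' := (halfSpace n).indicator (pd i f)) (v := EuclideanSpace.single i 1)
      (by simp [e2]) (by simpa [← e1] using! hIf) ?_
      (fun x _ => (hχ.1.differentiable (by simp) x).hasFDerivAt.hasLineDerivAt _)
      (fun x _ => hline x)
    · simp only [ContinuousLinearMap.mul_apply'] at key
      rw [key, e2]; simp
    · have : Integrable ((halfSpace n).indicator (fun x => χ x * f x)) :=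
        (hf.mul_left hχ.1).integrable.indicator measurableSet_halfSpace
      refine this.congr (Filter.Eventually.of_forall fun x => ?_)
      by_cases hx : x ∈ halfSpace n <;> simp [hx]

/-- Integration by parts on the half space, against a function that vanishes on the boundary if the
derivative is normal. -/
lemma setIntegral_halfSpace_mul_pd {f g : EuclideanSpace ℝ (Fin n) → ℝ} (hf : IsTest f)
    (hg : ContDiff ℝ ∞ g) (i : Fin n)
    (h : i = 0 → ∀ x : EuclideanSpace ℝ (Fin n), x 0 = 0 → f x = 0 ∨ g x = 0) :
    ∫ x in halfSpace n, pd i f x * g x = -∫ x in halfSpace n, f x * pd i g x := by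
  have h0 := setIntegral_halfSpace_pd (hf.mul_right hg) i
    (fun hi x hx => by rcases h hi x hx with h | h <;> simp [h])
  rw [pd_mul hf.1 hg] at h0
  rw [integral_add ((hf.pd i).mul_right hg).integrable.integrableOn
    (hf.mul_right (contDiff_pd hg i)).integrable.integrableOn] at h0
  linarith

end HalfSpaceCalculus

/-! ### Laplacians of Schwartz functions are dense in `L²` -/

section LaplacianDensity

open LineDeriv Laplacian FourierTransform SchwartzMap
open scoped SchwartzMap

variable {n : ℕ}

lemma pd_schwartz (φ : 𝓢(EuclideanSpace ℝ (Fin n), ℝ)) (i : Fin n) :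
    pd i φ = (∂_{(EuclideanSpace.single i (1 : ℝ) : EuclideanSpace ℝ (Fin n))} φ :
      𝓢(EuclideanSpace ℝ (Fin n), ℝ)) := rfl

/-- The classical Laplacian `∑ᵢ ∂ᵢ∂ᵢ f`. -/
def lap (f : EuclideanSpace ℝ (Fin n) → ℝ) : EuclideanSpace ℝ (Fin n) → ℝ :=
  fun x => ∑ i, pd i (pd i f) x

lemma lap_schwartz (φ : 𝓢(EuclideanSpace ℝ (Fin n), ℝ)) :
    lap φ = (Δ φ : 𝓢(EuclideanSpace ℝ (Fin n), ℝ)) := by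
  funext x
  rw [SchwartzMap.laplacian_eq_sum (EuclideanSpace.basisFun (Fin n) ℝ)]
  simp [lap, pd_schwartz]

/-- A second derivative is controlled in `L²` by the Laplacian. -/
lemma integral_sq_pd_pd_le (φ : 𝓢(EuclideanSpace ℝ (Fin n), ℝ)) (a b : Fin n) :
    ∫ x, pd a (pd b φ) x ^ 2 ≤ ∫ x, lap φ x ^ 2 := by
  set e : Fin n → EuclideanSpace ℝ (Fin n) := fun i => EuclideanSpace.single i (1 : ℝ) with he
  have hint : ∀ f g : 𝓢(EuclideanSpace ℝ (Fin n), ℝ), Integrable (fun x => f x * g x) := by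
    intro f g
    exact (f.memLp 2).integrable_mul (g.memLp 2)
  have hcomm : ∀ (a b : Fin n) (f : 𝓢(EuclideanSpace ℝ (Fin n), ℝ)),
      (∂_{e a} (∂_{e b} f) : 𝓢(EuclideanSpace ℝ (Fin n), ℝ)) = ∂_{e b} (∂_{e a} f) := by
    intro a b f
    ext x
    exact congrFun (pd_comm (f.smooth ⊤) a b) x
  have key : ∀ a b : Fin n, ∫ x, pd a (pd b φ) x ^ 2
      = ∫ x, pd a (pd a φ) x * pd b (pd b φ) x := by
    intro a b
    have h1 := SchwartzMap.integral_mul_lineDerivOp_right_eq_neg_left (μ := volume) (𝕜 := ℝ)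
      (∂_{e a} (∂_{e b} φ)) (∂_{e b} φ) (e a)
    have h2 := SchwartzMap.integral_mul_lineDerivOp_right_eq_neg_left (μ := volume) (𝕜 := ℝ)
      (∂_{e a} (∂_{e a} φ)) (∂_{e b} φ) (e b)
    rw [← hcomm a b, ← hcomm a b φ] at h2
    calc ∫ x, pd a (pd b φ) x ^ 2
        = ∫ x, (∂_{e a} (∂_{e b} φ) : 𝓢(EuclideanSpace ℝ (Fin n), ℝ)) x
            * (∂_{e a} (∂_{e b} φ) : 𝓢(EuclideanSpace ℝ (Fin n), ℝ)) x := by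
          refine integral_congr_ae (Filter.Eventually.of_forall fun x => ?_)
          exact sq _
      _ = _ := h1.trans h2.symm
  have hsum : ∫ x, lap φ x ^ 2 = ∑ a, ∑ b, ∫ x, pd a (pd b φ) x ^ 2 := by
    simp only [key]
    have : ∀ x, lap φ x ^ 2 = ∑ a, ∑ b, pd a (pd a φ) x * pd b (pd b φ) x := by
      intro x
      rw [sq, lap, Finset.sum_mul_sum]
    simp only [this]
    refine (integral_finsetSum _ fun a _ => integrable_finsetSum _ fun b _ => hint
      (∂_{e a} (∂_{e a} φ)) (∂_{e b} (∂_{e b} φ))).trans ?_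
    refine Finset.sum_congr rfl fun a _ => ?_
    exact integral_finsetSum _ fun b _ => hint
      (∂_{e a} (∂_{e a} φ)) (∂_{e b} (∂_{e b} φ))
  rw [hsum]
  have hnn : ∀ a b : Fin n, 0 ≤ ∫ x, pd a (pd b φ) x ^ 2 :=
    fun a b => integral_nonneg fun x => sq_nonneg _
  exact (Finset.single_le_sum (f := fun b => ∫ x, pd a (pd b φ) x ^ 2)
    (fun b _ => hnn a b) (Finset.mem_univ b)).trans
    (Finset.single_le_sum (f := fun a => ∑ b, ∫ x, pd a (pd b φ) x ^ 2)
    (fun a _ => Finset.sum_nonneg fun b _ => hnn a b) (Finset.mem_univ a))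

variable [NeZero n]

/-- Laplacians of Schwartz functions are dense in `L²(ℝⁿ; ℂ)`: on the Fourier side, a function
orthogonal to all of them vanishes off the origin. -/
lemma dense_laplacian_complex :
    Dense (range fun φ : 𝓢(EuclideanSpace ℝ (Fin n), ℂ) =>
      (Δ φ : 𝓢(EuclideanSpace ℝ (Fin n), ℂ)).toLp 2 volume) := by
  let T : 𝓢(EuclideanSpace ℝ (Fin n), ℂ) →L[ℂ]
      Lp ℂ 2 (volume : Measure (EuclideanSpace ℝ (Fin n))) :=
    (SchwartzMap.toLpCLM ℂ ℂ 2 volume) ∘L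
      (laplacianCLM ℂ (EuclideanSpace ℝ (Fin n)) 𝓢(EuclideanSpace ℝ (Fin n), ℂ))
  have hT : ∀ φ, T φ = (Δ φ : 𝓢(EuclideanSpace ℝ (Fin n), ℂ)).toLp 2 := by
    intro φ
    simp only [T, ContinuousLinearMap.comp_apply, SchwartzMap.laplacianCLM_eq,
      SchwartzMap.toLpCLM_apply]
  have hrange : (range fun φ : 𝓢(EuclideanSpace ℝ (Fin n), ℂ) =>
        (Δ φ : 𝓢(EuclideanSpace ℝ (Fin n), ℂ)).toLp 2 volume)
      = (LinearMap.range T.toLinearMap :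
        Set (Lp ℂ 2 (volume : Measure (EuclideanSpace ℝ (Fin n))))) := by
    ext v
    simp [hT]
  rw [hrange, Submodule.dense_iff_topologicalClosure_eq_top,
    Submodule.topologicalClosure_eq_top_iff, Submodule.eq_bot_iff]
  intro v hv
  rw [Submodule.mem_orthogonal] at hv
  have hv' : ∀ φ : 𝓢(EuclideanSpace ℝ (Fin n), ℂ),
      inner ℂ ((Δ φ : 𝓢(EuclideanSpace ℝ (Fin n), ℂ)).toLp 2 volume) v = 0 := by
    intro φ
    exact hv _ ⟨φ, hT φ⟩
  set w : Lp ℂ 2 (volume : Measure (EuclideanSpace ℝ (Fin n))) := 𝓕 v with hw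
  have hmul : ∀ᵐ x : EuclideanSpace ℝ (Fin n), ((‖x‖ ^ 2 : ℝ) : ℂ) * w x = 0 := by
    have hloc : LocallyIntegrable
        (fun x : EuclideanSpace ℝ (Fin n) => ((‖x‖ ^ 2 : ℝ) : ℂ) * w x) := by
      have h1 : LocallyIntegrable (w : EuclideanSpace ℝ (Fin n) → ℂ) :=
        (Lp.memLp w).locallyIntegrable (by norm_num)
      have h2 : Continuous fun x : EuclideanSpace ℝ (Fin n) => ((‖x‖ ^ 2 : ℝ) : ℂ) := by fun_prop
      exact h1.continuous_mul h2
    refine ae_eq_zero_of_integral_contDiff_smul_eq_zero hloc fun η hη hηc => ?_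
    let ηc : EuclideanSpace ℝ (Fin n) → ℂ := fun x => (η x : ℂ)
    have hηc1 : ContDiff ℝ ∞ ηc := Complex.ofRealCLM.contDiff.comp hη
    have hηc2 : HasCompactSupport ηc := hηc.comp_left (g := fun x : ℝ => (x : ℂ)) (by simp)
    let ψ : 𝓢(EuclideanSpace ℝ (Fin n), ℂ) := hηc2.toSchwartzMap hηc1
    have h0 := hv' (𝓕⁻ ψ)
    have hF : 𝓕 (Δ (𝓕⁻ ψ) : 𝓢(EuclideanSpace ℝ (Fin n), ℂ))
        = (-(2 * Real.pi) ^ 2 : ℝ) •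
          smulLeftCLM ℂ (fun x : EuclideanSpace ℝ (Fin n) => ‖x‖ ^ 2) ψ := by
      rw [SchwartzMap.laplacian_eq_fourierMultiplierCLM, SchwartzMap.fourierMultiplierCLM_apply,
        FourierTransform.fourier_fourierInv_eq, ← FourierTransform.fourierInv_smul,
        FourierTransform.fourier_fourierInv_eq]
    rw [← MeasureTheory.Lp.inner_fourier_eq, SchwartzMap.toLp_fourier_eq, hF, L2.inner_def] at h0
    have h1 : ∫ x, ((-(2 * Real.pi) ^ 2 : ℝ) : ℂ) * (η x • (((‖x‖ ^ 2 : ℝ) : ℂ) * w x)) = 0 := by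
      rw [← h0]
      refine integral_congr_ae ?_
      filter_upwards [SchwartzMap.coeFn_toLp
        ((-(2 * Real.pi) ^ 2 : ℝ) •
          smulLeftCLM ℂ (fun x : EuclideanSpace ℝ (Fin n) => ‖x‖ ^ 2) ψ) 2 volume] with x hx
      rw [hx]
      have hg : (fun x : EuclideanSpace ℝ (Fin n) => ‖x‖ ^ 2).HasTemperateGrowth := by fun_prop
      have hψ : ψ x = (η x : ℂ) := rfl
      simp only [smul_apply, SchwartzMap.smulLeftCLM_apply_apply hg, hψ]
      simp only [RCLike.inner_apply, Complex.real_smul, map_mul, Complex.conj_ofReal]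
      ring
    rw [integral_const_mul] at h1
    refine (mul_eq_zero.1 h1).resolve_left ?_
    simp [Real.pi_ne_zero]
  have hw0 : w = 0 := by
    refine Lp.ext ?_
    have hz : ∀ᵐ x : EuclideanSpace ℝ (Fin n), x ≠ 0 := by
      simp [ae_iff]
    filter_upwards [hmul, hz, Lp.coeFn_zero ℂ 2
      (volume : Measure (EuclideanSpace ℝ (Fin n)))] with x hx hx0 h0
    rw [h0]
    have : ((‖x‖ ^ 2 : ℝ) : ℂ) ≠ 0 := by
      have := norm_ne_zero_iff.2 hx0
      exact_mod_cast pow_ne_zero 2 this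
    simpa using (mul_eq_zero.1 hx).resolve_left this
  have := MeasureTheory.Lp.norm_fourier_eq v
  rw [← hw, hw0, norm_zero] at this
  exact norm_eq_zero.1 this.symm

lemma exists_schwartz_lap_approx {f : EuclideanSpace ℝ (Fin n) → ℝ} (hf : MemLp f 2) {δ : ℝ}
    (hδ : 0 < δ) : ∃ φ : 𝓢(EuclideanSpace ℝ (Fin n), ℝ), ∫ x, (f x - lap φ x) ^ 2 ≤ δ := by
  have hfc : MemLp (fun x => (f x : ℂ)) 2 := hf.ofReal
  obtain ⟨_, ⟨φ, rfl⟩, hφ⟩ := dense_laplacian_complex.exists_dist_lt (hfc.toLp _)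
    (Real.sqrt_pos.2 hδ)
  let ψ : 𝓢(EuclideanSpace ℝ (Fin n), ℝ) := SchwartzMap.postcompCLM (𝕜 := ℝ) Complex.reCLM φ
  have hψ : ∀ x, lap ψ x = ((Δ φ : 𝓢(EuclideanSpace ℝ (Fin n), ℂ)) x).re := by
    intro x
    have h1 : ∀ (χ : 𝓢(EuclideanSpace ℝ (Fin n), ℂ)) (i : Fin n),
        (∂_{(EuclideanSpace.single i (1 : ℝ) : EuclideanSpace ℝ (Fin n))}
        (SchwartzMap.postcompCLM (𝕜 := ℝ) Complex.reCLM χ) : 𝓢(EuclideanSpace ℝ (Fin n), ℝ))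
        = SchwartzMap.postcompCLM (𝕜 := ℝ) Complex.reCLM
          (∂_{(EuclideanSpace.single i (1 : ℝ) : EuclideanSpace ℝ (Fin n))} χ) := by
      intro χ i
      ext y
      rw [SchwartzMap.lineDerivOp_apply_eq_fderiv, SchwartzMap.postcompCLM_apply,
        SchwartzMap.lineDerivOp_apply_eq_fderiv]
      have : (⇑(SchwartzMap.postcompCLM (𝕜 := ℝ) Complex.reCLM χ) : EuclideanSpace ℝ (Fin n) → ℝ)
        = Complex.reCLM ∘ χ := rfl
      rw [this, fderiv_comp _ Complex.reCLM.differentiableAt χ.differentiableAt]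
      simp
    have h2 : (Δ φ : 𝓢(EuclideanSpace ℝ (Fin n), ℂ))
        = ∑ i, ∂_{(EuclideanSpace.single i (1 : ℝ) : EuclideanSpace ℝ (Fin n))}
          (∂_{(EuclideanSpace.single i (1 : ℝ) : EuclideanSpace ℝ (Fin n))} φ) := by
      simpa using SchwartzMap.laplacian_eq_sum (EuclideanSpace.basisFun (Fin n) ℝ) φ
    rw [h2, sum_apply, Complex.re_sum, lap]
    refine Finset.sum_congr rfl fun i _ => ?_
    rw [pd_schwartz, pd_schwartz, h1, h1]
    rfl
  refine ⟨ψ, ?_⟩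
  have hmem : MemLp (fun x => (f x : ℂ) - (Δ φ : 𝓢(EuclideanSpace ℝ (Fin n), ℂ)) x) 2 :=
    hfc.sub ((Δ φ : 𝓢(EuclideanSpace ℝ (Fin n), ℂ)).memLp 2)
  have h2 : ∫ x, (f x - lap ψ x) ^ 2
      ≤ ∫ x, ‖(f x : ℂ) - (Δ φ : 𝓢(EuclideanSpace ℝ (Fin n), ℂ)) x‖ ^ 2 := by
    refine integral_mono_of_nonneg (Filter.Eventually.of_forall fun x => sq_nonneg _)
      (hmem.integrable_norm_pow (by norm_num)) (Filter.Eventually.of_forall fun x => ?_)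
    have : f x - lap ψ x = ((f x : ℂ) - (Δ φ : 𝓢(EuclideanSpace ℝ (Fin n), ℂ)) x).re := by simp [hψ]
    simp only [this]
    rw [← sq_abs]
    exact pow_le_pow_left₀ (abs_nonneg _) (Complex.abs_re_le_norm _) 2
  refine h2.trans ?_
  have h3 : ∫ x, ‖(f x : ℂ) - (Δ φ : 𝓢(EuclideanSpace ℝ (Fin n), ℂ)) x‖ ^ 2
      = ‖hfc.toLp _ - (Δ φ : 𝓢(EuclideanSpace ℝ (Fin n), ℂ)).toLp 2 volume‖ ^ 2 := by
    rw [← real_inner_self_eq_norm_sq, L2.inner_def]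
    refine integral_congr_ae ?_
    filter_upwards [Lp.coeFn_sub (hfc.toLp _)
        ((Δ φ : 𝓢(EuclideanSpace ℝ (Fin n), ℂ)).toLp 2 volume), hfc.coeFn_toLp,
      SchwartzMap.coeFn_toLp (Δ φ : 𝓢(EuclideanSpace ℝ (Fin n), ℂ)) 2 volume] with x h1 h2 h3
    rw [real_inner_self_eq_norm_sq, h1, Pi.sub_apply, h2, h3]
  rw [h3, ← dist_eq_norm]
  calc dist (hfc.toLp _) ((Δ φ : 𝓢(EuclideanSpace ℝ (Fin n), ℂ)).toLp 2 volume) ^ 2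
      ≤ Real.sqrt δ ^ 2 :=
        pow_le_pow_left₀ dist_nonneg hφ.le 2
    _ = δ := Real.sq_sqrt hδ.le

end LaplacianDensity

/-! ### Weighted reflections in the boundary hyperplane -/

section Reflections

open scoped SchwartzMap

variable {n : ℕ}

/-- Composition with an invertible linear map is bounded on `L²`. -/
lemma exists_integral_sq_comp_le (L : EuclideanSpace ℝ (Fin n) ≃L[ℝ] EuclideanSpace ℝ (Fin n)) :
    ∃ C : ℝ, 0 ≤ C ∧ ∀ f : EuclideanSpace ℝ (Fin n) → ℝ, MemLp f 2 →
      MemLp (fun x => f (L x)) 2 ∧ ∫ x, f (L x) ^ 2 ≤ C * ∫ x, f x ^ 2 := by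
  have hdet : LinearMap.det (L.toLinearEquiv : EuclideanSpace ℝ (Fin n) →ₗ[ℝ] _) ≠ 0 :=
    (LinearEquiv.isUnit_det' L.toLinearEquiv).ne_zero
  have hmap := Measure.map_linearMap_addHaar_eq_smul_addHaar
    (volume : Measure (EuclideanSpace ℝ (Fin n))) hdet
  set c : ℝ := |(LinearMap.det (L.toLinearEquiv : EuclideanSpace ℝ (Fin n) →ₗ[ℝ] _))⁻¹| with hc
  have hmap' : Measure.map L (volume : Measure (EuclideanSpace ℝ (Fin n)))
      = ENNReal.ofReal c • volume := hmap
  have hemb : MeasurableEmbedding L := L.toHomeomorph.measurableEmbedding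
  refine ⟨c, abs_nonneg _, fun f hf => ⟨?_, ?_⟩⟩
  · have : MemLp f 2 (Measure.map L volume) := by
      rw [hmap']; exact hf.smul_measure ENNReal.ofReal_ne_top
    exact (hemb.memLp_map_measure_iff).1 this
  · have := hemb.integral_map (μ := (volume : Measure (EuclideanSpace ℝ (Fin n))))
      (fun x => f x ^ 2)
    rw [← this, hmap', integral_smul_measure, ENNReal.toReal_ofReal (abs_nonneg _)]
    exact le_of_eq rfl

variable [NeZero n]

/-- The linear map `y ↦ (-s y₀, y')`. -/
def reflMap (n : ℕ) [NeZero n] (s : ℝ) : EuclideanSpace ℝ (Fin n) →L[ℝ] EuclideanSpace ℝ (Fin n) :=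
  ContinuousLinearMap.id ℝ _ - (s + 1) •
    (EuclideanSpace.proj (𝕜 := ℝ) (0 : Fin n)).smulRight
      (EuclideanSpace.single 0 1 : EuclideanSpace ℝ (Fin n))

lemma reflMap_apply (s : ℝ) (x : EuclideanSpace ℝ (Fin n)) :
    reflMap n s x = x - ((s + 1) * x 0) • EuclideanSpace.single 0 1 := by
  simp [reflMap, smul_smul]

lemma reflMap_apply_zero (s : ℝ) (x : EuclideanSpace ℝ (Fin n)) :
    reflMap n s x 0 = -s * x 0 := by
  rw [reflMap_apply]; simp; ring

lemma reflMap_of_zero (s : ℝ) {x : EuclideanSpace ℝ (Fin n)} (hx : x 0 = 0) :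
    reflMap n s x = x := by
  rw [reflMap_apply]; simp [hx]

lemma reflMap_single (s : ℝ) (i : Fin n) :
    reflMap n s (EuclideanSpace.single i 1)
      = (if i = 0 then -s else 1) • EuclideanSpace.single i 1 := by
  rw [reflMap_apply]
  split_ifs with h
  · subst h
    ext j
    by_cases hj : j = 0 <;> simp [hj]
  · simp [Ne.symm h]

lemma reflMap_reflMap {s : ℝ} (hs : s ≠ 0) (x : EuclideanSpace ℝ (Fin n)) :
    reflMap n s⁻¹ (reflMap n s x) = x := by
  rw [reflMap_apply, reflMap_apply_zero, reflMap_apply]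
  rw [sub_sub, ← add_smul]
  have : (s + 1) * x 0 + (s⁻¹ + 1) * (-s * x 0) = 0 := by field_simp; ring
  rw [this, zero_smul, sub_zero]

/-- `reflMap` as a linear equivalence, for `s ≠ 0`. -/
def reflEquiv (n : ℕ) [NeZero n] {s : ℝ} (hs : s ≠ 0) :
    EuclideanSpace ℝ (Fin n) ≃L[ℝ] EuclideanSpace ℝ (Fin n) :=
  ContinuousLinearEquiv.equivOfInverse (reflMap n s) (reflMap n s⁻¹) (reflMap_reflMap hs)
    (fun x => by simpa using reflMap_reflMap (inv_ne_zero hs) x)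

/-- Weights for which the combinations `reflComb` vanish on the boundary: they solve
`∑ₖ cₖ (-(k+1))^q = -1` for `q ≤ 3`. -/
def reflWeight : Fin 4 → ℝ := ![-10, 20, -15, 4]

/-- `f + ∑ₖ cₖ (-(k+1))^q f(-(k+1) y₀, y')`. It vanishes on the boundary for `q ≤ 3`, and a normal
derivative raises `q` by one. -/
def reflComb (q : ℕ) (f : EuclideanSpace ℝ (Fin n) → ℝ) : EuclideanSpace ℝ (Fin n) → ℝ :=
  fun x => f x + ∑ k : Fin 4, (reflWeight k * (-((k : ℝ) + 1)) ^ q) * f (reflMap n ((k : ℝ) + 1) x)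

lemma contDiff_reflComb {f : EuclideanSpace ℝ (Fin n) → ℝ} (hf : ContDiff ℝ ∞ f) (q : ℕ) :
    ContDiff ℝ ∞ (reflComb q f) := by
  unfold reflComb
  exact hf.add (ContDiff.sum fun k _ =>
    contDiff_const.mul (hf.comp (reflMap n ((k : ℝ) + 1)).contDiff))

lemma pd_comp_reflMap {f : EuclideanSpace ℝ (Fin n) → ℝ} (hf : ContDiff ℝ ∞ f) (s : ℝ)
    (i : Fin n) : pd i (fun x => f (reflMap n s x))
      = fun x => (if i = 0 then -s else 1) * pd i f (reflMap n s x) := by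
  funext x
  simp only [pd]
  have : (fun x => f (reflMap n s x)) = f ∘ reflMap n s := rfl
  rw [this, fderiv_comp _ (hf.differentiable (by simp) _) (reflMap n s).differentiableAt]
  simp only [ContinuousLinearMap.fderiv, ContinuousLinearMap.comp_apply, reflMap_single, map_smul,
    smul_eq_mul]

lemma pd_reflComb {f : EuclideanSpace ℝ (Fin n) → ℝ} (hf : ContDiff ℝ ∞ f) (q : ℕ) (i : Fin n) :
    pd i (reflComb q f) = reflComb (q + if i = 0 then 1 else 0) (pd i f) := by
  have hk : ∀ k : Fin 4, ContDiff ℝ ∞ fun x => f (reflMap n ((k : ℝ) + 1) x) :=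
    fun k => hf.comp (reflMap n ((k : ℝ) + 1)).contDiff
  unfold reflComb
  rw [pd_add hf (ContDiff.sum fun k _ => contDiff_const.mul (hk k)),
    pd_sum fun k _ => contDiff_const.mul (hk k)]
  funext x
  congr 1
  refine Finset.sum_congr rfl fun k _ => ?_
  rw [pd_const_mul (hk k), pd_comp_reflMap hf]
  split_ifs
  · simp only [pow_succ]; ring
  · simp

lemma reflComb_of_zero {q : ℕ} (hq : q ≤ 3) (f : EuclideanSpace ℝ (Fin n) → ℝ)
    {x : EuclideanSpace ℝ (Fin n)} (hx : x 0 = 0) : reflComb q f x = 0 := by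
  simp only [reflComb, reflMap_of_zero _ hx, Fin.sum_univ_four, reflWeight]
  interval_cases q <;> simp <;> ring

lemma reflComb_indicator (q : ℕ) (f : EuclideanSpace ℝ (Fin n) → ℝ)
    {x : EuclideanSpace ℝ (Fin n)} (hx : x ∈ halfSpace n) :
    reflComb q ((halfSpace n).indicator f) x = f x := by
  have : ∀ k : Fin 4, reflMap n ((k : ℝ) + 1) x ∉ halfSpace n := by
    intro k
    simp only [halfSpace, mem_ofPred_eq, reflMap_apply_zero, not_lt] at hx ⊢
    have : (0 : ℝ) ≤ k := by positivity
    nlinarith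
  simp [reflComb, hx, this]

lemma exists_integral_sq_reflComb_le (n : ℕ) [NeZero n] : ∃ C : ℝ, 0 ≤ C ∧ ∀ q ≤ 4,
    ∀ f : EuclideanSpace ℝ (Fin n) → ℝ, MemLp f 2 →
      MemLp (reflComb q f) 2 ∧ ∫ x in halfSpace n, reflComb q f x ^ 2 ≤ C * ∫ x, f x ^ 2 := by
  have hpos : ∀ k : Fin 4, ((k : ℝ) + 1) ≠ 0 := fun k => by positivity
  choose C hC0 hC using fun k : Fin 4 => exists_integral_sq_comp_le (reflEquiv n (hpos k))
  have hC' : ∀ (k : Fin 4) (f : EuclideanSpace ℝ (Fin n) → ℝ), MemLp f 2 →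
      MemLp (fun x => f (reflMap n ((k : ℝ) + 1) x)) 2 ∧
        ∫ x, f (reflMap n ((k : ℝ) + 1) x) ^ 2 ≤ C k * ∫ x, f x ^ 2 := fun k => hC k
  have hw : ∀ q ≤ 4, ∀ k : Fin 4, (reflWeight k * (-((k : ℝ) + 1)) ^ q) ^ 2 ≤ (20 * 256) ^ 2 := by
    intro q hq k
    rw [sq_le_sq, abs_mul, abs_of_pos (by norm_num : (0 : ℝ) < 20 * 256), abs_pow, abs_neg]
    refine mul_le_mul ?_ ?_ (by positivity) (by norm_num)
    · fin_cases k <;> norm_num [reflWeight]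
    · rw [abs_of_nonneg (by positivity)]
      have h4 : (k : ℝ) + 1 ≤ 4 := by fin_cases k <;> norm_num
      calc ((k : ℝ) + 1) ^ q ≤ 4 ^ q := pow_le_pow_left₀ (by positivity) h4 q
        _ ≤ 4 ^ 4 := pow_le_pow_right₀ (by norm_num) hq
        _ = 256 := by norm_num
  refine ⟨5 * (1 + ∑ k, (20 * 256) ^ 2 * C k), by
    have := Finset.sum_nonneg fun k (_ : k ∈ Finset.univ) =>
      mul_nonneg (by norm_num : (0 : ℝ) ≤ (20 * 256) ^ 2) (hC0 k)
    positivity,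
    fun q hq f hf => ⟨?_, ?_⟩⟩
  · exact hf.add (memLp_finsetSum _ fun k _ => (hC' k f hf).1.const_mul _)
  have hsq : ∀ x, reflComb q f x ^ 2
      ≤ 5 * (f x ^ 2 + ∑ k : Fin 4, (20 * 256) ^ 2 * f (reflMap n ((k : ℝ) + 1) x) ^ 2) := by
    intro x
    have h1 : reflComb q f x ^ 2 ≤ 5 * (f x ^ 2 + ∑ k : Fin 4,
        (reflWeight k * (-((k : ℝ) + 1)) ^ q) ^ 2 * f (reflMap n ((k : ℝ) + 1) x) ^ 2) := by
      have := sq_sum_le_card_mul_sum_sq (s := Finset.univ)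
        (f := fun k : Option (Fin 4) => k.elim (f x) fun k => reflWeight k * (-((k : ℝ) + 1)) ^ q
        * f (reflMap n ((k : ℝ) + 1) x))
      simp only [reflComb, ← mul_pow]
      simpa [Fintype.sum_option] using this
    refine h1.trans ?_
    refine mul_le_mul_of_nonneg_left (add_le_add_right (Finset.sum_le_sum fun k _ => ?_) _)
      (by norm_num)
    exact mul_le_mul_of_nonneg_right (hw q hq k) (sq_nonneg _)
  have hint : Integrable (fun x => f x ^ 2) := hf.integrable_sq
  have hintk : ∀ k : Fin 4, Integrable (fun x => f (reflMap n ((k : ℝ) + 1) x) ^ 2) :=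
    fun k => (hC' k f hf).1.integrable_sq
  have hsumint : Integrable (fun x => ∑ k : Fin 4, ((20 : ℝ) * 256) ^ 2
      * f (reflMap n ((k : ℝ) + 1) x) ^ 2) :=
    integrable_finsetSum _ fun k _ => (hintk k).const_mul _
  have hbig : Integrable (fun x => 5 * (f x ^ 2 + ∑ k : Fin 4, ((20 : ℝ) * 256) ^ 2
      * f (reflMap n ((k : ℝ) + 1) x) ^ 2)) := (hint.add hsumint).const_mul _
  calc ∫ x in halfSpace n, reflComb q f x ^ 2
      ≤ ∫ x in halfSpace n, 5 * (f x ^ 2 + ∑ k : Fin 4, ((20 : ℝ) * 256) ^ 2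
        * f (reflMap n ((k : ℝ) + 1) x) ^ 2) :=
        integral_mono_of_nonneg (Filter.Eventually.of_forall fun x => sq_nonneg _)
          hbig.integrableOn (Filter.Eventually.of_forall hsq)
    _ ≤ ∫ x, 5 * (f x ^ 2 + ∑ k : Fin 4, ((20 : ℝ) * 256) ^ 2
        * f (reflMap n ((k : ℝ) + 1) x) ^ 2) :=
        setIntegral_le_integral hbig (Filter.Eventually.of_forall fun x => by positivity)
    _ = 5 * ((∫ x, f x ^ 2) + ∑ k : Fin 4, ((20 : ℝ) * 256) ^ 2
        * ∫ x, f (reflMap n ((k : ℝ) + 1) x) ^ 2) := by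
        rw [integral_const_mul, integral_add hint hsumint,
          integral_finsetSum _ fun k _ => (hintk k).const_mul _]
        simp only [integral_const_mul]
    _ ≤ 5 * ((∫ x, f x ^ 2) + ∑ k : Fin 4, ((20 : ℝ) * 256) ^ 2 * (C k * ∫ x, f x ^ 2)) := by
        gcongr with k
        exact (hC' k f hf).2
    _ = 5 * (1 + ∑ k, (20 * 256) ^ 2 * C k) * ∫ x, f x ^ 2 := by
        rw [mul_assoc, add_mul, Finset.sum_mul, one_mul]
        simp only [mul_assoc]

/-- Two integrations by parts on the half space. -/
lemma setIntegral_halfSpace_pd_pd_mul {h ψ : EuclideanSpace ℝ (Fin n) → ℝ} (hh : IsTest h)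
    (hψ : ContDiff ℝ ∞ ψ) (h0 : ∀ x : EuclideanSpace ℝ (Fin n), x 0 = 0 → ψ x = 0)
    (a b : Fin n) (h1 : ∀ x : EuclideanSpace ℝ (Fin n), x 0 = 0 → pd a ψ x = 0) :
    ∫ x in halfSpace n, pd a (pd b h) x * ψ x = ∫ x in halfSpace n, h x * pd b (pd a ψ) x := by
  rw [setIntegral_halfSpace_mul_pd (hh.pd b) hψ a fun _ x hx => Or.inr (h0 x hx),
    setIntegral_halfSpace_mul_pd hh (contDiff_pd hψ a) b fun _ x hx => Or.inr (h1 x hx), neg_neg]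

end Reflections

/-! ### `L²` estimates on the half space for overdetermined second order equations -/

section HalfSpaceRegularity

open scoped SchwartzMap

variable {n : ℕ}

/-- Cauchy–Schwarz with a parameter. -/
lemma integral_mul_le_of_memLp {μ : Measure (EuclideanSpace ℝ (Fin n))}
    {f g : EuclideanSpace ℝ (Fin n) → ℝ} (hf : MemLp f 2 μ) (hg : MemLp g 2 μ) {t : ℝ}
    (ht : 0 < t) : |∫ x, f x * g x ∂μ| ≤ t * ∫ x, f x ^ 2 ∂μ + t⁻¹ * ∫ x, g x ^ 2 ∂μ := by
  rw [← integral_const_mul, ← integral_const_mul,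
    ← integral_add (hf.integrable_sq.const_mul _) (hg.integrable_sq.const_mul _)]
  refine abs_integral_le_integral_abs.trans (integral_mono (hf.integrable_mul hg).abs
    ((hf.integrable_sq.const_mul _).add (hg.integrable_sq.const_mul _)) fun x => ?_)
  have h1 : t * f x ^ 2 + t⁻¹ * g x ^ 2 = t⁻¹ * ((t * f x) ^ 2 + g x ^ 2) := by
    field_simp
  have h2 : |f x * g x| = t⁻¹ * (|t * f x| * |g x|) := by
    rw [abs_mul, abs_mul, abs_of_pos ht]; field_simp
  rw [h1, h2]
  refine mul_le_mul_of_nonneg_left ?_ (inv_nonneg.2 ht.le)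
  rw [← sq_abs (t * f x), ← sq_abs (g x)]
  nlinarith [sq_nonneg (|t * f x| - |g x|), abs_nonneg (t * f x), abs_nonneg (g x)]

variable [NeZero n]

lemma reflComb_sum {ι : Type*} (s : Finset ι) (q : ℕ) (f : ι → EuclideanSpace ℝ (Fin n) → ℝ) :
    reflComb q (fun x => ∑ i ∈ s, f i x) = fun x => ∑ i ∈ s, reflComb q (f i) x := by
  funext x
  simp only [reflComb, Finset.sum_add_distrib, Finset.mul_sum]
  rw [Finset.sum_comm]

lemma reflComb_sub (q : ℕ) (f g : EuclideanSpace ℝ (Fin n) → ℝ) :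
    reflComb q (fun x => f x - g x) = fun x => reflComb q f x - reflComb q g x := by
  funext x
  simp only [reflComb, mul_sub, Finset.sum_sub_distrib]
  ring

/-- The exponent `q` for which `reflComb q φ` is the potential of the `i`-th term of the reflected
Laplacian `reflComb 2 (lap φ)`. -/
def reflExp (i : Fin n) : ℕ := if i = 0 then 0 else 2

lemma reflComb_lap {φ : EuclideanSpace ℝ (Fin n) → ℝ} (hφ : ContDiff ℝ ∞ φ) :
    reflComb 2 (lap φ) = fun x => ∑ i, pd i (pd i (reflComb (reflExp i) φ)) x := by
  unfold lap
  rw [reflComb_sum]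
  funext x
  refine Finset.sum_congr rfl fun i _ => ?_
  rw [pd_reflComb hφ, pd_reflComb (contDiff_pd hφ i)]
  by_cases h : i = 0 <;> simp [h, reflExp]

/-- The test of the equations `∂ᵢ∂ᵢ u = ∑ P ∂ₐ∂_b e` against reflected Laplacians. No boundary term
appears since the reflected functions vanish to second order on the boundary. -/
lemma setIntegral_mul_reflComb_lap_le {ι : Type*} [Fintype ι]
    (P : Fin n → ι → Fin n → Fin n → ℝ) {CR : ℝ}
    (hCR : ∀ q ≤ 4, ∀ f : EuclideanSpace ℝ (Fin n) → ℝ, MemLp f 2 →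
      MemLp (reflComb q f) 2 ∧ ∫ x in halfSpace n, reflComb q f x ^ 2 ≤ CR * ∫ x, f x ^ 2)
    (hCR0 : 0 ≤ CR)
    {u : EuclideanSpace ℝ (Fin n) → ℝ} {e : ι → EuclideanSpace ℝ (Fin n) → ℝ} (hu : IsTest u)
    (he : ∀ c, IsTest (e c))
    (hP : ∀ i, ∀ x ∈ halfSpace n,
      pd i (pd i u) x = ∑ c, ∑ a, ∑ b, P i c a b * pd a (pd b (e c)) x)
    (φ : 𝓢(EuclideanSpace ℝ (Fin n), ℝ)) {t : ℝ} (ht : 0 < t) :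
    ∫ x in halfSpace n, u x * reflComb 2 (lap φ) x
      ≤ (∑ i, ∑ c, ∑ a, ∑ b, |P i c a b|)
        * (t * (∑ c, ∫ x in halfSpace n, e c x ^ 2) + t⁻¹ * (CR * ∫ x, lap φ x ^ 2)) := by
  have hφ : ContDiff ℝ ∞ φ := φ.smooth ⊤
  set ψ : Fin n → EuclideanSpace ℝ (Fin n) → ℝ := fun i => reflComb (reflExp i) φ with hψdef
  have hψ : ∀ i, ContDiff ℝ ∞ (ψ i) := fun i => contDiff_reflComb hφ _
  have hle : ∀ i : Fin n, reflExp i ≤ 2 := fun i => by unfold reflExp; split_ifs <;> norm_num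
  have hψ0 : ∀ i, ∀ x : EuclideanSpace ℝ (Fin n), x 0 = 0 → ψ i x = 0 := fun i x hx =>
    reflComb_of_zero ((hle i).trans (by norm_num)) _ hx
  have hψ1 : ∀ i a, ∀ x : EuclideanSpace ℝ (Fin n), x 0 = 0 → pd a (ψ i) x = 0 := by
    intro i a x hx
    rw [hψdef]
    simp only
    rw [pd_reflComb hφ]
    refine reflComb_of_zero ?_ _ hx
    have := hle i
    split_ifs <;> omega
  have e1 : ∫ x in halfSpace n, u x * reflComb 2 (lap φ) x
      = ∑ i, ∑ c, ∑ a, ∑ b, P i c a b * ∫ x in halfSpace n, e c x * pd b (pd a (ψ i)) x := by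
    rw [reflComb_lap hφ]
    simp only [Finset.mul_sum]
    rw [integral_finsetSum _ fun i _ =>
      (hu.mul_right (contDiff_pd (contDiff_pd (hψ i) i) i)).integrable.integrableOn]
    refine Finset.sum_congr rfl fun i _ => ?_
    rw [← setIntegral_halfSpace_pd_pd_mul hu (hψ i) (hψ0 i) i i (hψ1 i i)]
    have h2 : ∀ c a b, Integrable (fun x => P i c a b * (pd a (pd b (e c)) x * ψ i x))
        (volume.restrict (halfSpace n)) := fun c a b =>
      (((((he c).pd b).pd a).mul_right (hψ i)).integrable.const_mul _).integrableOn
    calc ∫ x in halfSpace n, pd i (pd i u) x * ψ i x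
        = ∫ x in halfSpace n, ∑ c, ∑ a, ∑ b, P i c a b * (pd a (pd b (e c)) x * ψ i x) := by
          refine setIntegral_congr_fun measurableSet_halfSpace fun x hx => ?_
          simp only [hP i x hx, Finset.sum_mul, mul_assoc]
      _ = ∑ c, ∑ a, ∑ b, ∫ x in halfSpace n, P i c a b * (pd a (pd b (e c)) x * ψ i x) := by
          rw [integral_finsetSum _ fun c _ => integrable_finsetSum _ fun a _ =>
            integrable_finsetSum _ fun b _ => h2 c a b]
          refine Finset.sum_congr rfl fun c _ => ?_
          rw [integral_finsetSum _ fun a _ => integrable_finsetSum _ fun b _ => h2 c a b]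
          refine Finset.sum_congr rfl fun a _ => ?_
          rw [integral_finsetSum _ fun b _ => h2 c a b]
      _ = _ := by
          refine Finset.sum_congr rfl fun c _ => Finset.sum_congr rfl fun a _ =>
            Finset.sum_congr rfl fun b _ => ?_
          rw [integral_const_mul, setIntegral_halfSpace_pd_pd_mul (he c) (hψ i) (hψ0 i) a b
            (hψ1 i a)]
  rw [e1]
  have hA : ∀ c, ∫ x in halfSpace n, e c x ^ 2 ≤ ∑ c, ∫ x in halfSpace n, e c x ^ 2 := fun c =>
    Finset.single_le_sum (f := fun c => ∫ x in halfSpace n, e c x ^ 2)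
      (fun c _ => integral_nonneg fun x => sq_nonneg _) (Finset.mem_univ c)
  simp only [Finset.sum_mul]
  refine Finset.sum_le_sum fun i _ => Finset.sum_le_sum fun c _ => Finset.sum_le_sum fun a _ =>
    Finset.sum_le_sum fun b _ => ?_
  refine (le_abs_self _).trans ?_
  rw [abs_mul]
  refine mul_le_mul_of_nonneg_left ?_ (abs_nonneg _)
  have hmem : MemLp (pd b (pd a φ)) 2 := by
    have := (LineDeriv.lineDerivOp (EuclideanSpace.single b (1 : ℝ) : EuclideanSpace ℝ (Fin n))
      (LineDeriv.lineDerivOp (EuclideanSpace.single a (1 : ℝ) : EuclideanSpace ℝ (Fin n)) φ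
        : 𝓢(EuclideanSpace ℝ (Fin n), ℝ)) : 𝓢(EuclideanSpace ℝ (Fin n), ℝ)).memLp 2
    exact this
  -- Second derivatives of `ψ i` are again reflected combinations, of second derivatives of `φ`.
  obtain ⟨q, hq, hpdpd⟩ : ∃ q ≤ 4, pd b (pd a (ψ i)) = reflComb q (pd b (pd a φ)) := by
    refine ⟨reflExp i + (if a = 0 then 1 else 0) + (if b = 0 then 1 else 0), ?_, ?_⟩
    · have := hle i
      split_ifs <;> omega
    · rw [hψdef]
      simp only
      rw [pd_reflComb hφ, pd_reflComb (contDiff_pd hφ a)]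
  rw [hpdpd]
  refine (integral_mul_le_of_memLp (((he c).memLp 2).restrict _)
    ((hCR q hq _ hmem).1.restrict _) ht).trans ?_
  refine add_le_add (mul_le_mul_of_nonneg_left (hA c) ht.le)
    (mul_le_mul_of_nonneg_left ?_ (inv_nonneg.2 ht.le))
  exact (hCR q hq _ hmem).2.trans (mul_le_mul_of_nonneg_left (integral_sq_pd_pd_le φ b a) hCR0)

/-- If the pure second derivatives of `u` are combinations of second derivatives of functions `e`,
then `u` is controlled by `e` in `L²` of the half space. -/
theorem exists_integral_sq_le_of_pd_pd_eq {ι : Type*} [Fintype ι]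
    (P : Fin n → ι → Fin n → Fin n → ℝ) :
    ∃ C : ℝ, 0 ≤ C ∧ ∀ (u : EuclideanSpace ℝ (Fin n) → ℝ) (e : ι → EuclideanSpace ℝ (Fin n) → ℝ),
      IsTest u → (∀ c, IsTest (e c)) →
      (∀ i, ∀ x ∈ halfSpace n,
        pd i (pd i u) x = ∑ c, ∑ a, ∑ b, P i c a b * pd a (pd b (e c)) x) →
      ∫ x in halfSpace n, u x ^ 2 ≤ C * ∑ c, ∫ x in halfSpace n, e c x ^ 2 := by
  obtain ⟨CR, hCR0, hCR⟩ := exists_integral_sq_reflComb_le n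
  set B : ℝ := ∑ i, ∑ c, ∑ a, ∑ b, |P i c a b| with hB
  have hB0 : 0 ≤ B := by positivity
  -- `t` makes `B * CR / t ≤ 1 / 8`, so that the terms with `‖u‖²` on the right can be absorbed.
  set t : ℝ := 8 * (B * CR) + 1 with ht
  have ht0 : 0 < t := by positivity
  refine ⟨2 * (B * t), by positivity, fun u e hu he hP => ?_⟩
  set X : ℝ := ∫ x in halfSpace n, u x ^ 2 with hX
  set A : ℝ := ∑ c, ∫ x in halfSpace n, e c x ^ 2 with hA
  set F : EuclideanSpace ℝ (Fin n) → ℝ := (halfSpace n).indicator u with hF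
  have huL : MemLp u 2 := hu.memLp 2
  have hFL : MemLp F 2 := huL.indicator measurableSet_halfSpace
  have hFX : ∫ x, F x ^ 2 = X := by
    rw [hX, ← integral_indicator measurableSet_halfSpace]
    refine integral_congr_ae (Filter.Eventually.of_forall fun x => ?_)
    by_cases hx : x ∈ halfSpace n <;> simp [hF, hx]
  have hX0 : 0 ≤ X := integral_nonneg fun x => sq_nonneg _
  have main : ∀ δ : ℝ, 0 < δ → X ≤ 2 * (B * t) * A + (1 / 2 + 8 * CR) * δ := by
    intro δ hδ
    obtain ⟨φ, hφ⟩ := exists_schwartz_lap_approx hFL hδ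
    have hlapL : MemLp (lap φ) 2 := by
      rw [lap_schwartz]
      exact (Laplacian.laplacian φ : 𝓢(EuclideanSpace ℝ (Fin n), ℝ)).memLp 2
    have hdL : MemLp (fun x => F x - lap φ x) 2 := hFL.sub hlapL
    have h1 := setIntegral_mul_reflComb_lap_le P hCR hCR0 hu he hP φ ht0
    have h2 : ∫ x, lap φ x ^ 2 ≤ 2 * X + 2 * δ := by
      have : ∫ x, lap φ x ^ 2 ≤ ∫ x, (2 * F x ^ 2 + 2 * (F x - lap φ x) ^ 2) := by
        refine integral_mono hlapL.integrable_sq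
          ((hFL.integrable_sq.const_mul _).add (hdL.integrable_sq.const_mul _)) fun x => ?_
        simp only
        nlinarith [sq_nonneg (2 * F x - lap φ x)]
      rw [integral_add (hFL.integrable_sq.const_mul _) (hdL.integrable_sq.const_mul _),
        integral_const_mul, integral_const_mul, hFX] at this
      linarith
    -- On the half space `u` coincides with the reflected combination of its extension by zero.
    have h3 : X = (∫ x in halfSpace n, u x * reflComb 2 (lap φ) x)
        + ∫ x in halfSpace n, u x * reflComb 2 (fun x => F x - lap φ x) x := by
      rw [← integral_add]
      · refine setIntegral_congr_fun measurableSet_halfSpace fun x hx => ?_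
        have h7 := reflComb_indicator 2 u hx
        simp only [reflComb_sub, hF, h7]
        ring
      · exact (huL.restrict _).integrable_mul ((hCR 2 (by norm_num) _ hlapL).1.restrict _)
      · exact (huL.restrict _).integrable_mul ((hCR 2 (by norm_num) _ hdL).1.restrict _)
    have h4 := (le_abs_self _).trans (integral_mul_le_of_memLp (huL.restrict (halfSpace n))
      ((hCR 2 (by norm_num) _ hdL).1.restrict (halfSpace n)) (t := 1 / 4) (by norm_num))
    have h5 := (hCR 2 (by norm_num) _ hdL).2
    have h6 : CR * ∫ x, (F x - lap φ x) ^ 2 ≤ CR * δ := mul_le_mul_of_nonneg_left hφ hCR0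
    have h7 : B * (t⁻¹ * (CR * ∫ x, lap φ x ^ 2)) ≤ (2 * X + 2 * δ) / 8 := by
      have : B * CR / t ≤ 1 / 8 := by
        rw [div_le_div_iff₀ ht0 (by norm_num)]; linarith
      calc B * (t⁻¹ * (CR * ∫ x, lap φ x ^ 2)) = B * CR / t * ∫ x, lap φ x ^ 2 := by
            field_simp
        _ ≤ 1 / 8 * (2 * X + 2 * δ) := by
            refine mul_le_mul this h2 (integral_nonneg fun x => sq_nonneg _) (by norm_num)
        _ = _ := by ring
    rw [mul_add] at h1
    norm_num at h4
    nlinarith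
  refine le_of_forall_pos_le_add fun ε hε => ?_
  have hK : 0 < 1 / 2 + 8 * CR := by positivity
  have := main (ε / (1 / 2 + 8 * CR)) (div_pos hε hK)
  rwa [mul_div_cancel₀ _ hK.ne'] at this

end HalfSpaceRegularity

/-! ### The conformal Killing operator of a constant metric -/

section SmoothKorn

variable {n : ℕ}

/-- The conformal Killing operator of the constant metric `G` on a matrix `a`, the entry `a i k`
standing for `∂ᵢ Wᵏ`. -/
def killingMat (G : Matrix (Fin n) (Fin n) ℝ) (a : Fin n → Fin n → ℝ) (i j : Fin n) : ℝ :=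
  (∑ k, G j k * a i k) + (∑ k, G i k * a j k) - 2 / (n : ℝ) * (∑ k, a k k) * G i j

/-- Arrays `D a b i k`, standing for `∂ₐ ∂_b ∂ᵢ Wᵏ`, symmetric in the derivatives. -/
def thirdJets (n : ℕ) : Submodule ℝ (Fin n → Fin n → Fin n → Fin n → ℝ) where
  carrier := {D | ∀ a b i k, D a b i k = D b a i k ∧ D a b i k = D a i b k}
  add_mem' := fun hx hy a b i k => ⟨by simp [(hx a b i k).1, (hy a b i k).1],
    by simp only [Pi.add_apply]; rw [(hx a b i k).2, (hy a b i k).2]⟩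
  zero_mem' := fun a b i k => ⟨rfl, rfl⟩
  smul_mem' := fun c x hx a b i k => ⟨by simp [(hx a b i k).1],
    by simp only [Pi.smul_apply]; rw [(hx a b i k).2]⟩

/-- The map `∂∂∂W ↦ ∂∂(𝕃W)`. -/
def killingJet (G : Matrix (Fin n) (Fin n) ℝ) :
    thirdJets n →ₗ[ℝ] ((Fin n × Fin n) × Fin n × Fin n → ℝ) where
  toFun D := fun c => killingMat G (D.1 c.2.1 c.2.2) c.1.1 c.1.2
  map_add' D D' := by
    funext c
    simp only [killingMat, Submodule.coe_add, Pi.add_apply, mul_add, Finset.sum_add_distrib,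
      add_mul]
    ring
  map_smul' r D := by
    funext c
    simp only [killingMat, SetLike.val_smul, Pi.smul_apply, smul_eq_mul, RingHom.id_apply,
      mul_left_comm _ r, ← Finset.mul_sum]
    ring

/-- For `n ≥ 3` the second derivatives of the conformal Killing operator determine the third
derivatives of the field: conformal Killing fields of a flat metric are quadratic.

If `∂ₐ∂_b(𝕃W) = 0`, then `L_{abij} = ∂ₐ∂_b∂ᵢWⱼ` satisfies `L_{abij} + L_{abji} = h_{ab} G_{ij}`,
where `h` is `2/n` times the Hessian of the divergence. As in the Koszul formula this expresses `L`
by `h`. The symmetry of `L` in its first three indices becomes a curvature-like identity for `h`,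
whose trace is `(n - 2) h = -τ G`, with `τ` the trace of `h`. A further trace gives `(2n - 2) τ =
0`, hence `τ = 0`, and `h = 0` since `n > 2`. -/
lemma killingJet_injective (hn : 3 ≤ n) {G : Matrix (Fin n) (Fin n) ℝ} (hG : G.IsSymm)
    (hGu : IsUnit G.det) : Function.Injective (killingJet G) := by
  rw [injective_iff_map_eq_zero]
  intro D hD
  have hn3 : (3 : ℝ) ≤ n := by exact_mod_cast hn
  have hsym : ∀ i j, G i j = G j i := fun i j => by rw [← hG.apply]
  have hGi : ∀ a i, ∑ k, G a k * G⁻¹ k i = if a = i then 1 else 0 := by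
    intro a i
    rw [← Matrix.mul_apply, Matrix.mul_nonsing_inv _ hGu, Matrix.one_apply]
  have hiG : ∀ a i, ∑ k, G⁻¹ a k * G k i = if a = i then 1 else 0 := by
    intro a i
    rw [← Matrix.mul_apply, Matrix.nonsing_inv_mul _ hGu, Matrix.one_apply]
  set L : Fin n → Fin n → Fin n → Fin n → ℝ := fun a b i j => ∑ k, G j k * D.1 a b i k with hL
  set h : Fin n → Fin n → ℝ := fun a b => 2 / (n : ℝ) * ∑ k, D.1 a b k k with hh
  have hL1 : ∀ a b i j, L a b i j = L b a i j := fun a b i j => by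
    simp only [hL]
    exact Finset.sum_congr rfl fun k _ => by rw [(D.2 a b i k).1]
  have hL2 : ∀ a b i j, L a b i j = L a i b j := fun a b i j => by
    simp only [hL]
    exact Finset.sum_congr rfl fun k _ => by rw [(D.2 a b i k).2]
  have hε : ∀ a b i j, L a b i j + L a b j i = h a b * G i j := by
    intro a b i j
    have := congrFun hD ((i, j), a, b)
    simp only [killingJet, killingMat, LinearMap.coe_mk, AddHom.coe_mk, Pi.zero_apply] at this
    simp only [hL, hh]
    linarith
  -- the alternating sum over cyclic permutations, as in the Koszul formula
  have h2L : ∀ a i j k, 2 * L a i j k = h a i * G j k + h a j * G i k - h a k * G i j := by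
    intro a i j k
    rw [← hε, ← hε, ← hε, hL2 a i k j, hL2 a j i k, hL2 a j k i]
    ring
  have hcomp : ∀ a i j k, h a j * G i k - h a k * G i j = h i j * G a k - h i k * G a j := by
    intro a i j k
    have h1 := h2L a i j k
    have h2 := h2L i a j k
    rw [hL1 i a] at h2
    have h3 : h a i = h i a := by
      simp only [hh]
      congr 1
      exact Finset.sum_congr rfl fun k _ => (D.2 a i k k).1
    rw [h3] at h1
    linarith
  set τ : ℝ := ∑ k, ∑ i, G⁻¹ k i * h i k with hτ
  -- the trace of `hcomp` over `i` and `k`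
  have hric : ∀ a j, (n : ℝ) * h a j - h a j = h a j - τ * G a j := by
    intro a j
    have key : ∑ k, ∑ i, G⁻¹ k i * (h a j * G i k - h a k * G i j)
        = ∑ k, ∑ i, G⁻¹ k i * (h i j * G a k - h i k * G a j) := by
      simp only [hcomp a]
    have e1 : ∑ k, ∑ i, G⁻¹ k i * (h a j * G i k) = n * h a j := by
      have : ∀ k i, G⁻¹ k i * (h a j * G i k) = h a j * (G⁻¹ k i * G i k) := fun k i => by ring
      simp only [this, ← Finset.mul_sum, hiG]
      simp [mul_comm]
    have e2 : ∑ k, ∑ i, G⁻¹ k i * (h a k * G i j) = h a j := by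
      have : ∀ k i, G⁻¹ k i * (h a k * G i j) = h a k * (G⁻¹ k i * G i j) := fun k i => by ring
      simp only [this, ← Finset.mul_sum, hiG]
      simp
    have e3 : ∑ k, ∑ i, G⁻¹ k i * (h i j * G a k) = h a j := by
      rw [Finset.sum_comm]
      have : ∀ i k, G⁻¹ k i * (h i j * G a k) = h i j * (G a k * G⁻¹ k i) := fun k i => by ring
      simp only [this, ← Finset.mul_sum, hGi]
      simp
    have e4 : ∑ k, ∑ i, G⁻¹ k i * (h i k * G a j) = τ * G a j := by
      simp only [hτ, Finset.sum_mul, mul_assoc]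
    simp only [mul_sub, Finset.sum_sub_distrib] at key
    rw [e1, e2, e3, e4] at key
    exact key
  have hτ0 : τ = 0 := by
    have key : ∑ k, ∑ i, G⁻¹ k i * (((n : ℝ) - 2) * h i k)
        = ∑ k, ∑ i, G⁻¹ k i * (-τ * G i k) := by
      refine Finset.sum_congr rfl fun k _ => Finset.sum_congr rfl fun i _ => ?_
      have := hric i k
      rw [show ((n : ℝ) - 2) * h i k = -τ * G i k by linarith]
    have e1 : ∑ k, ∑ i, G⁻¹ k i * (((n : ℝ) - 2) * h i k) = ((n : ℝ) - 2) * τ := by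
      simp only [hτ, Finset.mul_sum, mul_left_comm]
    have e2 : ∑ k, ∑ i, G⁻¹ k i * (-τ * G i k) = -τ * n := by
      have : ∀ k i, G⁻¹ k i * (-τ * G i k) = -τ * (G⁻¹ k i * G i k) := fun k i => by ring
      simp only [this, ← Finset.mul_sum, hiG]
      simp
    rw [e1, e2] at key
    have : (2 * (n : ℝ) - 2) * τ = 0 := by linarith
    rcases mul_eq_zero.1 this with h | h
    · linarith
    · exact h
  have hh0 : ∀ a j, h a j = 0 := by
    intro a j
    have := hric a j
    rw [hτ0] at this
    have : ((n : ℝ) - 2) * h a j = 0 := by linarith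
    rcases mul_eq_zero.1 this with h | h
    · linarith
    · exact h
  have hL0 : ∀ a b i j, L a b i j = 0 := by
    intro a b i j
    have := h2L a b i j
    simp only [hh0] at this
    linarith
  ext a b i k
  have e : ∑ j, G⁻¹ k j * L a b i j = D.1 a b i k := by
    simp only [hL, Finset.mul_sum]
    rw [Finset.sum_comm]
    simp only [← mul_assoc, ← Finset.sum_mul, hiG]
    simp
  simp only [hL0] at e
  simpa using e.symm

/-- The conformal Killing operator of the constant metric `G` on smooth vector fields. -/
def flatKilling (G : Matrix (Fin n) (Fin n) ℝ) (W : Fin n → EuclideanSpace ℝ (Fin n) → ℝ)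
    (c : Fin n × Fin n) (x : EuclideanSpace ℝ (Fin n)) : ℝ :=
  killingMat G (fun i k => pd i (W k) x) c.1 c.2

lemma isTest_flatKilling (G : Matrix (Fin n) (Fin n) ℝ)
    {W : Fin n → EuclideanSpace ℝ (Fin n) → ℝ} (hW : ∀ k, IsTest (W k)) (c : Fin n × Fin n) :
    IsTest (flatKilling G W c) := by
  have : flatKilling G W c = fun x => (∑ k, G c.2 k * pd c.1 (W k) x)
      + (∑ k, G c.1 k * pd c.2 (W k) x) + ∑ k, (-(2 / (n : ℝ) * G c.1 c.2)) * pd k (W k) x := by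
    funext x
    simp only [flatKilling, killingMat, ← Finset.mul_sum]
    ring
  rw [this]
  refine ((IsTest.sum fun k _ => ?_).add (IsTest.sum fun k _ => ?_)).add (IsTest.sum fun k _ => ?_)
  all_goals exact ((hW _).pd _).const_mul _

lemma pd_pd_flatKilling (G : Matrix (Fin n) (Fin n) ℝ)
    {W : Fin n → EuclideanSpace ℝ (Fin n) → ℝ} (hW : ∀ k, IsTest (W k)) (c : Fin n × Fin n)
    (a b : Fin n) (x : EuclideanSpace ℝ (Fin n)) :
    pd a (pd b (flatKilling G W c)) x
      = killingMat G (fun i k => pd a (pd b (pd i (W k))) x) c.1 c.2 := by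
  have h1 : flatKilling G W c = fun x => (∑ k, G c.2 k * pd c.1 (W k) x)
      + (∑ k, G c.1 k * pd c.2 (W k) x) + ∑ k, (-(2 / (n : ℝ) * G c.1 c.2)) * pd k (W k) x := by
    funext x
    simp only [flatKilling, killingMat, ← Finset.mul_sum]
    ring
  have hs : ∀ (f : Fin n → EuclideanSpace ℝ (Fin n) → ℝ) (r : Fin n → ℝ) (i : Fin n),
      (∀ k, IsTest (f k)) → pd i (fun x => ∑ k, r k * f k x)
        = fun x => ∑ k, r k * pd i (f k) x := by
    intro f r i hf
    rw [pd_sum fun k _ => ((hf k).const_mul _).1]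
    funext x
    exact Finset.sum_congr rfl fun k _ => by rw [pd_const_mul (hf k).1]
  have ht : ∀ (f : Fin n → EuclideanSpace ℝ (Fin n) → ℝ) (r : Fin n → ℝ),
      (∀ k, IsTest (f k)) → IsTest (fun x => ∑ k, r k * f k x) := fun f r hf =>
    IsTest.sum fun k _ => (hf k).const_mul _
  have hstep : ∀ (f1 f2 f3 : Fin n → EuclideanSpace ℝ (Fin n) → ℝ) (r1 r2 r3 : Fin n → ℝ)
      (i : Fin n), (∀ k, IsTest (f1 k)) → (∀ k, IsTest (f2 k)) → (∀ k, IsTest (f3 k)) →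
      pd i (fun x => (∑ k, r1 k * f1 k x) + (∑ k, r2 k * f2 k x) + ∑ k, r3 k * f3 k x)
      = fun x => (∑ k, r1 k * pd i (f1 k) x) + (∑ k, r2 k * pd i (f2 k) x)
        + ∑ k, r3 k * pd i (f3 k) x := by
    intro f1 f2 f3 r1 r2 r3 i h1 h2 h3
    rw [pd_add ((ht f1 r1 h1).add (ht f2 r2 h2)).1 (ht f3 r3 h3).1,
      pd_add (ht f1 r1 h1).1 (ht f2 r2 h2).1, hs f1 r1 i h1, hs f2 r2 i h2, hs f3 r3 i h3]
  rw [h1, hstep (fun k => pd c.1 (W k)) (fun k => pd c.2 (W k)) (fun k => pd k (W k)) _ _ _ b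
    (fun k => (hW k).pd _) (fun k => (hW k).pd _) (fun k => (hW k).pd _),
    hstep (fun k => pd b (pd c.1 (W k))) (fun k => pd b (pd c.2 (W k)))
      (fun k => pd b (pd k (W k))) _ _ _ a
    (fun k => ((hW k).pd _).pd _) (fun k => ((hW k).pd _).pd _) (fun k => ((hW k).pd _).pd _)]
  simp only [killingMat, ← Finset.mul_sum]
  ring

variable [NeZero n]

/-- The trace-free Korn inequality on the half space, for a constant metric and smooth fields with
compact support. -/
theorem exists_korn_halfSpace_of_isTest (hn : 3 ≤ n) {G : Matrix (Fin n) (Fin n) ℝ}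
    (hG : G.IsSymm) (hGu : IsUnit G.det) :
    ∃ C : ℝ, 0 ≤ C ∧ ∀ W : Fin n → EuclideanSpace ℝ (Fin n) → ℝ, (∀ k, IsTest (W k)) →
      ∀ i k, ∫ x in halfSpace n, pd i (W k) x ^ 2
        ≤ C * ∑ c, ∫ x in halfSpace n, flatKilling G W c x ^ 2 := by
  obtain ⟨Λ, hΛ⟩ := (killingJet G).exists_leftInverse_of_injective
    (LinearMap.ker_eq_bot.2 (killingJet_injective hn hG hGu))
  -- The coefficients express `∂ⱼ∂ⱼ∂ᵢWᵏ` by second derivatives of the conformal Killing operator.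
  let P : Fin n → Fin n → Fin n → (Fin n × Fin n) → Fin n → Fin n → ℝ := fun i k j c a b =>
    (Λ (fun d => if (c, a, b) = d then 1 else 0)).1 j j i k
  choose C hC0 hC using fun i k => exists_integral_sq_le_of_pd_pd_eq (P i k)
  refine ⟨∑ i, ∑ k, C i k, Finset.sum_nonneg fun i _ => Finset.sum_nonneg fun k _ => hC0 i k,
    fun W hW i k => ?_⟩
  have h1 := hC i k (pd i (W k)) (flatKilling G W) ((hW k).pd i) (isTest_flatKilling G hW) ?_
  · refine h1.trans (mul_le_mul_of_nonneg_right ?_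
      (Finset.sum_nonneg fun c _ => integral_nonneg fun x => sq_nonneg _))
    exact (Finset.single_le_sum (f := fun k => C i k) (fun k _ => hC0 i k)
      (Finset.mem_univ k)).trans (Finset.single_le_sum (f := fun i => ∑ k, C i k)
      (fun i _ => Finset.sum_nonneg fun k _ => hC0 i k) (Finset.mem_univ i))
  · intro j x _
    let D : thirdJets n := ⟨fun a b i k => pd a (pd b (pd i (W k))) x, fun a b i k =>
      ⟨congrFun (pd_comm ((hW k).pd i).1 a b) x, by
        simp only
        rw [pd_comm (hW k).1 b i]⟩⟩
    have hD : Λ (killingJet G D) = D := LinearMap.congr_fun hΛ D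
    have h2 : pd j (pd j (pd i (W k))) x = D.1 j j i k := rfl
    rw [h2, ← hD, LinearMap.pi_apply_eq_sum_univ Λ (killingJet G D)]
    have h3 : ∀ c : (Fin n × Fin n) × Fin n × Fin n,
        killingJet G D c = pd c.2.1 (pd c.2.2 (flatKilling G W c.1)) x := fun c =>
      (pd_pd_flatKilling G hW c.1 c.2.1 c.2.2 x).symm
    simp only [Fintype.sum_prod_type, h3, P]
    simp only [AddSubmonoidClass.coe_finsetSum, Finset.sum_apply, SetLike.val_smul,
      Pi.smul_apply, smul_eq_mul, mul_comm]

end SmoothKorn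

/-! ### Smooth approximation on the half space -/

section Smoothing

open scoped Convolution

variable {n : ℕ}

/-- Smooth averaging kernels supported in the ball of radius `r`. -/
structure IsKernel (r : ℝ) (ρ : EuclideanSpace ℝ (Fin n) → ℝ) : Prop where
  test : IsTest ρ
  nonneg : ∀ x, 0 ≤ ρ x
  integral_eq_one : ∫ x, ρ x = 1
  support_subset : Function.support ρ ⊆ Metric.ball 0 r

/-- The average `∫ ρ(t) f(x - t) dt`. -/
def mollify (ρ f : EuclideanSpace ℝ (Fin n) → ℝ) (x : EuclideanSpace ℝ (Fin n)) : ℝ :=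
  ∫ t, ρ t * f (x - t)

lemma mollify_eq_convolution (ρ f : EuclideanSpace ℝ (Fin n) → ℝ) :
    mollify ρ f = ρ ⋆[ContinuousLinearMap.lsmul ℝ ℝ, volume] f := rfl

lemma IsKernel.integrable_mul {r : ℝ} {ρ : EuclideanSpace ℝ (Fin n) → ℝ} (hρ : IsKernel r ρ)
    {f : EuclideanSpace ℝ (Fin n) → ℝ} (hf : LocallyIntegrable f) (x : EuclideanSpace ℝ (Fin n)) :
    Integrable fun t => ρ t * f (x - t) :=
  hρ.test.2.convolutionExists_left (ContinuousLinearMap.lsmul ℝ ℝ) hρ.test.continuous hf x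

/-- Averaging is a contraction of `L²`. -/
lemma IsKernel.mollify_sq_le {r : ℝ} {ρ : EuclideanSpace ℝ (Fin n) → ℝ} (hρ : IsKernel r ρ)
    {f : EuclideanSpace ℝ (Fin n) → ℝ} (hf : MemLp f 2) :
    MemLp (mollify ρ f) 2 ∧ ∫ x, mollify ρ f x ^ 2 ≤ ∫ x, f x ^ 2 := by
  have hfloc : LocallyIntegrable f := hf.locallyIntegrable (by norm_num)
  have hf2 : Integrable (fun x => f x ^ 2) := hf.integrable_sq
  have hpt : ∀ x, mollify ρ f x ^ 2 ≤ mollify ρ (fun y => f y ^ 2) x := by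
    intro x
    have h1 := hρ.integrable_mul hfloc x
    have h2 := hρ.integrable_mul hf2.locallyIntegrable x
    have h3 : Integrable ρ := hρ.test.integrable
    set m := mollify ρ f x with hm
    have h0 : 0 ≤ ∫ t, (ρ t * f (x - t) ^ 2 - 2 * m * (ρ t * f (x - t)) + m ^ 2 * ρ t) := by
      refine integral_nonneg fun t => ?_
      have : ρ t * f (x - t) ^ 2 - 2 * m * (ρ t * f (x - t)) + m ^ 2 * ρ t
        = ρ t * (f (x - t) - m) ^ 2 := by ring
      simp only [this]
      exact mul_nonneg (hρ.nonneg t) (sq_nonneg _)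
    have h12 : Integrable fun t => ρ t * f (x - t) ^ 2 - 2 * m * (ρ t * f (x - t)) :=
      h2.sub (h1.const_mul _)
    rw [integral_add h12 (h3.const_mul _), integral_sub h2 (h1.const_mul _),
      integral_const_mul, integral_const_mul, hρ.integral_eq_one] at h0
    have e : ∫ t, ρ t * f (x - t) = m := rfl
    rw [e] at h0
    have e2 : mollify ρ (fun y => f y ^ 2) x = ∫ t, ρ t * f (x - t) ^ 2 := rfl
    rw [e2]
    nlinarith
  have hcont : Continuous (mollify ρ f) :=
    hρ.test.2.continuous_convolution_left (ContinuousLinearMap.lsmul ℝ ℝ) hρ.test.continuous hfloc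
  have hint : Integrable (mollify ρ fun y => f y ^ 2) :=
    hρ.test.integrable.integrable_convolution (ContinuousLinearMap.lsmul ℝ ℝ) hf2
  have hsq : Integrable (fun x => mollify ρ f x ^ 2) :=
    hint.mono' (hcont.pow 2).aestronglyMeasurable (Filter.Eventually.of_forall fun x => by
      rw [Real.norm_of_nonneg (sq_nonneg _)]; exact hpt x)
  refine ⟨(memLp_two_iff_integrable_sq hcont.aestronglyMeasurable).2 hsq, ?_⟩
  refine (integral_mono hsq hint hpt).trans (le_of_eq ?_)
  have := integral_convolution (μ := (volume : Measure (EuclideanSpace ℝ (Fin n))))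
    (ν := (volume : Measure (EuclideanSpace ℝ (Fin n))))
    (ContinuousLinearMap.lsmul ℝ ℝ) hρ.test.integrable hf2
  rw [mollify_eq_convolution, this, hρ.integral_eq_one]
  simp

lemma IsKernel.mollify_sub {r : ℝ} {ρ : EuclideanSpace ℝ (Fin n) → ℝ} (hρ : IsKernel r ρ)
    {f g : EuclideanSpace ℝ (Fin n) → ℝ} (hf : LocallyIntegrable f) (hg : LocallyIntegrable g)
    (x : EuclideanSpace ℝ (Fin n)) :
    mollify ρ (fun y => f y - g y) x = mollify ρ f x - mollify ρ g x := by
  simp only [mollify, mul_sub]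
  exact integral_sub (hρ.integrable_mul hf x) (hρ.integrable_mul hg x)

/-- Averages at small scale converge in `L²`, uniformly in the kernel. -/
lemma exists_kernel_radius {f : EuclideanSpace ℝ (Fin n) → ℝ} (hf : MemLp f 2) {δ : ℝ}
    (hδ : 0 < δ) : ∃ r₀ : ℝ, 0 < r₀ ∧ ∀ r ≤ r₀, ∀ ρ : EuclideanSpace ℝ (Fin n) → ℝ,
      IsKernel r ρ → ∫ x, (mollify ρ f x - f x) ^ 2 ≤ δ := by
  -- `f` is approximated by a test function `h`, and the error is split into three terms.
  have hε : 0 < Real.sqrt (δ / 9) := Real.sqrt_pos.2 (by positivity)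
  obtain ⟨h, hhc, hhs, hfh⟩ := hf.exist_eLpNorm_sub_le (by norm_num) (by norm_num) hε
  have hh : IsTest h := ⟨hhs, hhc⟩
  have hhL : MemLp h 2 := hh.memLp 2
  have hdL : MemLp (fun x => f x - h x) 2 := hf.sub hhL
  have hd : ∫ x, (f x - h x) ^ 2 ≤ δ / 9 := by
    have h1 : eLpNorm (fun x => f x - h x) 2 volume ≤ ENNReal.ofReal (Real.sqrt (δ / 9)) := hfh
    rw [hdL.eLpNorm_eq_integral_rpow_norm (by norm_num) (by norm_num)] at h1
    have h2 := (ENNReal.ofReal_le_ofReal_iff hε.le).1 h1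
    simp only [ENNReal.toReal_ofNat, Real.rpow_two, Real.norm_eq_abs, sq_abs] at h2
    rw [← one_div, ← Real.sqrt_eq_rpow] at h2
    exact (Real.sqrt_le_sqrt_iff (by positivity)).1 h2
  obtain ⟨L, hL⟩ := hhs.lipschitzWith_of_hasCompactSupport hhc (by simp)
  obtain ⟨R, hR⟩ := hhc.isBounded.subset_ball (0 : EuclideanSpace ℝ (Fin n))
  set B : Set (EuclideanSpace ℝ (Fin n)) := Metric.ball 0 (R + 1) with hB
  set v : ℝ := (volume B).toReal with hv
  have hv0 : 0 ≤ v := ENNReal.toReal_nonneg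
  refine ⟨min 1 (δ / (9 * ((L : ℝ) ^ 2 * v + 1))), by positivity, fun r hr ρ hρ => ?_⟩
  have hr1 : r ≤ 1 := hr.trans (min_le_left _ _)
  have hr2 : r ≤ δ / (9 * ((L : ℝ) ^ 2 * v + 1)) := hr.trans (min_le_right _ _)
  have hr0 : 0 ≤ r := by
    -- for negative `r` the kernel would vanish identically
    by_contra hneg
    have hemp : Function.support ρ ⊆ ∅ := by
      have := hρ.support_subset
      rwa [Metric.ball_eq_empty.2 (not_le.1 hneg).le] at this
    have : ρ = 0 := Function.support_eq_empty_iff.1 (subset_empty_iff.1 hemp)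
    have h1 := hρ.integral_eq_one
    simp [this] at h1
  have hclose : ∀ x, |mollify ρ h x - h x| ≤ L * r := by
    intro x
    have := dist_convolution_le (f := ρ) (g := h) (x₀ := x) (R := r) (z₀ := h x)
      (μ := (volume : Measure (EuclideanSpace ℝ (Fin n)))) (ε := L * r) (by positivity)
      hρ.support_subset hρ.nonneg hρ.integral_eq_one hh.continuous.aestronglyMeasurable
      (fun y hy => (hL.dist_le_mul y x).trans
        (mul_le_mul_of_nonneg_left (Metric.mem_ball.1 hy).le L.2))
    rwa [Real.dist_eq] at this
  have hzero : ∀ x ∉ B, mollify ρ h x - h x = 0 := by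
    intro x hx
    have hx' : R + 1 ≤ ‖x‖ := by simpa [hB] using hx
    have h1 : ∀ y : EuclideanSpace ℝ (Fin n), R ≤ ‖y‖ → h y = 0 := by
      intro y hy
      by_contra hne
      have := hR (subset_tsupport _ hne)
      simp at this
      linarith
    have h2 : mollify ρ h x = 0 := by
      unfold mollify
      rw [integral_eq_zero_of_ae]
      refine Filter.Eventually.of_forall fun t => ?_
      by_cases ht : ρ t = 0
      · simp [ht]
      · have : ‖t‖ < r := by simpa using hρ.support_subset ht
        have : h (x - t) = 0 := h1 _ (by have := norm_sub_norm_le x t; linarith)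
        simp [this]
    rw [h2, h1 x (by linarith), sub_zero]
  obtain ⟨hm1, hm2⟩ := hρ.mollify_sq_le hdL
  have hsec : ∫ x, (mollify ρ h x - h x) ^ 2 ≤ δ / 9 := by
    have h1 : ∀ x, (mollify ρ h x - h x) ^ 2 ≤ B.indicator (fun _ => (L * r) ^ 2) x := by
      intro x
      by_cases hx : x ∈ B
      · simp only [hx, indicator_of_mem]
        rw [← sq_abs]
        exact pow_le_pow_left₀ (abs_nonneg _) (hclose x) 2
      · simp [hx, hzero x hx]
    have hBm : MeasurableSet B := measurableSet_ball
    have hBf : volume B ≠ ⊤ := measure_ball_lt_top.ne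
    refine (integral_mono_of_nonneg (Filter.Eventually.of_forall fun x => sq_nonneg _)
      ((integrable_indicator_iff hBm).2 (integrableOn_const hBf))
      (Filter.Eventually.of_forall h1)).trans ?_
    rw [integral_indicator hBm, setIntegral_const, smul_eq_mul]
    have e : volume.real B = v := rfl
    rw [e]
    have h3 : r ^ 2 ≤ r := by nlinarith
    calc v * (L * r) ^ 2 = (L ^ 2 * v) * r ^ 2 := by ring
      _ ≤ (L ^ 2 * v + 1) * r := by gcongr; linarith
      _ ≤ (L ^ 2 * v + 1) * (δ / (9 * ((L : ℝ) ^ 2 * v + 1))) := by gcongr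
      _ = δ / 9 := by field_simp
  have hhloc : LocallyIntegrable h := hhL.locallyIntegrable (by norm_num)
  have hfloc : LocallyIntegrable f := hf.locallyIntegrable (by norm_num)
  have hm3 : MemLp (fun x => mollify ρ h x - h x) 2 := (hρ.mollify_sq_le hhL).1.sub hhL
  have hpt : ∀ x, (mollify ρ f x - f x) ^ 2 ≤ 3 * mollify ρ (fun y => f y - h y) x ^ 2
      + (3 * (mollify ρ h x - h x) ^ 2 + 3 * (f x - h x) ^ 2) := by
    intro x
    rw [hρ.mollify_sub hfloc hhloc]
    set a := mollify ρ f x - mollify ρ h x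
    set b := mollify ρ h x - h x
    set c := f x - h x
    have : mollify ρ f x - f x = a + b - c := by simp only [a, b, c]; ring
    rw [this]
    nlinarith [sq_nonneg (a - b), sq_nonneg (a + c), sq_nonneg (b + c)]
  have i1 := hm1.integrable_sq.const_mul 3
  have i2 := hm3.integrable_sq.const_mul 3
  have i3 := hdL.integrable_sq.const_mul 3
  have i23 : Integrable fun x => 3 * (mollify ρ h x - h x) ^ 2 + 3 * (f x - h x) ^ 2 := i2.add i3
  refine (integral_mono_of_nonneg (Filter.Eventually.of_forall fun x => sq_nonneg _)
    (i1.add i23) (Filter.Eventually.of_forall hpt)).trans ?_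
  refine (le_of_eq (integral_add i1 i23)).trans ?_
  rw [integral_add i2 i3, integral_const_mul, integral_const_mul,
    integral_const_mul]
  linarith

variable [NeZero n]

/-- Kernels supported below the boundary hyperplane: averages over them at points of the half space
only see values in the half space. -/
lemma exists_kernel_below {r : ℝ} (hr : 0 < r) : ∃ ρ : EuclideanSpace ℝ (Fin n) → ℝ,
    IsKernel r ρ ∧ ∀ x ∈ tsupport ρ, x 0 < 0 := by
  let c : EuclideanSpace ℝ (Fin n) := EuclideanSpace.single 0 (-(r / 2))
  have hc : ‖c‖ = r / 2 := by simp [c, abs_of_pos hr]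
  let b : ContDiffBump c := ⟨r / 8, r / 4, by positivity, by linarith⟩
  refine ⟨b.normed volume, ⟨⟨b.contDiff_normed, b.hasCompactSupport_normed⟩, b.nonneg_normed,
    b.integral_normed, ?_⟩, fun x hx => ?_⟩
  · rw [b.support_normed_eq]
    refine Metric.ball_subset_ball' ?_
    rw [dist_zero_right, hc]
    change r / 4 + r / 2 ≤ r
    linarith
  · rw [b.tsupport_normed_eq, Metric.mem_closedBall, dist_eq_norm] at hx
    have h1 : ‖(x - c) 0‖ ≤ ‖x - c‖ := PiLp.norm_apply_le _ _
    have h2 : (x - c) 0 = x 0 + r / 2 := by simp [c]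
    rw [h2, Real.norm_eq_abs] at h1
    have h3 : b.rOut = r / 4 := rfl
    have := (le_abs_self _).trans (h1.trans hx)
    linarith

/-- `V ∈ W^{1,2}` of the open half space, with bounded support and weak derivatives `dV`. -/
structure IsHalfW12 (V : EuclideanSpace ℝ (Fin n) → ℝ)
    (dV : Fin n → EuclideanSpace ℝ (Fin n) → ℝ) : Prop where
  memLp : MemLp V 2 (volume.restrict (halfSpace n))
  bounded : ∃ R : ℝ, ∀ x : EuclideanSpace ℝ (Fin n), R ≤ ‖x‖ → V x = 0
  memLp_deriv : ∀ i, MemLp (dV i) 2 (volume.restrict (halfSpace n))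
  weak : ∀ i η, IsTest η → tsupport η ⊆ halfSpace n →
    ∫ x in halfSpace n, V x * pd i η x = -∫ x in halfSpace n, dV i x * η x

/-- Averaging over a kernel supported below the hyperplane commutes with weak derivatives. -/
lemma IsHalfW12.pd_mollify {V : EuclideanSpace ℝ (Fin n) → ℝ}
    {dV : Fin n → EuclideanSpace ℝ (Fin n) → ℝ} (hV : IsHalfW12 V dV) {r : ℝ}
    {ρ : EuclideanSpace ℝ (Fin n) → ℝ} (hρ : IsKernel r ρ) (hρ0 : ∀ x ∈ tsupport ρ, x 0 < 0)
    (i : Fin n) {x : EuclideanSpace ℝ (Fin n)} (hx : x ∈ halfSpace n) :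
    pd i (mollify ρ ((halfSpace n).indicator V)) x
      = mollify ρ ((halfSpace n).indicator (dV i)) x := by
  set F := (halfSpace n).indicator V with hF
  have hFL : MemLp F 2 := (memLp_indicator_iff_restrict measurableSet_halfSpace).2 hV.memLp
  have hFloc : LocallyIntegrable F := hFL.locallyIntegrable (by norm_num)
  have hder := hρ.test.2.hasFDerivAt_convolution_left (ContinuousLinearMap.lsmul ℝ ℝ)
    (hρ.test.1.of_le (by simp)) hFloc x
  have h1 : pd i (mollify ρ F) x = ∫ t, pd i ρ t * F (x - t) := by
    rw [pd, mollify_eq_convolution, hder.fderiv, convolution,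
      ContinuousLinearMap.integral_apply]
    · rfl
    · exact (hρ.test.2.fderiv (𝕜 := ℝ)).convolutionExists_left _
        (hρ.test.1.continuous_fderiv (by simp)) hFloc x
  have hsub : ∀ (a b : EuclideanSpace ℝ (Fin n) → ℝ),
      ∫ t, a t * (halfSpace n).indicator b (x - t)
        = ∫ z in halfSpace n, b z * a (x - z) := by
    intro a b
    rw [← integral_sub_left_eq_self _ volume x, ← integral_indicator measurableSet_halfSpace]
    refine integral_congr_ae (Filter.Eventually.of_forall fun z => ?_)
    by_cases hz : z ∈ halfSpace n <;> simp [hz, mul_comm]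
  rw [h1, hF, hsub, mollify, hsub]
  let L : EuclideanSpace ℝ (Fin n) ≃ₜ EuclideanSpace ℝ (Fin n) := Homeomorph.subLeft x
  have hη : IsTest fun z => ρ (x - z) :=
    ⟨hρ.test.1.comp (contDiff_const.sub contDiff_id), hρ.test.2.comp_homeomorph L⟩
  have hpdη : ∀ z, pd i (fun z => ρ (x - z)) z = -pd i ρ (x - z) := by
    intro z
    simp only [pd]
    have hd : HasFDerivAt (fun z : EuclideanSpace ℝ (Fin n) => x - z)
      (-ContinuousLinearMap.id ℝ (EuclideanSpace ℝ (Fin n))) z := (hasFDerivAt_id z).const_sub x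
    have := ((hρ.test.1.differentiable (by simp) (x - z)).hasFDerivAt.comp z hd).fderiv
    have e : (ρ ∘ fun z => x - z) = fun z => ρ (x - z) := rfl
    rw [e] at this
    rw [this]
    simp
  have hsupp : tsupport (fun z => ρ (x - z)) ⊆ halfSpace n := by
    intro z hz
    have hz' : x - z ∈ tsupport ρ := by
      have := tsupport_comp_subset_preimage ρ (f := fun z => x - z) (by fun_prop) hz
      exact this
    have := hρ0 _ hz'
    simp only [PiLp.sub_apply, halfSpace, mem_ofPred_eq] at this hx ⊢
    linarith
  have hw := hV.weak i _ hη hsupp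
  simp only [hpdη, mul_neg, integral_neg, neg_inj] at hw
  exact hw

/-- Functions in `W^{1,2}` of the half space are approximated by test functions on `ℝⁿ`. -/
theorem IsHalfW12.exists_isTest_approx {ι : Type*} [Finite ι]
    {V : ι → EuclideanSpace ℝ (Fin n) → ℝ} {dV : ι → Fin n → EuclideanSpace ℝ (Fin n) → ℝ}
    (hV : ∀ k, IsHalfW12 (V k) (dV k)) {δ : ℝ} (hδ : 0 < δ) :
    ∃ v : ι → EuclideanSpace ℝ (Fin n) → ℝ, (∀ k, IsTest (v k)) ∧
      (∀ k, ∫ x in halfSpace n, (v k x - V k x) ^ 2 ≤ δ) ∧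
      ∀ k i, ∫ x in halfSpace n, (pd i (v k) x - dV k i x) ^ 2 ≤ δ := by
  have hFL : ∀ k, MemLp ((halfSpace n).indicator (V k)) 2 := fun k =>
    (memLp_indicator_iff_restrict measurableSet_halfSpace).2 (hV k).memLp
  have hdL : ∀ k i, MemLp ((halfSpace n).indicator (dV k i)) 2 := fun k i =>
    (memLp_indicator_iff_restrict measurableSet_halfSpace).2 ((hV k).memLp_deriv i)
  choose r1 hr1 hr1' using fun k => exists_kernel_radius (hFL k) hδ
  choose r2 hr2 hr2' using fun p : ι × Fin n => exists_kernel_radius (hdL p.1 p.2) hδ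
  obtain ⟨r, hr0, hra, hrb⟩ : ∃ r : ℝ, 0 < r ∧ (∀ k, r ≤ r1 k) ∧ ∀ p, r ≤ r2 p := by
    have h1 : ∀ᶠ r in 𝓝[>] (0 : ℝ), ∀ k, r ≤ r1 k := Filter.eventually_all.2 fun k =>
      Filter.mem_of_superset (Ioc_mem_nhdsGT (hr1 k)) fun r hr => hr.2
    have h2 : ∀ᶠ r in 𝓝[>] (0 : ℝ), ∀ p, r ≤ r2 p := Filter.eventually_all.2 fun p =>
      Filter.mem_of_superset (Ioc_mem_nhdsGT (hr2 p)) fun r hr => hr.2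
    obtain ⟨r, hr, h3, h4⟩ := (Filter.Eventually.and
      (self_mem_nhdsWithin : ∀ᶠ r in 𝓝[>] (0 : ℝ), 0 < r) (h1.and h2)).exists
    exact ⟨r, hr, h3, h4⟩
  -- one kernel serves for all functions and all derivatives
  obtain ⟨ρ, hρ, hρ0⟩ := exists_kernel_below (n := n) hr0
  have hrestr : ∀ {F G f : EuclideanSpace ℝ (Fin n) → ℝ}, MemLp (mollify ρ F) 2 → MemLp F 2 →
      ∫ x, (mollify ρ F x - F x) ^ 2 ≤ δ → (∀ x ∈ halfSpace n, f x = F x) →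
      (∀ x ∈ halfSpace n, G x = mollify ρ F x) → ∫ x in halfSpace n, (G x - f x) ^ 2 ≤ δ := by
    intro F G f h1 h2 h3 h4 h5
    have hint : Integrable fun x => (mollify ρ F x - F x) ^ 2 := (h1.sub h2).integrable_sq
    refine le_trans ?_ ((setIntegral_le_integral (s := halfSpace n) hint
      (Filter.Eventually.of_forall fun x => sq_nonneg _)).trans h3)
    refine le_of_eq (setIntegral_congr_fun measurableSet_halfSpace fun x hx => ?_)
    simp only [h4 x hx, h5 x hx]
  refine ⟨fun k => mollify ρ ((halfSpace n).indicator (V k)), fun k => ⟨?_, ?_⟩, fun k => ?_,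
    fun k i => ?_⟩
  · exact hρ.test.2.contDiff_convolution_left (n := ⊤) (ContinuousLinearMap.lsmul ℝ ℝ) hρ.test.1
      ((hFL k).locallyIntegrable (by norm_num))
  · refine hρ.test.2.convolution (ContinuousLinearMap.lsmul ℝ ℝ) ?_
    obtain ⟨R, hR⟩ := (hV k).bounded
    refine HasCompactSupport.intro (isCompact_closedBall (0 : EuclideanSpace ℝ (Fin n)) R)
      fun x hx => ?_
    have : V k x = 0 := hR x (by simpa using (not_le.1 (by simpa using hx)).le)
    by_cases h : x ∈ halfSpace n <;> simp [h, this]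
  · exact hrestr (hρ.mollify_sq_le (hFL k)).1 (hFL k) (hr1' k r (hra k) ρ hρ)
      (fun x hx => by simp [hx]) (fun x _ => rfl)
  · exact hrestr (hρ.mollify_sq_le (hdL k i)).1 (hdL k i) (hr2' (k, i) r (hrb (k, i)) ρ hρ)
      (fun x hx => by simp [hx]) (fun x hx => (hV k).pd_mollify hρ hρ0 i hx)

end Smoothing

/-! ### The Sobolev inequality on the half space -/

section Sobolev

open Filter
open scoped NNReal

variable {n : ℕ}

lemma norm_fderiv_sq_le (f : EuclideanSpace ℝ (Fin n) → ℝ) (x : EuclideanSpace ℝ (Fin n)) :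
    ‖fderiv ℝ f x‖ ^ 2 ≤ ∑ i, pd i f x ^ 2 := by
  have h : ‖fderiv ℝ f x‖ ≤ Real.sqrt (∑ i, pd i f x ^ 2) := by
    refine ContinuousLinearMap.opNorm_le_bound _ (Real.sqrt_nonneg _) fun v => ?_
    have hv : v = ∑ i, v i • (EuclideanSpace.single i (1 : ℝ)) := by
      have := (EuclideanSpace.basisFun (Fin n) ℝ).sum_repr v
      simpa using this.symm
    have : fderiv ℝ f x v = ∑ i, pd i f x * v i := by
      conv_lhs => rw [hv]
      simp [pd, mul_comm]
    rw [this, EuclideanSpace.norm_eq v, Real.norm_eq_abs]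
    simp only [Real.norm_eq_abs, sq_abs]
    rw [← Real.sqrt_mul (Finset.sum_nonneg fun i _ => sq_nonneg _)]
    exact Real.abs_le_sqrt (Finset.sum_mul_sq_le_sq_mul_sq _ _ _)
  calc ‖fderiv ℝ f x‖ ^ 2 ≤ Real.sqrt (∑ i, pd i f x ^ 2) ^ 2 :=
        pow_le_pow_left₀ (norm_nonneg _) h 2
    _ = _ := Real.sq_sqrt (Finset.sum_nonneg fun i _ => sq_nonneg _)

/-- The Sobolev exponent `2n/(n-2)`. -/
def sobolevExp (n : ℕ) : ℝ≥0 := (2 * (n : ℝ) / ((n : ℝ) - 2)).toNNReal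

lemma sobolevExp_inv (hn : 3 ≤ n) : ((sobolevExp n : ℝ≥0) : ℝ)⁻¹ = (2 : ℝ)⁻¹ - (n : ℝ)⁻¹ := by
  have hn3 : (3 : ℝ) ≤ n := by exact_mod_cast hn
  rw [sobolevExp, Real.coe_toNNReal _ (by apply div_nonneg <;> linarith)]
  have : (n : ℝ) - 2 ≠ 0 := by linarith
  field_simp

variable [NeZero n]

/-- The fold `y ↦ (√(y₀² + δ²), y')`, smooth for `δ ≠ 0`, which tends to the even fold as
`δ → 0`. -/
def foldMap (δ : ℝ) (x : EuclideanSpace ℝ (Fin n)) : EuclideanSpace ℝ (Fin n) :=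
  x + (Real.sqrt (x 0 ^ 2 + δ ^ 2) - x 0) • EuclideanSpace.single 0 1

lemma norm_le_norm_foldMap (δ : ℝ) (x : EuclideanSpace ℝ (Fin n)) : ‖x‖ ≤ ‖foldMap δ x‖ := by
  rw [EuclideanSpace.norm_eq, EuclideanSpace.norm_eq]
  refine Real.sqrt_le_sqrt (Finset.sum_le_sum fun i _ => ?_)
  simp only [Real.norm_eq_abs, sq_abs]
  by_cases hi : i = 0
  · subst hi
    have : foldMap δ x 0 = Real.sqrt (x 0 ^ 2 + δ ^ 2) := by simp [foldMap]
    rw [this, Real.sq_sqrt (by positivity)]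
    nlinarith [sq_nonneg δ]
  · simp [foldMap, hi]

lemma hasFDerivAt_foldMap {δ : ℝ} (hδ : δ ≠ 0) (x : EuclideanSpace ℝ (Fin n)) :
    ContDiff ℝ 1 (foldMap (n := n) δ) ∧ ‖fderiv ℝ (foldMap (n := n) δ) x‖ ≤ 3 := by
  have hpos : ∀ x : EuclideanSpace ℝ (Fin n), 0 < x 0 ^ 2 + δ ^ 2 := fun x => by positivity
  have hproj : ContDiff ℝ 1 fun x : EuclideanSpace ℝ (Fin n) => x 0 :=
    (EuclideanSpace.proj (𝕜 := ℝ) (0 : Fin n)).contDiff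
  refine ⟨?_, ?_⟩
  · unfold foldMap
    refine contDiff_id.add (ContDiff.smul (ContDiff.sub ?_ hproj) contDiff_const)
    exact ContDiff.sqrt ((hproj.pow 2).add contDiff_const) fun x => (hpos x).ne'
  · have h0 : HasFDerivAt (fun x : EuclideanSpace ℝ (Fin n) => x 0)
        (EuclideanSpace.proj (𝕜 := ℝ) (0 : Fin n)) x :=
      (EuclideanSpace.proj (𝕜 := ℝ) (0 : Fin n)).hasFDerivAt
    set s := Real.sqrt (x 0 ^ 2 + δ ^ 2) with hs
    have hs0 : 0 < s := Real.sqrt_pos.2 (hpos x)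
    have h1 : HasFDerivAt (fun x : EuclideanSpace ℝ (Fin n) => Real.sqrt (x 0 ^ 2 + δ ^ 2))
        ((x 0 / s) • EuclideanSpace.proj (𝕜 := ℝ) (0 : Fin n)) x := by
      have h2 : HasFDerivAt (fun x : EuclideanSpace ℝ (Fin n) => x 0 ^ 2 + δ ^ 2)
          ((2 * x 0) • EuclideanSpace.proj (𝕜 := ℝ) (0 : Fin n)) x := by
        have := (h0.pow 2).add_const (δ ^ 2)
        simpa using this
      have := h2.sqrt (hpos x).ne'
      convert! this using 1
      rw [smul_smul]
      congr 1
      rw [← hs]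
      field_simp
    have h3 : HasFDerivAt (foldMap (n := n) δ) (ContinuousLinearMap.id ℝ _
        + ((x 0 / s) • EuclideanSpace.proj (𝕜 := ℝ) (0 : Fin n)
          - EuclideanSpace.proj (𝕜 := ℝ) (0 : Fin n)).smulRight
          (EuclideanSpace.single 0 1 : EuclideanSpace ℝ (Fin n))) x :=
      (hasFDerivAt_id x).add ((h1.sub h0).smul_const _)
    rw [h3.fderiv]
    refine ContinuousLinearMap.opNorm_le_bound _ (by norm_num) fun v => ?_
    have hv0 : |v 0| ≤ ‖v‖ := PiLp.norm_apply_le v 0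
    have hxs : |x 0 / s| ≤ 1 := by
      rw [abs_div, abs_of_pos hs0, div_le_one hs0]
      refine Real.abs_le_sqrt ?_
      nlinarith [sq_nonneg δ]
    have e : (ContinuousLinearMap.id ℝ (EuclideanSpace ℝ (Fin n))
        + ((x 0 / s) • EuclideanSpace.proj (𝕜 := ℝ) (0 : Fin n)
          - EuclideanSpace.proj (𝕜 := ℝ) (0 : Fin n)).smulRight
          (EuclideanSpace.single 0 1 : EuclideanSpace ℝ (Fin n))) v
        = v + ((x 0 / s - 1) * v 0) • EuclideanSpace.single 0 1 := by
      simp [sub_mul]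
    rw [e]
    refine (norm_add_le _ _).trans ?_
    rw [norm_smul, PiLp.norm_single, norm_one, mul_one, Real.norm_eq_abs, abs_mul]
    have : |x 0 / s - 1| ≤ 2 := by
      rw [abs_le] at hxs ⊢
      constructor <;> linarith [hxs.1, hxs.2]
    nlinarith [abs_nonneg (v 0), abs_nonneg (x 0 / s - 1)]

lemma tendsto_foldMap (x : EuclideanSpace ℝ (Fin n)) :
    Tendsto (fun m : ℕ => foldMap (1 / ((m : ℝ) + 1)) x) atTop (𝓝 (foldMap 0 x)) := by
  have hc : Continuous fun δ : ℝ => foldMap δ x := by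
    unfold foldMap
    fun_prop
  exact (hc.tendsto 0).comp tendsto_one_div_add_atTop_nhds_zero_nat

lemma foldMap_zero_of_mem {x : EuclideanSpace ℝ (Fin n)} (hx : x ∈ halfSpace n) :
    foldMap 0 x = x := by
  have : (0 : ℝ) < x 0 := hx
  simp [foldMap, Real.sqrt_sq this.le]

lemma foldMap_zero_of_neg {x : EuclideanSpace ℝ (Fin n)} (hx : x 0 ≤ 0) :
    foldMap 0 x = reflMap n 1 x := by
  rw [reflMap_apply, foldMap]
  have : Real.sqrt (x 0 ^ 2 + 0 ^ 2) = -x 0 := by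
    rw [zero_pow (by norm_num), add_zero, Real.sqrt_sq_eq_abs, abs_of_nonpos hx]
  rw [this, sub_eq_add_neg x, ← neg_smul]
  congr 2
  ring

/-- The integral over the whole space of an evenly reflected function. -/
lemma exists_lintegral_foldMap_le (n : ℕ) [NeZero n] : ∃ C : ℝ≥0,
    ∀ h : EuclideanSpace ℝ (Fin n) → ℝ≥0∞,
      ∫⁻ x, h (foldMap 0 x) ≤ C * ∫⁻ x in halfSpace n, h x := by
  have hdet : LinearMap.det ((reflEquiv n one_ne_zero).toLinearEquiv :
      EuclideanSpace ℝ (Fin n) →ₗ[ℝ] _) ≠ 0 :=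
    (LinearEquiv.isUnit_det' (reflEquiv n one_ne_zero).toLinearEquiv).ne_zero
  have hmap := Measure.map_linearMap_addHaar_eq_smul_addHaar
    (volume : Measure (EuclideanSpace ℝ (Fin n))) hdet
  set c : ℝ := |(LinearMap.det ((reflEquiv n one_ne_zero).toLinearEquiv :
    EuclideanSpace ℝ (Fin n) →ₗ[ℝ] _))⁻¹| with hc
  have hmap' : Measure.map (reflMap n 1) (volume : Measure (EuclideanSpace ℝ (Fin n)))
      = ENNReal.ofReal c • volume := hmap
  have hemb : MeasurableEmbedding (reflMap n 1) :=
    (reflEquiv n one_ne_zero).toHomeomorph.measurableEmbedding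
  refine ⟨1 + c.toNNReal, fun h => ?_⟩
  rw [← lintegral_add_compl _ (measurableSet_halfSpace (n := n))]
  have h1 : ∫⁻ x in halfSpace n, h (foldMap 0 x) = ∫⁻ x in halfSpace n, h x :=
    setLIntegral_congr_fun measurableSet_halfSpace fun x hx => by
      simp only [foldMap_zero_of_mem hx]
  have h2 : ∫⁻ x in (halfSpace n)ᶜ, h (foldMap 0 x)
      ≤ ENNReal.ofReal c * ∫⁻ x in halfSpace n, h x := by
    rw [← lintegral_indicator measurableSet_halfSpace, ← lintegral_indicator
      measurableSet_halfSpace.compl, ← smul_eq_mul, ← lintegral_smul_measure, ← hmap',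
      hemb.lintegral_map]
    refine lintegral_mono_ae ?_
    filter_upwards [ae_coord_zero_ne (n := n)] with x hx
    by_cases hxc : x ∈ (halfSpace n)ᶜ
    · have hx0 : x 0 ≤ 0 := not_lt.1 hxc
      have : reflMap n 1 x ∈ halfSpace n := by
        simp only [halfSpace, mem_ofPred_eq, reflMap_apply_zero]
        have := lt_of_le_of_ne hx0 hx
        linarith
      simp [hxc, this, foldMap_zero_of_neg hx0]
    · simp [hxc]
  rw [h1, ENNReal.coe_add, add_mul, ENNReal.coe_one, one_mul]
  exact add_le_add le_rfl h2

/-- The Sobolev inequality on the half space, by smooth approximation of the even reflection. -/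
theorem exists_sobolev_halfSpace (hn : 3 ≤ n) : ∃ K : ℝ≥0,
    ∀ v : EuclideanSpace ℝ (Fin n) → ℝ, IsTest v →
      eLpNorm v (sobolevExp n) (volume.restrict (halfSpace n))
        ≤ K * eLpNorm (fderiv ℝ v) 2 (volume.restrict (halfSpace n)) := by
  obtain ⟨C, hC⟩ := exists_lintegral_foldMap_le n
  set K₀ := SNormLESNormFDerivOfEqConst ℝ (volume : Measure (EuclideanSpace ℝ (Fin n))) 2 with hK₀
  refine ⟨K₀ * (3 * NNReal.sqrt C), fun v hv => ?_⟩
  have hv1 : ContDiff ℝ 1 v := hv.1.of_le (by simp)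
  have hdv : Differentiable ℝ v := hv1.differentiable (by simp)
  have hcdv : Continuous (fderiv ℝ v) := hv1.continuous_fderiv (by simp)
  -- the Sobolev inequality on `ℝⁿ` for `v ∘ foldMap δ`, in the limit `δ → 0`
  set δ : ℕ → ℝ := fun m => 1 / ((m : ℝ) + 1) with hδdef
  have hδ : ∀ m, δ m ≠ 0 := fun m => by simp only [hδdef]; positivity
  obtain ⟨R, hR⟩ := hv.2.isBounded.subset_ball (0 : EuclideanSpace ℝ (Fin n))
  have hfar : ∀ y : EuclideanSpace ℝ (Fin n), R ≤ ‖y‖ → y ∉ tsupport v := by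
    intro y hy hmem
    have := hR hmem
    simp at this
    linarith
  have hcomp : ∀ m, ContDiff ℝ 1 (v ∘ foldMap (δ m)) := fun m =>
    hv1.comp (hasFDerivAt_foldMap (hδ m) 0).1
  have hsupp : ∀ m, HasCompactSupport (v ∘ foldMap (δ m)) := fun m => by
    refine HasCompactSupport.intro (isCompact_closedBall (0 : EuclideanSpace ℝ (Fin n)) R)
      fun x hx => ?_
    have hx' : R ≤ ‖x‖ := (not_le.1 (by simpa using hx)).le
    show v (foldMap (δ m) x) = 0
    exact image_eq_zero_of_notMem_tsupport (f := v)
      (hfar _ (hx'.trans (norm_le_norm_foldMap _ _)))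
  have hgns : ∀ m, eLpNorm (v ∘ foldMap (δ m)) (sobolevExp n) volume
      ≤ K₀ * eLpNorm (fderiv ℝ (v ∘ foldMap (δ m))) (2 : ℝ≥0) volume := fun m =>
    eLpNorm_le_eLpNorm_fderiv_of_eq (p := 2) volume (hcomp m) (hsupp m) (by norm_num)
      (by rw [finrank_euclideanSpace_fin]; omega)
      (by rw [finrank_euclideanSpace_fin, sobolevExp_inv hn]; simp)
  have hder : ∀ m x, ‖fderiv ℝ (v ∘ foldMap (δ m)) x‖ ≤ 3 * ‖fderiv ℝ v (foldMap (δ m) x)‖ := by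
    intro m x
    rw [fderiv_comp _ (hdv _) ((hasFDerivAt_foldMap (hδ m) x).1.differentiable (by simp) x)]
    refine (ContinuousLinearMap.opNorm_comp_le _ _).trans ?_
    rw [mul_comm]
    exact mul_le_mul_of_nonneg_right (hasFDerivAt_foldMap (hδ m) x).2 (norm_nonneg _)
  have hder' : ∀ m, eLpNorm (fderiv ℝ (v ∘ foldMap (δ m))) (2 : ℝ≥0) volume
      ≤ 3 * eLpNorm (fun x => fderiv ℝ v (foldMap (δ m) x)) (2 : ℝ≥0) volume := by
    intro m
    have := eLpNorm_le_nnreal_smul_eLpNorm_of_ae_le_mul (μ := volume) (c := 3)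
      (Eventually.of_forall (hder m)) (2 : ℝ≥0)
    simpa [ENNReal.smul_def] using this
  have hL2 : ∀ (f : EuclideanSpace ℝ (Fin n) → (EuclideanSpace ℝ (Fin n) →L[ℝ] ℝ))
      (μ : Measure (EuclideanSpace ℝ (Fin n))), eLpNorm f (2 : ℝ≥0) μ
        = (∫⁻ x, ‖f x‖ₑ ^ 2 ∂μ) ^ (1 / 2 : ℝ) := by
    intro f μ
    rw [eLpNorm_eq_lintegral_rpow_enorm_toReal (by norm_num) (by simp)]
    simp
  have hlim : Tendsto (fun m => ∫⁻ x, ‖fderiv ℝ v (foldMap (δ m) x)‖ₑ ^ 2) atTop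
      (𝓝 (∫⁻ x, ‖fderiv ℝ v (foldMap 0 x)‖ₑ ^ 2)) := by
    obtain ⟨B, hB⟩ := hcdv.bounded_above_of_compact_support (hv.2.fderiv (𝕜 := ℝ))
    refine tendsto_lintegral_of_dominated_convergence
      ((Metric.closedBall (0 : EuclideanSpace ℝ (Fin n)) R).indicator
        fun _ => ENNReal.ofReal B ^ 2) ?_ ?_ ?_ ?_
    · intro m
      exact (hcdv.comp (hasFDerivAt_foldMap (hδ m) 0).1.continuous).enorm.measurable.pow_const 2
    · intro m
      refine Eventually.of_forall fun x => ?_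
      by_cases hx : x ∈ Metric.closedBall (0 : EuclideanSpace ℝ (Fin n)) R
      · simp only [hx, indicator_of_mem]
        gcongr
        rw [← ofReal_norm]
        exact ENNReal.ofReal_le_ofReal (hB _)
      · have hx' : R ≤ ‖x‖ := (not_le.1 (by simpa using hx)).le
        have : fderiv ℝ v (foldMap (δ m) x) = 0 := by
          by_contra hne
          exact hfar _ (hx'.trans (norm_le_norm_foldMap _ _))
            (tsupport_fderiv_subset ℝ (subset_tsupport _ hne))
        have h0 : ‖fderiv ℝ v (foldMap (δ m) x)‖ₑ = 0 := by
          rw [← ofReal_norm, this, norm_zero, ENNReal.ofReal_zero]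
        simp [h0]
    · rw [lintegral_indicator measurableSet_closedBall, setLIntegral_const]
      exact ENNReal.mul_ne_top (by simp) measure_closedBall_lt_top.ne
    · refine Eventually.of_forall fun x => ?_
      have h1 := (hcdv.tendsto _).comp (tendsto_foldMap x)
      exact ((ENNReal.continuous_pow 2).tendsto _).comp h1.enorm
  have hbound : ∫⁻ x, ‖fderiv ℝ v (foldMap 0 x)‖ₑ ^ 2
      ≤ C * ∫⁻ x in halfSpace n, ‖fderiv ℝ v x‖ₑ ^ 2 := hC fun x => ‖fderiv ℝ v x‖ₑ ^ 2
  have hfatou := Lp.eLpNorm_lim_le_liminf_eLpNorm (p := (sobolevExp n : ℝ≥0∞))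
    (μ := volume.restrict (halfSpace n)) (f := fun m => v ∘ foldMap (δ m))
    (fun m => (hcomp m).continuous.aestronglyMeasurable) v (by
      refine (ae_restrict_iff' measurableSet_halfSpace).2 (Eventually.of_forall fun x hx => ?_)
      have h1 := (hv1.continuous.tendsto _).comp (tendsto_foldMap x)
      rw [foldMap_zero_of_mem hx] at h1
      exact h1)
  refine hfatou.trans ?_
  have hle : ∀ m, eLpNorm (v ∘ foldMap (δ m)) (sobolevExp n) (volume.restrict (halfSpace n))
      ≤ K₀ * (3 * (∫⁻ x, ‖fderiv ℝ v (foldMap (δ m) x)‖ₑ ^ 2) ^ (1 / 2 : ℝ)) := by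
    intro m
    rw [← hL2]
    exact (eLpNorm_mono_measure _ Measure.restrict_le_self).trans
      ((hgns m).trans (mul_le_mul_right (hder' m) _))
  have hlim2 : Tendsto (fun m => (K₀ : ℝ≥0∞) * (3 * (∫⁻ x, ‖fderiv ℝ v (foldMap (δ m) x)‖ₑ ^ 2)
      ^ (1 / 2 : ℝ))) atTop
      (𝓝 (K₀ * (3 * (∫⁻ x, ‖fderiv ℝ v (foldMap 0 x)‖ₑ ^ 2) ^ (1 / 2 : ℝ)))) := by
    refine ENNReal.Tendsto.const_mul (ENNReal.Tendsto.const_mul ?_ (Or.inr (by norm_num)))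
      (Or.inr ENNReal.coe_ne_top)
    exact (ENNReal.continuous_rpow_const.tendsto _).comp hlim
  refine (liminf_le_liminf (Eventually.of_forall hle)).trans ?_
  rw [hlim2.liminf_eq]
  have h2 : eLpNorm (fderiv ℝ v) 2 (volume.restrict (halfSpace n))
      = (∫⁻ x in halfSpace n, ‖fderiv ℝ v x‖ₑ ^ 2) ^ (1 / 2 : ℝ) := by
    rw [← hL2]; rfl
  rw [h2]
  calc (K₀ : ℝ≥0∞) * (3 * (∫⁻ x, ‖fderiv ℝ v (foldMap 0 x)‖ₑ ^ 2) ^ (1 / 2 : ℝ))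
      ≤ K₀ * (3 * (C * ∫⁻ x in halfSpace n, ‖fderiv ℝ v x‖ₑ ^ 2) ^ (1 / 2 : ℝ)) := by
        gcongr
    _ = _ := by
        rw [ENNReal.mul_rpow_of_nonneg _ _ (by norm_num)]
        have : (C : ℝ≥0∞) ^ (1 / 2 : ℝ) = (NNReal.sqrt C : ℝ≥0) := by
          rw [← ENNReal.coe_rpow_of_nonneg _ (by norm_num), NNReal.sqrt_eq_rpow]
        rw [this]
        push_cast
        ring

end Sobolev

/-! ### Multiplication by functions in `Lⁿ` -/

section Absorption

open Filter
open scoped NNReal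

variable {n : ℕ}

lemma eLpNorm_two_sq {α F : Type*} [MeasurableSpace α] [NormedAddCommGroup F] {μ : Measure α}
    (f : α → F) : eLpNorm f 2 μ ^ 2 = ∫⁻ x, ‖f x‖ₑ ^ 2 ∂μ := by
  have h := eLpNorm_eq_lintegral_rpow_enorm_toReal (μ := μ) (f := f) (p := 2) (by norm_num)
    (by norm_num)
  rw [h, ← ENNReal.rpow_natCast, ← ENNReal.rpow_mul]
  norm_num

lemma enorm_sq_eq_ofReal (a : ℝ) : ‖a‖ₑ ^ 2 = ENNReal.ofReal (a ^ 2) := by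
  rw [← ofReal_norm, ← ENNReal.ofReal_pow (norm_nonneg _), Real.norm_eq_abs, sq_abs]

lemma lintegral_ofReal_sq {α : Type*} [MeasurableSpace α] {μ : Measure α} {f : α → ℝ}
    (hf : MemLp f 2 μ) : ∫⁻ x, ENNReal.ofReal (f x ^ 2) ∂μ = ENNReal.ofReal (∫ x, f x ^ 2 ∂μ) :=
  (ofReal_integral_eq_lintegral_ofReal hf.integrable_sq
    (Eventually.of_forall fun _ => sq_nonneg _)).symm

lemma ennreal_add_sq_le (a b : ℝ≥0∞) : (a + b) ^ 2 ≤ 4 * (a ^ 2 + b ^ 2) := by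
  wlog h : a ≤ b generalizing a b
  · rw [add_comm a b, add_comm (a ^ 2)]
    exact this b a (le_of_not_ge h)
  calc (a + b) ^ 2 ≤ (b + b) ^ 2 := by gcongr
    _ = 4 * b ^ 2 := by ring
    _ ≤ 4 * (a ^ 2 + b ^ 2) := by gcongr; exact le_add_self

lemma killingMat_sub (G : Matrix (Fin n) (Fin n) ℝ) (a b : Fin n → Fin n → ℝ) (i j : Fin n) :
    killingMat G (fun i k => a i k - b i k) i j = killingMat G a i j - killingMat G b i j := by
  simp only [killingMat, mul_sub, sub_mul, Finset.sum_sub_distrib]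
  ring

lemma memLp_killingMat_of_bounded {α : Type*} [MeasurableSpace α] {μ : Measure α}
    {G : α → Matrix (Fin n) (Fin n) ℝ} (hG : ∀ i j, AEStronglyMeasurable (fun x => G x i j) μ)
    {b : ℝ} (hb : ∀ᵐ x ∂μ, ∀ i j, |G x i j| ≤ b) {a : Fin n → Fin n → α → ℝ}
    (ha : ∀ i k, MemLp (a i k) 2 μ) (i j : Fin n) :
    MemLp (fun x => killingMat (G x) (fun i k => a i k x) i j) 2 μ := by
  have h : ∀ i j {f : α → ℝ}, MemLp f 2 μ → MemLp (fun x => G x i j * f x) 2 μ := by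
    intro i j f hf
    refine hf.of_le_mul (c := b) ((hG i j).mul hf.1) ?_
    filter_upwards [hb] with x hx
    rw [norm_mul]
    exact mul_le_mul_of_nonneg_right (hx i j) (norm_nonneg _)
  unfold killingMat
  refine ((memLp_finsetSum _ fun k _ => h j k (ha i k)).add
    (memLp_finsetSum _ fun k _ => h i k (ha j k))).sub ?_
  simp only [mul_comm _ (G _ i j)]
  exact h i j ((memLp_finsetSum _ fun k _ => ha k k).const_mul (2 / (n : ℝ)))

lemma memLp_killingMat {α : Type*} [MeasurableSpace α] {μ : Measure α}
    (G : Matrix (Fin n) (Fin n) ℝ) {a : Fin n → Fin n → α → ℝ} (ha : ∀ i k, MemLp (a i k) 2 μ)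
    (i j : Fin n) : MemLp (fun x => killingMat G (fun i k => a i k x) i j) 2 μ := by
  obtain ⟨b, hb⟩ := (Set.finite_range fun p : Fin n × Fin n => |G p.1 p.2|).bddAbove
  exact memLp_killingMat_of_bounded (G := fun _ => G) (fun i j => aestronglyMeasurable_const)
    (Eventually.of_forall fun x i j => hb ⟨(i, j), rfl⟩) ha i j

variable [NeZero n]

/-- Multiplication by a function in `Lⁿ` is bounded relative to the gradient with arbitrarily small
relative bound: the part of the multiplier where it is large has small `Lⁿ` norm. -/
lemma exists_eLpNorm_mul_le (hn : 3 ≤ n) {Γ : EuclideanSpace ℝ (Fin n) → ℝ}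
    (hΓ : MemLp Γ n (volume.restrict (halfSpace n))) {ε : ℝ} (hε : 0 < ε) :
    ∃ M : ℝ≥0, ∀ v : EuclideanSpace ℝ (Fin n) → ℝ, IsTest v →
      eLpNorm (fun x => Γ x * v x) 2 (volume.restrict (halfSpace n))
        ≤ ENNReal.ofReal ε * eLpNorm (fderiv ℝ v) 2 (volume.restrict (halfSpace n))
          + M * eLpNorm v 2 (volume.restrict (halfSpace n)) := by
  obtain ⟨K, hK⟩ := exists_sobolev_halfSpace hn
  set μ := (volume : Measure (EuclideanSpace ℝ (Fin n))).restrict (halfSpace n) with hμ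
  set Γ' := hΓ.1.mk Γ with hΓ'
  have hsm : StronglyMeasurable Γ' := hΓ.1.stronglyMeasurable_mk
  have hae : Γ =ᵐ[μ] Γ' := hΓ.1.ae_eq_mk
  obtain ⟨M, hM0, hM⟩ := (MemLp.ae_eq hae hΓ).eLpNorm_indicator_norm_ge_pos_le hsm
    (ε := ε / (K + 1)) (by positivity)
  refine ⟨M.toNNReal, fun v hv => ?_⟩
  -- The part of `Γ` on `A` is paired with the Sobolev inequality, the part off `A` is bounded.
  set A := {x | M ≤ (‖Γ' x‖₊ : ℝ)} with hA
  have hAm : MeasurableSet A :=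
    measurableSet_le measurable_const hsm.nnnorm.measurable.subtype_coe
  have hvm : AEStronglyMeasurable v μ := hv.continuous.aestronglyMeasurable
  have e : (fun x => Γ x * v x) =ᵐ[μ] (A.indicator Γ' • v) + (Aᶜ.indicator Γ' • v) := by
    filter_upwards [hae] with x hx
    by_cases hxA : x ∈ A <;> simp [hxA, hx]
  have h1 : AEStronglyMeasurable (A.indicator Γ') μ := (hsm.indicator hAm).aestronglyMeasurable
  have h2 : AEStronglyMeasurable (Aᶜ.indicator Γ') μ :=
    (hsm.indicator hAm.compl).aestronglyMeasurable
  rw [eLpNorm_congr_ae e]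
  refine (eLpNorm_add_le (h1.smul hvm) (h2.smul hvm) (by norm_num)).trans (add_le_add ?_ ?_)
  · have hinv := sobolevExp_inv hn
    -- the Hölder relation `1/n + (n-2)/2n = 1/2`
    have : ENNReal.HolderTriple n (sobolevExp n) 2 := by
      refine ⟨?_⟩
      have hn0 : (n : ℝ≥0) ≠ 0 := by exact_mod_cast (by omega : n ≠ 0)
      have hs0 : sobolevExp n ≠ 0 := by
        intro h
        rw [h] at hinv
        have hn3 : (3 : ℝ) ≤ n := by exact_mod_cast hn
        have : (n : ℝ)⁻¹ ≤ 3⁻¹ := inv_anti₀ (by norm_num) hn3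
        simp only [NNReal.coe_zero, inv_zero] at hinv
        linarith [show (3 : ℝ)⁻¹ < 2⁻¹ by norm_num]
      have key : (n : ℝ≥0)⁻¹ + (sobolevExp n)⁻¹ = 2⁻¹ := by
        ext
        push_cast
        rw [hinv]
        ring
      have h3 := congrArg (fun t : ℝ≥0 => (t : ℝ≥0∞)) key
      simp only [ENNReal.coe_add] at h3
      rw [ENNReal.coe_inv hn0, ENNReal.coe_inv hs0, ENNReal.coe_inv (by norm_num)] at h3
      simpa using h3
    refine (eLpNorm_smul_le_mul_eLpNorm (p := n) (q := sobolevExp n) hvm h1).trans ?_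
    calc _ ≤ ENNReal.ofReal (ε / (K + 1)) * (K * eLpNorm (fderiv ℝ v) 2 μ) :=
          mul_le_mul' hM (hK v hv)
      _ = (ENNReal.ofReal (ε / (K + 1)) * K) * eLpNorm (fderiv ℝ v) 2 μ := by ring
      _ ≤ _ := by
        gcongr
        rw [← ENNReal.ofReal_coe_nnreal, ← ENNReal.ofReal_mul (by positivity)]
        refine ENNReal.ofReal_le_ofReal ?_
        rw [div_mul_eq_mul_div, div_le_iff₀ (by positivity)]
        nlinarith [K.coe_nonneg]
  · have h3 := eLpNorm_le_nnreal_smul_eLpNorm_of_ae_le_mul (μ := μ) (f := Aᶜ.indicator Γ' • v)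
      (g := v) (c := M.toNNReal) (Eventually.of_forall fun x => ?_) 2
    · simpa [ENNReal.smul_def] using h3
    · simp only [Pi.smul_apply', smul_eq_mul, nnnorm_mul]
      gcongr
      by_cases hxA : x ∈ A
      · simp [hxA]
      · have : ‖Γ' x‖ < M := not_le.1 hxA
        rw [indicator_of_mem (show x ∈ Aᶜ from hxA), ← NNReal.coe_le_coe, coe_nnnorm,
          Real.coe_toNNReal _ hM0.le]
        exact this.le

lemma exists_lintegral_mul_sq_le (hn : 3 ≤ n) {Γ : EuclideanSpace ℝ (Fin n) → ℝ}
    (hΓ : MemLp Γ n (volume.restrict (halfSpace n))) {δ : ℝ} (hδ : 0 < δ) :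
    ∃ C : ℝ, 0 ≤ C ∧ ∀ v : EuclideanSpace ℝ (Fin n) → ℝ, IsTest v →
      ∫⁻ x in halfSpace n, ENNReal.ofReal ((Γ x * v x) ^ 2)
        ≤ ENNReal.ofReal (δ * (∑ i, ∫ x in halfSpace n, pd i v x ^ 2)
          + C * ∫ x in halfSpace n, v x ^ 2) := by
  obtain ⟨M, hM⟩ := exists_eLpNorm_mul_le hn hΓ (ε := Real.sqrt (δ / 4)) (by positivity)
  refine ⟨4 * M ^ 2, by positivity, fun v hv => ?_⟩
  set μ := (volume : Measure (EuclideanSpace ℝ (Fin n))).restrict (halfSpace n) with hμ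
  have hv2 : MemLp v 2 μ := (hv.memLp 2).restrict _
  have hpd : ∀ i, MemLp (pd i v) 2 μ := fun i => ((hv.pd i).memLp 2).restrict _
  have h1 := pow_le_pow_left' (hM v hv) 2
  rw [eLpNorm_two_sq] at h1
  simp only [enorm_sq_eq_ofReal] at h1
  refine h1.trans ((ennreal_add_sq_le _ _).trans ?_)
  rw [mul_pow, mul_pow, eLpNorm_two_sq, eLpNorm_two_sq, ← ENNReal.ofReal_pow (Real.sqrt_nonneg _),
    Real.sq_sqrt (by positivity)]
  simp only [enorm_sq_eq_ofReal]
  rw [lintegral_ofReal_sq hv2]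
  have h2 : ∫⁻ x, ‖fderiv ℝ v x‖ₑ ^ 2 ∂μ ≤ ENNReal.ofReal (∑ i, ∫ x, pd i v x ^ 2 ∂μ) := by
    rw [← integral_finsetSum _ fun i _ => (hpd i).integrable_sq,
      ofReal_integral_eq_lintegral_ofReal (integrable_finsetSum _ fun i _ => (hpd i).integrable_sq)
        (Eventually.of_forall fun x => Finset.sum_nonneg fun i _ => sq_nonneg _)]
    refine lintegral_mono fun x => ?_
    rw [← ofReal_norm, ← ENNReal.ofReal_pow (norm_nonneg _)]
    exact ENNReal.ofReal_le_ofReal (norm_fderiv_sq_le v x)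
  have h0 : (0 : ℝ) ≤ ∑ i, ∫ x, pd i v x ^ 2 ∂μ :=
    Finset.sum_nonneg fun i _ => integral_nonneg fun x => sq_nonneg _
  have h0' : (0 : ℝ) ≤ ∫ x, v x ^ 2 ∂μ := integral_nonneg fun x => sq_nonneg _
  calc _ ≤ 4 * (ENNReal.ofReal (δ / 4) * ENNReal.ofReal (∑ i, ∫ x, pd i v x ^ 2 ∂μ)
        + (M : ℝ≥0∞) ^ 2 * ENNReal.ofReal (∫ x, v x ^ 2 ∂μ)) := by gcongr
    _ = _ := by
      rw [ENNReal.ofReal_add (by positivity) (by positivity), ENNReal.ofReal_mul hδ.le,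
        ENNReal.ofReal_mul (by positivity), ENNReal.ofReal_mul (by norm_num),
        ENNReal.ofReal_pow (by positivity), ENNReal.ofReal_coe_nnreal,
        ENNReal.ofReal_div_of_pos (by norm_num)]
      rw [show ENNReal.ofReal 4 = 4 by norm_num, mul_add, ← mul_assoc, ENNReal.mul_div_cancel
        (by norm_num) (by norm_num), mul_assoc]

/-- Smooth approximations of a weakly differentiable function on the half space that converge almost
everywhere, with control of the norms. -/
lemma IsHalfW12.exists_seq {V : EuclideanSpace ℝ (Fin n) → ℝ}
    {dV : Fin n → EuclideanSpace ℝ (Fin n) → ℝ} (hV : IsHalfW12 V dV) :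
    ∃ v : ℕ → EuclideanSpace ℝ (Fin n) → ℝ, (∀ m, IsTest (v m)) ∧
      (∀ᵐ x ∂(volume.restrict (halfSpace n)), Tendsto (fun m => v m x) atTop (𝓝 (V x))) ∧
      (∀ m, ∫ x in halfSpace n, (v m x - V x) ^ 2 ≤ 1 / ((m : ℝ) + 1)) ∧
      ∀ m i, ∫ x in halfSpace n, (pd i (v m) x - dV i x) ^ 2 ≤ 1 / ((m : ℝ) + 1) := by
  have h : ∀ m : ℕ, ∃ v, IsTest v ∧ (∫ x in halfSpace n, (v x - V x) ^ 2 ≤ 1 / ((m : ℝ) + 1)) ∧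
      ∀ i, ∫ x in halfSpace n, (pd i v x - dV i x) ^ 2 ≤ 1 / ((m : ℝ) + 1) := by
    intro m
    obtain ⟨v, h1, h2, h3⟩ := IsHalfW12.exists_isTest_approx (ι := Unit) (fun _ => hV)
      (δ := 1 / ((m : ℝ) + 1)) (by positivity)
    exact ⟨v (), h1 (), h2 (), h3 ()⟩
  choose v hv1 hv2 hv3 using h
  have hlim : Tendsto (fun m => eLpNorm (v m - V) 2 (volume.restrict (halfSpace n))) atTop
      (𝓝 0) := by
    have hb : ∀ m, eLpNorm (v m - V) 2 (volume.restrict (halfSpace n))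
        ≤ ENNReal.ofReal (Real.sqrt (1 / ((m : ℝ) + 1))) := by
      intro m
      refine (ENNReal.pow_right_strictMono (n := 2) (by norm_num)).le_iff_le.1 ?_
      rw [eLpNorm_two_sq, ← ENNReal.ofReal_pow (Real.sqrt_nonneg _), Real.sq_sqrt (by positivity)]
      simp only [enorm_sq_eq_ofReal]
      have := lintegral_ofReal_sq ((((hv1 m).memLp 2).restrict (halfSpace n)).sub hV.memLp)
      rw [this]
      exact ENNReal.ofReal_le_ofReal (hv2 m)
    refine tendsto_of_tendsto_of_tendsto_of_le_of_le tendsto_const_nhds ?_ (fun _ => zero_le) hb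
    have h1 := (Real.continuous_sqrt.tendsto 0).comp tendsto_one_div_add_atTop_nhds_zero_nat
    rw [Real.sqrt_zero] at h1
    have h2 := (ENNReal.continuous_ofReal.tendsto 0).comp h1
    rw [ENNReal.ofReal_zero] at h2
    exact h2
  obtain ⟨ns, hns, hae⟩ := (tendstoInMeasure_of_tendsto_eLpNorm (by norm_num)
    (fun m => (hv1 m).continuous.aestronglyMeasurable) hV.memLp.1 hlim).exists_seq_tendsto_ae
  have hle : ∀ m, 1 / ((ns m : ℝ) + 1) ≤ 1 / ((m : ℝ) + 1) := fun m => by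
    have : (m : ℝ) ≤ ns m := by exact_mod_cast hns.id_le m
    exact one_div_le_one_div_of_le (by positivity) (by linarith)
  exact ⟨fun m => v (ns m), fun m => hv1 _, hae, fun m => (hv2 _).trans (hle m),
    fun m i => (hv3 _ i).trans (hle m)⟩

lemma integral_sq_le_two_mul_add {α : Type*} [MeasurableSpace α] {μ : Measure α} {f g : α → ℝ}
    (hf : MemLp f 2 μ) (hg : MemLp g 2 μ) :
    ∫ x, f x ^ 2 ∂μ ≤ 2 * (∫ x, g x ^ 2 ∂μ) + 2 * ∫ x, (f x - g x) ^ 2 ∂μ := by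
  have h1 : Integrable (fun x => (f x - g x) ^ 2) μ := (hf.sub hg).integrable_sq
  have h2 : Integrable (fun x => 2 * g x ^ 2 + 2 * (f x - g x) ^ 2) μ :=
    (hg.integrable_sq.const_mul 2).add (h1.const_mul 2)
  calc _ ≤ ∫ x, (2 * g x ^ 2 + 2 * (f x - g x) ^ 2) ∂μ :=
        integral_mono hf.integrable_sq h2 fun x => by
          simp only
          nlinarith [sq_nonneg (f x - 2 * g x)]
    _ = _ := by
      rw [integral_add (hg.integrable_sq.const_mul 2) (h1.const_mul 2), integral_const_mul,
        integral_const_mul]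

/-- Multiplication by a function in `Lⁿ` is bounded relative to the weak gradient, with arbitrarily
small relative bound. -/
theorem exists_integral_mul_sq_le (hn : 3 ≤ n) {Γ : EuclideanSpace ℝ (Fin n) → ℝ}
    (hΓ : MemLp Γ n (volume.restrict (halfSpace n))) {δ : ℝ} (hδ : 0 < δ) :
    ∃ C : ℝ, 0 ≤ C ∧ ∀ V dV, IsHalfW12 V dV →
      MemLp (fun x => Γ x * V x) 2 (volume.restrict (halfSpace n)) ∧
      ∫ x in halfSpace n, (Γ x * V x) ^ 2 ≤ δ * (∑ i, ∫ x in halfSpace n, dV i x ^ 2)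
          + C * ∫ x in halfSpace n, V x ^ 2 := by
  obtain ⟨C, hC0, hC⟩ := exists_lintegral_mul_sq_le hn hΓ (δ := δ / 2) (by positivity)
  refine ⟨2 * C, by positivity, fun V dV hV => ?_⟩
  set μ := (volume : Measure (EuclideanSpace ℝ (Fin n))).restrict (halfSpace n) with hμ
  obtain ⟨v, hv1, hae, hv2, hv3⟩ := hV.exists_seq
  have hfatou : ∫⁻ x, ENNReal.ofReal ((Γ x * V x) ^ 2) ∂μ
      ≤ liminf (fun m => ∫⁻ x, ENNReal.ofReal ((Γ x * v m x) ^ 2) ∂μ) atTop := by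
    refine le_trans (le_of_eq (lintegral_congr_ae ?_)) (lintegral_liminf_le' fun m => ?_)
    · filter_upwards [hae] with x hx
      exact (((ENNReal.continuous_ofReal.tendsto _).comp
        ((hx.const_mul (Γ x)).pow 2)).liminf_eq).symm
    · exact ((hΓ.1.mul (hv1 m).continuous.aestronglyMeasurable).aemeasurable.pow_const
        2).ennreal_ofReal
  set T := ∑ i, ∫ x, dV i x ^ 2 ∂μ with hT
  set S := ∫ x, V x ^ 2 ∂μ with hS
  have hS0 : 0 ≤ S := integral_nonneg fun x => sq_nonneg _
  have hT0 : 0 ≤ T := Finset.sum_nonneg fun i _ => integral_nonneg fun x => sq_nonneg _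
  have hb : ∀ m, ∫⁻ x, ENNReal.ofReal ((Γ x * v m x) ^ 2) ∂μ
      ≤ ENNReal.ofReal (δ * T + 2 * C * S + (δ * n + 2 * C) * (1 / ((m : ℝ) + 1))) := by
    intro m
    refine (hC (v m) (hv1 m)).trans (ENNReal.ofReal_le_ofReal ?_)
    have h1 : ∑ i, ∫ x, pd i (v m) x ^ 2 ∂μ ≤ 2 * T + 2 * n * (1 / ((m : ℝ) + 1)) := by
      calc _ ≤ ∑ i : Fin n, (2 * (∫ x, dV i x ^ 2 ∂μ) + 2 * (1 / ((m : ℝ) + 1))) := by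
            refine Finset.sum_le_sum fun i _ => ?_
            have := integral_sq_le_two_mul_add ((((hv1 m).pd i).memLp 2).restrict (halfSpace n))
              (hV.memLp_deriv i)
            linarith [hv3 m i]
        _ = _ := by
            rw [Finset.sum_add_distrib, ← Finset.mul_sum, Finset.sum_const, Finset.card_univ,
              Fintype.card_fin, nsmul_eq_mul]
            ring
    have h2 : ∫ x, v m x ^ 2 ∂μ ≤ 2 * S + 2 * (1 / ((m : ℝ) + 1)) := by
      have := integral_sq_le_two_mul_add (((hv1 m).memLp 2).restrict (halfSpace n)) hV.memLp
      linarith [hv2 m]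
    have h3 := mul_le_mul_of_nonneg_left h1 (show 0 ≤ δ / 2 by positivity)
    have h4 := mul_le_mul_of_nonneg_left h2 hC0
    linarith
  have hlim : Tendsto (fun m : ℕ => ENNReal.ofReal
      (δ * T + 2 * C * S + (δ * n + 2 * C) * (1 / ((m : ℝ) + 1)))) atTop
      (𝓝 (ENNReal.ofReal (δ * T + 2 * C * S))) := by
    have h1 := (tendsto_one_div_add_atTop_nhds_zero_nat (𝕜 := ℝ)).const_mul (δ * n + 2 * C)
    have h2 := h1.const_add (δ * T + 2 * C * S)
    rw [mul_zero, add_zero] at h2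
    exact (ENNReal.continuous_ofReal.tendsto _).comp h2
  have hfin : ∫⁻ x, ENNReal.ofReal ((Γ x * V x) ^ 2) ∂μ ≤ ENNReal.ofReal (δ * T + 2 * C * S) := by
    refine hfatou.trans ((liminf_le_liminf (Eventually.of_forall hb)).trans ?_)
    rw [hlim.liminf_eq]
  have hmem : MemLp (fun x => Γ x * V x) 2 μ := by
    have hm : AEStronglyMeasurable (fun x => Γ x * V x) μ := hΓ.1.mul hV.memLp.1
    refine ⟨hm, ?_⟩
    have : eLpNorm (fun x => Γ x * V x) 2 μ ^ 2 < ⊤ := by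
      rw [eLpNorm_two_sq]
      simp only [enorm_sq_eq_ofReal]
      exact hfin.trans_lt ENNReal.ofReal_lt_top
    exact (ENNReal.pow_lt_top_iff.1 this).resolve_right (by norm_num)
  refine ⟨hmem, ?_⟩
  rw [lintegral_ofReal_sq hmem] at hfin
  exact (ENNReal.ofReal_le_ofReal_iff (by positivity)).1 hfin

lemma killingMat_sq_le {G : Matrix (Fin n) (Fin n) ℝ} {b : ℝ} (hb : ∀ i j, |G i j| ≤ b)
    (a : Fin n → Fin n → ℝ) (i j : Fin n) :
    killingMat G a i j ^ 2 ≤ 16 * b ^ 2 * n ^ 2 * ∑ i, ∑ k, a i k ^ 2 := by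
  have hb0 : 0 ≤ b := (abs_nonneg _).trans (hb i j)
  set s : ℝ := ∑ i, ∑ k, |a i k| with hs
  have hrow : ∀ i, ∑ k, |a i k| ≤ s := fun i =>
    Finset.single_le_sum (f := fun i => ∑ k, |a i k|)
      (fun i _ => Finset.sum_nonneg fun k _ => abs_nonneg _) (Finset.mem_univ i)
  have h1 : ∀ i j, |∑ k, G j k * a i k| ≤ b * s := by
    intro i j
    refine (Finset.abs_sum_le_sum_abs _ _).trans (le_trans ?_
      (mul_le_mul_of_nonneg_left (hrow i) hb0))
    rw [Finset.mul_sum]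
    exact Finset.sum_le_sum fun k _ => by
      rw [abs_mul]
      exact mul_le_mul_of_nonneg_right (hb j k) (abs_nonneg _)
  have h2 : |∑ k, a k k| ≤ s :=
    (Finset.abs_sum_le_sum_abs _ _).trans (Finset.sum_le_sum fun k _ =>
      Finset.single_le_sum (f := fun l => |a k l|) (fun l _ => abs_nonneg _) (Finset.mem_univ k))
  have hs0 : 0 ≤ s := (abs_nonneg _).trans h2
  have hn1 : (1 : ℝ) ≤ n := by exact_mod_cast NeZero.one_le (n := n)
  have h3 : |killingMat G a i j| ≤ 4 * (b * s) := by
    have hdiv : |2 / (n : ℝ)| ≤ 2 := by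
      rw [abs_of_nonneg (by positivity)]
      exact div_le_self (by norm_num) hn1
    have h4 : |2 / (n : ℝ) * (∑ k, a k k) * G i j| ≤ 2 * s * b := by
      rw [abs_mul, abs_mul]
      exact mul_le_mul (mul_le_mul hdiv h2 (abs_nonneg _) (by norm_num)) (hb i j) (abs_nonneg _)
        (by positivity)
    rw [killingMat]
    refine (abs_sub _ _).trans ?_
    have h5 := abs_add_le (∑ k, G j k * a i k) (∑ k, G i k * a j k)
    linarith [h1 i j, h1 j i]
  have hcs : s ^ 2 ≤ n ^ 2 * ∑ i, ∑ k, a i k ^ 2 := by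
    have h6 := sq_sum_le_card_mul_sum_sq (s := (Finset.univ : Finset (Fin n × Fin n)))
      (f := fun p => |a p.1 p.2|)
    rw [Finset.card_univ, Fintype.card_prod, Fintype.card_fin, Fintype.sum_prod_type,
      Fintype.sum_prod_type] at h6
    simp only [sq_abs] at h6
    rw [hs]
    refine h6.trans (le_of_eq ?_)
    push_cast
    ring
  calc killingMat G a i j ^ 2 = |killingMat G a i j| ^ 2 := (sq_abs _).symm
    _ ≤ (4 * (b * s)) ^ 2 := pow_le_pow_left₀ (abs_nonneg _) h3 2
    _ = 16 * b ^ 2 * s ^ 2 := by ring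
    _ ≤ 16 * b ^ 2 * (n ^ 2 * ∑ i, ∑ k, a i k ^ 2) :=
        mul_le_mul_of_nonneg_left hcs (by positivity)
    _ = _ := by ring

/-- Korn's inequality for constant metrics on the half space, for weakly differentiable fields. -/
theorem exists_korn_halfSpace (hn : 3 ≤ n) {G : Matrix (Fin n) (Fin n) ℝ}
    (hG : G.IsSymm) (hGu : IsUnit G.det) :
    ∃ C : ℝ, 0 ≤ C ∧ ∀ (V : Fin n → EuclideanSpace ℝ (Fin n) → ℝ)
      (dV : Fin n → Fin n → EuclideanSpace ℝ (Fin n) → ℝ), (∀ k, IsHalfW12 (V k) (dV k)) →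
      ∀ i k, ∫ x in halfSpace n, dV k i x ^ 2
        ≤ C * ∑ c : Fin n × Fin n,
          ∫ x in halfSpace n, killingMat G (fun i k => dV k i x) c.1 c.2 ^ 2 := by
  obtain ⟨C, hC0, hC⟩ := exists_korn_halfSpace_of_isTest hn hG hGu
  refine ⟨4 * C, by positivity, fun V dV hV i k => ?_⟩
  set μ := (volume : Measure (EuclideanSpace ℝ (Fin n))).restrict (halfSpace n) with hμ
  obtain ⟨b, hb⟩ : ∃ b : ℝ, ∀ i j, |G i j| ≤ b := by
    obtain ⟨b, hb⟩ := (Set.finite_range fun p : Fin n × Fin n => |G p.1 p.2|).bddAbove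
    exact ⟨b, fun i j => hb ⟨(i, j), rfl⟩⟩
  set L : ℝ := ∑ c : Fin n × Fin n, ∫ x, killingMat G (fun i k => dV k i x) c.1 c.2 ^ 2 ∂μ with hL
  set B : ℝ := 4 * C * (n * n * (16 * b ^ 2 * n ^ 2 * (n * n))) + 2 with hB
  have hB0 : 0 < B := by positivity
  refine le_of_forall_pos_le_add fun ε hε => ?_
  obtain ⟨v, hv1, -, hv3⟩ := IsHalfW12.exists_isTest_approx hV (δ := ε / B) (by positivity)
  have hpd : ∀ i k, MemLp (pd i (v k)) 2 μ := fun i k => (((hv1 k).pd i).memLp 2).restrict _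
  have hdV : ∀ i k, MemLp (dV k i) 2 μ := fun i k => (hV k).memLp_deriv i
  have hdiff : ∀ i k, MemLp (fun x => pd i (v k) x - dV k i x) 2 μ := fun i k =>
    (hpd i k).sub (hdV i k)
  have h1 := integral_sq_le_two_mul_add (hdV i k) (hpd i k)
  have h2 : ∫ x, (dV k i x - pd i (v k) x) ^ 2 ∂μ ≤ ε / B := by
    refine le_trans (le_of_eq (integral_congr_ae (Eventually.of_forall fun x => ?_))) (hv3 k i)
    simp only
    ring
  have h3 : ∀ c, ∫ x, flatKilling G v c x ^ 2 ∂μ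
      ≤ 2 * (∫ x, killingMat G (fun i k => dV k i x) c.1 c.2 ^ 2 ∂μ)
        + 2 * (16 * b ^ 2 * n ^ 2 * (n * n) * (ε / B)) := by
    intro c
    have e1 := integral_sq_le_two_mul_add (memLp_killingMat G hpd c.1 c.2)
      (memLp_killingMat G hdV c.1 c.2)
    simp only [← killingMat_sub] at e1
    have e2 : ∫ x, killingMat G (fun i k => pd i (v k) x - dV k i x) c.1 c.2 ^ 2 ∂μ
        ≤ 16 * b ^ 2 * n ^ 2 * (n * n) * (ε / B) := by
      have hint : Integrable (fun x => ∑ i, ∑ k, (pd i (v k) x - dV k i x) ^ 2) μ :=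
        integrable_finsetSum _ fun i _ => integrable_finsetSum _ fun k _ =>
          (hdiff i k).integrable_sq
      calc _ ≤ ∫ x, 16 * b ^ 2 * n ^ 2 * ∑ i, ∑ k, (pd i (v k) x - dV k i x) ^ 2 ∂μ :=
            integral_mono (memLp_killingMat G hdiff c.1 c.2).integrable_sq (hint.const_mul _)
              fun x => killingMat_sq_le hb _ _ _
        _ = 16 * b ^ 2 * n ^ 2 * ∑ i, ∑ k, ∫ x, (pd i (v k) x - dV k i x) ^ 2 ∂μ := by
            rw [integral_const_mul, integral_finsetSum _ fun i _ =>
              integrable_finsetSum _ fun k _ => (hdiff i k).integrable_sq]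
            congr 1
            exact Finset.sum_congr rfl fun i _ =>
              integral_finsetSum _ fun k _ => (hdiff i k).integrable_sq
        _ ≤ 16 * b ^ 2 * n ^ 2 * ∑ i : Fin n, ∑ k : Fin n, ε / B := by
            refine mul_le_mul_of_nonneg_left (Finset.sum_le_sum fun i _ =>
              Finset.sum_le_sum fun k _ => hv3 k i) (by positivity)
        _ = _ := by
            simp only [Finset.sum_const, Finset.card_univ, Fintype.card_fin, nsmul_eq_mul]
            ring
    have e3 : ∫ x, flatKilling G v c x ^ 2 ∂μ
        = ∫ x, killingMat G (fun i k => pd i (v k) x) c.1 c.2 ^ 2 ∂μ := rfl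
    linarith
  have h4 : ∑ c, ∫ x, flatKilling G v c x ^ 2 ∂μ
      ≤ 2 * L + n * n * (2 * (16 * b ^ 2 * n ^ 2 * (n * n) * (ε / B))) := by
    refine (Finset.sum_le_sum fun c _ => h3 c).trans (le_of_eq ?_)
    rw [Finset.sum_add_distrib, ← Finset.mul_sum, Finset.sum_const, Finset.card_univ,
      Fintype.card_prod, Fintype.card_fin, nsmul_eq_mul]
    push_cast
    ring
  have h5 := (hC v hv1 i k).trans (mul_le_mul_of_nonneg_left h4 hC0)
  have h6 : B * (ε / B) = ε := mul_div_cancel₀ _ hB0.ne'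
  calc _ ≤ 2 * (C * (2 * L + n * n * (2 * (16 * b ^ 2 * n ^ 2 * (n * n) * (ε / B)))))
        + 2 * (ε / B) := by linarith
    _ = 4 * C * L + B * (ε / B) := by rw [hB]; ring
    _ = _ := by rw [h6]

end Absorption

/-! ### Korn's inequality in coordinates, with variable metric and connection terms -/

section LocalKorn

open Filter
open scoped NNReal

variable {n : ℕ}

lemma killingMat_add_left (G γ : Matrix (Fin n) (Fin n) ℝ) (a : Fin n → Fin n → ℝ) (i j : Fin n) :
    killingMat (G + γ) a i j = killingMat G a i j + killingMat γ a i j := by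
  simp only [killingMat, Matrix.add_apply, add_mul, mul_add, Finset.sum_add_distrib]
  ring

lemma killingMat_smul (G : Matrix (Fin n) (Fin n) ℝ) (t : ℝ) (a : Fin n → Fin n → ℝ)
    (i j : Fin n) : killingMat G (fun i k => t * a i k) i j = t * killingMat G a i j := by
  simp only [killingMat, mul_left_comm _ t, ← Finset.mul_sum, mul_sub, mul_add]
  ring

lemma sum_integral_sq {α : Type*} [MeasurableSpace α] {μ : Measure α} {ι κ : Type*} [Fintype ι]
    [Fintype κ] {f : ι → κ → α → ℝ} (hf : ∀ i k, MemLp (f i k) 2 μ) :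
    ∑ i, ∑ k, ∫ x, f i k x ^ 2 ∂μ = ∫ x, ∑ i, ∑ k, f i k x ^ 2 ∂μ := by
  rw [integral_finsetSum _ fun i _ => integrable_finsetSum _ fun k _ => (hf i k).integrable_sq]
  exact Finset.sum_congr rfl fun i _ =>
    (integral_finsetSum _ fun k _ => (hf i k).integrable_sq).symm

lemma integrable_sum_sq {α : Type*} [MeasurableSpace α] {μ : Measure α} {ι κ : Type*} [Fintype ι]
    [Fintype κ] {f : ι → κ → α → ℝ} (hf : ∀ i k, MemLp (f i k) 2 μ) :
    Integrable (fun x => ∑ i, ∑ k, f i k x ^ 2) μ :=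
  integrable_finsetSum _ fun i _ => integrable_finsetSum _ fun k _ => (hf i k).integrable_sq

lemma pd_eq_zero_of_notMem_tsupport {χ : EuclideanSpace ℝ (Fin n) → ℝ} (i : Fin n)
    {x : EuclideanSpace ℝ (Fin n)} (hx : x ∉ tsupport χ) : pd i χ x = 0 := by
  have h : fderiv ℝ χ x = 0 := by
    by_contra h
    exact hx (tsupport_fderiv_subset ℝ (subset_tsupport _ h))
  simp [pd, h]

variable [NeZero n]

lemma sum_killingMat_sq_le {G : Matrix (Fin n) (Fin n) ℝ} {b : ℝ} (hb : ∀ i j, |G i j| ≤ b)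
    (a : Fin n → Fin n → ℝ) :
    ∑ i, ∑ j, killingMat G a i j ^ 2 ≤ 16 * b ^ 2 * n ^ 4 * ∑ i, ∑ k, a i k ^ 2 := by
  refine (Finset.sum_le_sum fun i _ => Finset.sum_le_sum fun j _ =>
    killingMat_sq_le hb a i j).trans (le_of_eq ?_)
  simp only [Finset.sum_const, Finset.card_univ, Fintype.card_fin, nsmul_eq_mul]
  ring

/-- The operator of `G` on the matrix `d`, in terms of the operator of a perturbed metric `G + γ`
on a perturbed matrix `d + e`. -/
lemma sum_killingMat_sub_sq_le {G γ : Matrix (Fin n) (Fin n) ℝ} {b δ : ℝ}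
    (hb : ∀ i j, |G i j| ≤ b) (hγ : ∀ i j, |γ i j| ≤ δ) (d e : Fin n → Fin n → ℝ) :
    ∑ i, ∑ j, killingMat G d i j ^ 2
      ≤ 3 * ∑ i, ∑ j, killingMat (G + γ) (fun i k => d i k + e i k) i j ^ 2
        + 96 * δ ^ 2 * n ^ 4 * ∑ i, ∑ k, d i k ^ 2
        + (96 * δ ^ 2 + 48 * b ^ 2) * n ^ 4 * ∑ i, ∑ k, e i k ^ 2 := by
  set a : Fin n → Fin n → ℝ := fun i k => d i k + e i k with ha
  have hd : d = fun i k => a i k - e i k := by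
    funext i k
    simp [ha]
  have h1 : ∀ i j, killingMat G d i j ^ 2 ≤ 3 * killingMat (G + γ) a i j ^ 2
      + 3 * killingMat γ a i j ^ 2 + 3 * killingMat G e i j ^ 2 := by
    intro i j
    have e1 : killingMat G d i j
        = killingMat (G + γ) a i j - killingMat γ a i j - killingMat G e i j := by
      conv_lhs => rw [hd]
      rw [killingMat_sub, killingMat_add_left]
      ring
    rw [e1]
    nlinarith [sq_nonneg (killingMat (G + γ) a i j + killingMat γ a i j),
      sq_nonneg (killingMat (G + γ) a i j + killingMat G e i j),
      sq_nonneg (killingMat γ a i j - killingMat G e i j)]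
  have h2 : ∑ i, ∑ k, a i k ^ 2 ≤ 2 * ∑ i, ∑ k, d i k ^ 2 + 2 * ∑ i, ∑ k, e i k ^ 2 := by
    simp only [Finset.mul_sum, ← Finset.sum_add_distrib]
    refine Finset.sum_le_sum fun i _ => Finset.sum_le_sum fun k _ => ?_
    simp only [ha]
    nlinarith [sq_nonneg (d i k - e i k)]
  have h3 := sum_killingMat_sq_le hγ a
  have h4 := sum_killingMat_sq_le hb e
  have h5 := Finset.sum_le_sum fun i (_ : i ∈ Finset.univ) =>
    Finset.sum_le_sum fun j (_ : j ∈ Finset.univ) => h1 i j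
  simp only [Finset.sum_add_distrib, ← Finset.mul_sum] at h5
  have h6 := mul_le_mul_of_nonneg_left h2 (show 0 ≤ 48 * δ ^ 2 * (n : ℝ) ^ 4 by positivity)
  linarith

/-- Korn's inequality on the half space is stable under small bounded perturbations of the metric
and under square integrable perturbations of the gradient. -/
lemma exists_korn_halfSpace_perturbed (hn : 3 ≤ n) {G : Matrix (Fin n) (Fin n) ℝ}
    (hG : G.IsSymm) (hGu : IsUnit G.det) :
    ∃ δ : ℝ, 0 < δ ∧ ∃ C : ℝ, 0 ≤ C ∧
      ∀ γ : EuclideanSpace ℝ (Fin n) → Matrix (Fin n) (Fin n) ℝ,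
      (∀ i j, AEStronglyMeasurable (fun x => γ x i j) (volume.restrict (halfSpace n))) →
      (∀ x i j, |γ x i j| ≤ δ) →
      ∀ (V : Fin n → EuclideanSpace ℝ (Fin n) → ℝ)
      (dV : Fin n → Fin n → EuclideanSpace ℝ (Fin n) → ℝ), (∀ k, IsHalfW12 (V k) (dV k)) →
      ∀ e : Fin n → Fin n → EuclideanSpace ℝ (Fin n) → ℝ,
      (∀ k i, MemLp (e k i) 2 (volume.restrict (halfSpace n))) →
      ∫ x in halfSpace n, ∑ i, ∑ k, dV k i x ^ 2
        ≤ C * ((∫ x in halfSpace n, ∑ i, ∑ j,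
            killingMat (G + γ x) (fun i k => dV k i x + e k i x) i j ^ 2)
          + ∫ x in halfSpace n, ∑ i, ∑ k, e k i x ^ 2) := by
  obtain ⟨C, hC0, hC⟩ := exists_korn_halfSpace hn hG hGu
  obtain ⟨b, hb⟩ : ∃ b : ℝ, ∀ i j, |G i j| ≤ b := by
    obtain ⟨b, hb⟩ := (Set.finite_range fun p : Fin n × Fin n => |G p.1 p.2|).bddAbove
    exact ⟨b, fun i j => hb ⟨(i, j), rfl⟩⟩
  set μ := (volume : Measure (EuclideanSpace ℝ (Fin n))).restrict (halfSpace n) with hμ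
  set B : ℝ := n ^ 2 * C with hB
  have hB0 : 0 ≤ B := by positivity
  -- the choice of `δ` makes the perturbation of the metric absorbable
  obtain ⟨δ, hδ0, hδ⟩ : ∃ δ : ℝ, 0 < δ ∧ B * (96 * δ ^ 2 * n ^ 4) ≤ 1 / 2 := by
    set A : ℝ := 192 * (B * n ^ 4) + 1 with hA
    have hA1 : 1 ≤ A := by rw [hA]; linarith [show 0 ≤ 192 * (B * n ^ 4) by positivity]
    refine ⟨1 / A, by positivity, ?_⟩
    have h1 : (1 / A) ^ 2 ≤ 1 / A := by
      have : 1 / A ≤ 1 := by rw [div_le_one (by linarith)]; exact hA1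
      nlinarith [show 0 < 1 / A by positivity]
    have h2 : 192 * (B * n ^ 4) * (1 / A) ≤ 1 := by
      rw [mul_one_div, div_le_one (by linarith)]
      linarith
    nlinarith [mul_le_mul_of_nonneg_left h1 (show 0 ≤ 96 * (B * (n : ℝ) ^ 4) by positivity)]
  refine ⟨δ, hδ0, 2 * B * (3 + (96 * δ ^ 2 + 48 * b ^ 2) * n ^ 4), by positivity, ?_⟩
  intro γ hγm hγ V dV hV e he
  have hdV : ∀ i k, MemLp (dV k i) 2 μ := fun i k => (hV k).memLp_deriv i
  have ha : ∀ i k, MemLp (fun x => dV k i x + e k i x) 2 μ := fun i k => (hdV i k).add (he k i)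
  have hL : ∀ i j, MemLp
      (fun x => killingMat (G + γ x) (fun i k => dV k i x + e k i x) i j) 2 μ := fun i j => by
    refine memLp_killingMat_of_bounded (b := b + δ) (fun i j => ?_)
      (Eventually.of_forall fun x i j => ?_) ha i j
    · exact aestronglyMeasurable_const.add (hγm i j)
    · exact (abs_add_le _ _).trans (add_le_add (hb i j) (hγ x i j))
  have hK : ∀ i j, MemLp (fun x => killingMat G (fun i k => dV k i x) i j) 2 μ :=
    memLp_killingMat G hdV
  set X := ∫ x, ∑ i, ∑ k, dV k i x ^ 2 ∂μ with hX
  set Y := ∫ x, ∑ i, ∑ k, e k i x ^ 2 ∂μ with hY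
  set L := ∫ x, ∑ i, ∑ j,
    killingMat (G + γ x) (fun i k => dV k i x + e k i x) i j ^ 2 ∂μ with hLd
  have hX0 : 0 ≤ X := integral_nonneg fun x => by positivity
  have hY0 : 0 ≤ Y := integral_nonneg fun x => by positivity
  have hL0 : 0 ≤ L := integral_nonneg fun x => by positivity
  have h1 : X ≤ B * ∫ x, ∑ i, ∑ j, killingMat G (fun i k => dV k i x) i j ^ 2 ∂μ := by
    rw [hX, ← sum_integral_sq hdV, ← sum_integral_sq hK]
    refine (Finset.sum_le_sum fun i _ => Finset.sum_le_sum fun k _ => hC V dV hV i k).trans ?_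
    simp only [Finset.sum_const, Finset.card_univ, Fintype.card_fin, nsmul_eq_mul,
      Fintype.sum_prod_type]
    rw [hB]
    exact le_of_eq (by ring)
  have hi1 := (integrable_sum_sq hL).const_mul 3
  have hi2 := (integrable_sum_sq hdV).const_mul (96 * δ ^ 2 * n ^ 4)
  have hi3 := (integrable_sum_sq fun i k => he k i).const_mul
    ((96 * δ ^ 2 + 48 * b ^ 2) * n ^ 4)
  have h2 : ∫ x, ∑ i, ∑ j, killingMat G (fun i k => dV k i x) i j ^ 2 ∂μ
      ≤ 3 * L + 96 * δ ^ 2 * n ^ 4 * X + (96 * δ ^ 2 + 48 * b ^ 2) * n ^ 4 * Y := by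
    refine (integral_mono (integrable_sum_sq hK) ((hi1.add hi2).add hi3) fun x =>
      sum_killingMat_sub_sq_le hb (hγ x) (fun i k => dV k i x) (fun i k => e k i x)).trans
      (le_of_eq ?_)
    exact (integral_add (hi1.add hi2) hi3).trans (congrArg₂ (· + ·)
      ((integral_add hi1 hi2).trans (congrArg₂ (· + ·) (integral_const_mul _ _)
        (integral_const_mul _ _))) (integral_const_mul _ _))
  have h3 := mul_le_mul_of_nonneg_left h2 hB0
  have h4 := mul_le_mul_of_nonneg_right hδ hX0
  have h5 : 0 ≤ B * (3 * Y) := by positivity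
  have h6 : 0 ≤ B * ((96 * δ ^ 2 + 48 * b ^ 2) * n ^ 4 * L) := by positivity
  linarith

lemma memLp_cutoff {p : ℝ≥0∞} {η f : EuclideanSpace ℝ (Fin n) → ℝ} (hη : IsTest η)
    {K : Set (EuclideanSpace ℝ (Fin n))} (hK : IsClosed K) (hs : ∀ x ∉ K, η x = 0)
    (hf : MemLp f p (volume.restrict (K ∩ halfSpace n))) :
    MemLp (fun x => η x * f x) p (volume.restrict (halfSpace n)) := by
  have e : (fun x => η x * f x) = K.indicator fun x => η x * f x := by
    funext x
    by_cases hx : x ∈ K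
    · simp [hx]
    · simp [hx, hs x hx]
  rw [e, memLp_indicator_iff_restrict hK.measurableSet, Measure.restrict_restrict hK.measurableSet]
  obtain ⟨B, hB⟩ := hη.continuous.bounded_above_of_compact_support hη.2
  refine hf.of_le_mul (c := B) (hη.continuous.aestronglyMeasurable.mul hf.1)
    (Eventually.of_forall fun x => ?_)
  rw [norm_mul]
  exact mul_le_mul_of_nonneg_right (hB x) (norm_nonneg _)

/-- A cutoff of a weakly differentiable function is weakly differentiable on the half space. -/
lemma isHalfW12_cutoff {χ : EuclideanSpace ℝ (Fin n) → ℝ} (hχ : IsTest χ)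
    {Ω : Set (EuclideanSpace ℝ (Fin n))} (hΩ : tsupport χ ∩ halfSpace n ⊆ Ω)
    {w : EuclideanSpace ℝ (Fin n) → ℝ} {dw : Fin n → EuclideanSpace ℝ (Fin n) → ℝ}
    (hw : ∀ i, IsWeakPartial Ω i w (dw i))
    (hw2 : MemLp w 2 (volume.restrict (tsupport χ ∩ halfSpace n)))
    (hdw2 : ∀ i, MemLp (dw i) 2 (volume.restrict (tsupport χ ∩ halfSpace n))) :
    IsHalfW12 (fun x => χ x * w x) (fun i x => χ x * dw i x + pd i χ x * w x) := by
  have h1 : MemLp (fun x => χ x * w x) 2 (volume.restrict (halfSpace n)) :=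
    memLp_cutoff hχ (isClosed_tsupport χ) (fun x hx => image_eq_zero_of_notMem_tsupport hx) hw2
  have h2 : ∀ i, MemLp (fun x => χ x * dw i x) 2 (volume.restrict (halfSpace n)) := fun i =>
    memLp_cutoff hχ (isClosed_tsupport χ) (fun x hx => image_eq_zero_of_notMem_tsupport hx)
      (hdw2 i)
  have h3 : ∀ i, MemLp (fun x => pd i χ x * w x) 2 (volume.restrict (halfSpace n)) := fun i =>
    memLp_cutoff (hχ.pd i) (isClosed_tsupport χ)
      (fun x hx => pd_eq_zero_of_notMem_tsupport i hx) hw2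
  refine ⟨h1, ?_, fun i => (h2 i).add (h3 i), fun i η hη hηH => ?_⟩
  · obtain ⟨R, hR⟩ := hχ.2.isBounded.subset_ball (0 : EuclideanSpace ℝ (Fin n))
    refine ⟨R, fun x hx => ?_⟩
    have : x ∉ tsupport χ := fun h => by
      have := hR h
      rw [mem_ball_zero_iff] at this
      linarith
    simp only [image_eq_zero_of_notMem_tsupport this, zero_mul]
  · have hχη : IsTest (fun x => χ x * η x) := hη.mul_left hχ.1
    have hsub : tsupport (fun x => χ x * η x) ⊆ Ω := fun x hx =>
      hΩ ⟨tsupport_mul_subset_left hx, hηH (tsupport_mul_subset_right hx)⟩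
    have key := (hw i).2.2 _ hχη.1 hχη.2 hsub
    have hη0 : ∀ x ∉ halfSpace n, η x = 0 := fun x hx =>
      image_eq_zero_of_notMem_tsupport fun h => hx (hηH h)
    have hpη0 : ∀ x ∉ halfSpace n, pd i η x = 0 := fun x hx =>
      pd_eq_zero_of_notMem_tsupport i fun h => hx (hηH h)
    have hpd : ∀ x, fderiv ℝ (fun x => χ x * η x) x (EuclideanSpace.single i 1)
        = pd i χ x * η x + χ x * pd i η x := fun x => by
      rw [fderiv_fun_mul (hχ.1.differentiable (by simp) x) (hη.1.differentiable (by simp) x)]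
      simp only [add_apply, smul_apply, smul_eq_mul, pd]
      ring
    simp only [hpd] at key
    have s1 := setIntegral_eq_integral_of_forall_compl_eq_zero (μ := volume) (s := halfSpace n)
      (f := fun x => w x * (pd i χ x * η x + χ x * pd i η x)) fun x hx => by
        rw [hη0 x hx, hpη0 x hx]; ring
    have s2 := setIntegral_eq_integral_of_forall_compl_eq_zero (μ := volume) (s := halfSpace n)
      (f := fun x => dw i x * (χ x * η x)) fun x hx => by
        rw [hη0 x hx]; ring
    rw [← s1, ← s2] at key
    have i1 : Integrable (fun x => χ x * w x * pd i η x) (volume.restrict (halfSpace n)) :=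
      h1.integrable_mul (((hη.pd i).memLp 2).restrict _)
    have i2 : Integrable (fun x => pd i χ x * w x * η x) (volume.restrict (halfSpace n)) :=
      (h3 i).integrable_mul ((hη.memLp 2).restrict _)
    have i3 : Integrable (fun x => χ x * dw i x * η x) (volume.restrict (halfSpace n)) :=
      (h2 i).integrable_mul ((hη.memLp 2).restrict _)
    have e1 : ∫ x in halfSpace n, w x * (pd i χ x * η x + χ x * pd i η x)
        = (∫ x in halfSpace n, χ x * w x * pd i η x)
          + ∫ x in halfSpace n, pd i χ x * w x * η x := by
      rw [← integral_add i1 i2]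
      exact integral_congr_ae (Eventually.of_forall fun x => by simp only; ring)
    have e2 : ∫ x in halfSpace n, dw i x * (χ x * η x)
        = ∫ x in halfSpace n, χ x * dw i x * η x :=
      integral_congr_ae (Eventually.of_forall fun x => by simp only; ring)
    have e3 : ∫ x in halfSpace n, (χ x * dw i x + pd i χ x * w x) * η x
        = (∫ x in halfSpace n, χ x * dw i x * η x)
          + ∫ x in halfSpace n, pd i χ x * w x * η x := by
      rw [← integral_add i3 i2]
      exact integral_congr_ae (Eventually.of_forall fun x => by simp only; ring)
    rw [e1, e2] at key
    rw [e3]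
    linarith

lemma integral_cutoff_sq_le {η f : EuclideanSpace ℝ (Fin n) → ℝ}
    {K : Set (EuclideanSpace ℝ (Fin n))} (hK : IsClosed K) (hs : ∀ x ∉ K, η x = 0) {B : ℝ}
    (hB : ∀ x, |η x| ≤ B) (hf : MemLp f 2 (volume.restrict (K ∩ halfSpace n))) :
    ∫ x in halfSpace n, (η x * f x) ^ 2 ≤ B ^ 2 * ∫ x in K ∩ halfSpace n, f x ^ 2 := by
  have e : (fun x => (η x * f x) ^ 2) = K.indicator fun x => (η x * f x) ^ 2 := by
    funext x
    by_cases hx : x ∈ K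
    · simp [hx]
    · simp [hx, hs x hx]
  rw [e, integral_indicator hK.measurableSet, Measure.restrict_restrict hK.measurableSet,
    ← integral_const_mul]
  refine integral_mono_of_nonneg (Eventually.of_forall fun x => sq_nonneg _)
    (hf.integrable_sq.const_mul _) (Eventually.of_forall fun x => ?_)
  simp only [mul_pow]
  refine mul_le_mul_of_nonneg_right ?_ (sq_nonneg _)
  rw [← sq_abs]
  exact pow_le_pow_left₀ (abs_nonneg _) (hB x) 2

/-- The zeroth order term of a connection with coefficients in `Lⁿ` is bounded relative to the
gradient with arbitrarily small relative bound. -/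
lemma exists_integral_connection_sq_le (hn : 3 ≤ n)
    {Γ : Fin n → Fin n → Fin n → EuclideanSpace ℝ (Fin n) → ℝ}
    (hΓ : ∀ k i l, MemLp (Γ k i l) n (volume.restrict (halfSpace n))) {δ : ℝ} (hδ : 0 < δ) :
    ∃ C : ℝ, 0 ≤ C ∧ ∀ (V : Fin n → EuclideanSpace ℝ (Fin n) → ℝ)
      (dV : Fin n → Fin n → EuclideanSpace ℝ (Fin n) → ℝ), (∀ k, IsHalfW12 (V k) (dV k)) →
      (∀ k i, MemLp (fun x => ∑ l, Γ k i l x * V l x) 2 (volume.restrict (halfSpace n))) ∧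
      ∀ k i, ∫ x in halfSpace n, (∑ l, Γ k i l x * V l x) ^ 2
        ≤ δ * (∫ x in halfSpace n, ∑ i, ∑ k, dV k i x ^ 2)
          + C * ∑ k, ∫ x in halfSpace n, V k x ^ 2 := by
  have hn0 : (0 : ℝ) < n := by exact_mod_cast (by omega : 0 < n)
  choose C hC0 hC using fun k i l => exists_integral_mul_sq_le hn (hΓ k i l)
    (δ := δ / n ^ 2) (by positivity)
  refine ⟨n * ∑ k, ∑ i, ∑ l, C k i l, mul_nonneg hn0.le (Finset.sum_nonneg fun k _ =>
    Finset.sum_nonneg fun i _ => Finset.sum_nonneg fun l _ => hC0 k i l), fun V dV hV => ?_⟩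
  have hmem : ∀ k i l, MemLp (fun x => Γ k i l x * V l x) 2 (volume.restrict (halfSpace n)) :=
    fun k i l => (hC k i l _ _ (hV l)).1
  refine ⟨fun k i => memLp_finsetSum _ fun l _ => hmem k i l, fun k i => ?_⟩
  rw [← sum_integral_sq fun i k => (hV k).memLp_deriv i]
  set μ := (volume : Measure (EuclideanSpace ℝ (Fin n))).restrict (halfSpace n) with hμ
  have hlC : ∀ l, C k i l ≤ ∑ k, ∑ i, ∑ l, C k i l := fun l =>
    (Finset.single_le_sum (f := fun l => C k i l) (fun l _ => hC0 k i l) (Finset.mem_univ l)).trans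
      ((Finset.single_le_sum (f := fun i => ∑ l, C k i l)
        (fun i _ => Finset.sum_nonneg fun l _ => hC0 k i l) (Finset.mem_univ i)).trans
      (Finset.single_le_sum (f := fun k => ∑ i, ∑ l, C k i l) (fun k _ =>
        Finset.sum_nonneg fun i _ => Finset.sum_nonneg fun l _ => hC0 k i l) (Finset.mem_univ k)))
  set Cs := ∑ k, ∑ i, ∑ l, C k i l with hCs
  set X := ∑ i, ∑ k, ∫ x, dV k i x ^ 2 ∂μ with hX
  have hlX : ∀ l, ∑ i, ∫ x, dV l i x ^ 2 ∂μ ≤ X := fun l =>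
    Finset.sum_le_sum fun i _ => Finset.single_le_sum (f := fun k => ∫ x, dV k i x ^ 2 ∂μ)
      (fun k _ => integral_nonneg fun x => sq_nonneg _) (Finset.mem_univ l)
  calc ∫ x, (∑ l, Γ k i l x * V l x) ^ 2 ∂μ
      ≤ ∫ x, n * ∑ l, (Γ k i l x * V l x) ^ 2 ∂μ := by
        refine integral_mono (memLp_finsetSum _ fun l _ => hmem k i l).integrable_sq
          ((integrable_finsetSum _ fun l _ => (hmem k i l).integrable_sq).const_mul _) fun x => ?_
        have := sq_sum_le_card_mul_sum_sq (s := (Finset.univ : Finset (Fin n)))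
          (f := fun l => Γ k i l x * V l x)
        simpa using this
    _ = n * ∑ l, ∫ x, (Γ k i l x * V l x) ^ 2 ∂μ := by
        rw [integral_const_mul, integral_finsetSum _ fun l _ => (hmem k i l).integrable_sq]
    _ ≤ n * ∑ l : Fin n, (δ / n ^ 2 * X + Cs * ∫ x, V l x ^ 2 ∂μ) := by
        refine mul_le_mul_of_nonneg_left (Finset.sum_le_sum fun l _ => ?_) hn0.le
        refine ((hC k i l _ _ (hV l)).2).trans (add_le_add
          (mul_le_mul_of_nonneg_left (hlX l) (by positivity))
          (mul_le_mul_of_nonneg_right (hlC l) (integral_nonneg fun x => sq_nonneg _)))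
    _ = _ := by
        rw [Finset.sum_add_distrib, ← Finset.mul_sum, Finset.sum_const, Finset.card_univ,
          Fintype.card_fin, nsmul_eq_mul, ← Finset.mul_sum]
        field_simp

/-- The conformal Korn inequality with a cutoff, in coordinates, for a metric close to a constant
one and with Christoffel symbols in `Lⁿ`: the lower order terms are absorbed. -/
theorem exists_local_korn (hn : 3 ≤ n) {G : Matrix (Fin n) (Fin n) ℝ}
    (hG : G.IsSymm) (hGu : IsUnit G.det) :
    ∃ δ : ℝ, 0 < δ ∧ ∀ χ : EuclideanSpace ℝ (Fin n) → ℝ, IsTest χ →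
      ∀ Ω : Set (EuclideanSpace ℝ (Fin n)), tsupport χ ∩ halfSpace n ⊆ Ω →
      ∀ g : EuclideanSpace ℝ (Fin n) → Matrix (Fin n) (Fin n) ℝ,
      (∀ i j, AEStronglyMeasurable (fun x => g x i j)
        (volume.restrict (tsupport χ ∩ halfSpace n))) →
      (∀ x ∈ tsupport χ ∩ halfSpace n, ∀ i j, |g x i j - G i j| ≤ δ) →
      ∀ Γ : Fin n → Fin n → Fin n → EuclideanSpace ℝ (Fin n) → ℝ,
      (∀ k i l, MemLp (Γ k i l) n (volume.restrict (tsupport χ ∩ halfSpace n))) →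
      ∃ C : ℝ, 0 ≤ C ∧ ∀ (w : Fin n → EuclideanSpace ℝ (Fin n) → ℝ)
        (dw : Fin n → Fin n → EuclideanSpace ℝ (Fin n) → ℝ),
        (∀ k i, IsWeakPartial Ω i (w k) (dw k i)) →
        (∀ k, MemLp (w k) 2 (volume.restrict (tsupport χ ∩ halfSpace n))) →
        (∀ k i, MemLp (dw k i) 2 (volume.restrict (tsupport χ ∩ halfSpace n))) →
        ∀ D : Fin n → Fin n → EuclideanSpace ℝ (Fin n) → ℝ,
        (∀ k i, ∀ᵐ x ∂(volume.restrict (tsupport χ ∩ halfSpace n)),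
          D k i x = dw k i x + ∑ l, Γ k i l x * w l x) →
        ∫⁻ x in tsupport χ ∩ halfSpace n, ENNReal.ofReal (∑ i, ∑ k, (χ x * D k i x) ^ 2)
          ≤ ENNReal.ofReal C * ((∫⁻ x in tsupport χ ∩ halfSpace n,
              ENNReal.ofReal (∑ i, ∑ j, (χ x * killingMat (g x) (fun i k => D k i x) i j) ^ 2))
            + ∫⁻ x in tsupport χ ∩ halfSpace n, ENNReal.ofReal (∑ k, w k x ^ 2)) := by
  obtain ⟨δ, hδ, C₀, hC₀, hK⟩ := exists_korn_halfSpace_perturbed hn hG hGu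
  refine ⟨δ, hδ, fun χ hχ Ω hΩ g hgm hg Γ hΓ => ?_⟩
  set μ := (volume : Measure (EuclideanSpace ℝ (Fin n))).restrict (halfSpace n) with hμ
  set S := tsupport χ ∩ halfSpace n with hS
  have htm : MeasurableSet (tsupport χ) := (isClosed_tsupport χ).measurableSet
  have hSm : MeasurableSet S := htm.inter measurableSet_halfSpace
  have hSμ : μ.restrict (tsupport χ) = volume.restrict S := Measure.restrict_restrict htm
  have hχ0 : ∀ x ∉ tsupport χ, χ x = 0 := fun x hx => image_eq_zero_of_notMem_tsupport hx
  obtain ⟨B, hB⟩ : ∃ B : ℝ, (∀ x, |χ x| ≤ B) ∧ ∀ i x, |pd i χ x| ≤ B := by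
    obtain ⟨B₁, h₁⟩ := hχ.continuous.bounded_above_of_compact_support hχ.2
    choose B₂ h₂ using fun i => (hχ.pd i).continuous.bounded_above_of_compact_support (hχ.pd i).2
    have h0 : ∀ i, 0 ≤ B₂ i := fun i => (norm_nonneg _).trans (h₂ i 0)
    refine ⟨B₁ + ∑ i, B₂ i, fun x => (h₁ x).trans ?_, fun i x => (h₂ i x).trans ?_⟩
    · linarith [Finset.sum_nonneg fun i (_ : i ∈ Finset.univ) => h0 i]
    · linarith [Finset.single_le_sum (fun i _ => h0 i) (Finset.mem_univ i),
        (norm_nonneg _).trans (h₁ 0)]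
  set Γ' : Fin n → Fin n → Fin n → EuclideanSpace ℝ (Fin n) → ℝ :=
    fun k i l => (tsupport χ).indicator (Γ k i l) with hΓ'
  have hΓ'm : ∀ k i l, MemLp (Γ' k i l) n μ := fun k i l => by
    rw [hΓ', memLp_indicator_iff_restrict htm, hSμ]
    exact hΓ k i l
  obtain ⟨C₁, hC₁, hcon⟩ := exists_integral_connection_sq_le hn hΓ'm
    (δ := 1 / (4 * n ^ 2 * C₀ + 1)) (by positivity)
  -- this relative bound makes the connection term absorbable
  set δ₁ : ℝ := 1 / (4 * n ^ 2 * C₀ + 1) with hδ₁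
  have hδ₁0 : 0 < δ₁ := by positivity
  have habs : C₀ * (2 * n ^ 2 * δ₁) ≤ 1 / 2 := by
    have : 4 * n ^ 2 * C₀ * δ₁ ≤ 1 := by
      rw [hδ₁, mul_one_div, div_le_one (by positivity)]
      linarith
    linarith
  set γ : EuclideanSpace ℝ (Fin n) → Matrix (Fin n) (Fin n) ℝ :=
    S.indicator fun x => g x - G with hγ
  have hγm : ∀ i j, AEStronglyMeasurable (fun x => γ x i j) μ := by
    intro i j
    have e : (fun x => γ x i j) = S.indicator fun x => g x i j - G i j := by
      funext x
      by_cases hx : x ∈ S <;> simp [hγ, hx]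
    rw [e, aestronglyMeasurable_indicator_iff hSm, hμ, Measure.restrict_restrict hSm,
      inter_eq_left.2 inter_subset_right]
    exact (hgm i j).sub aestronglyMeasurable_const
  have hγb : ∀ x i j, |γ x i j| ≤ δ := by
    intro x i j
    by_cases hx : x ∈ S
    · simpa [hγ, hx] using hg x hx i j
    · simpa [hγ, hx] using hδ.le
  set c : ℝ := 2 * n ^ 2 * B ^ 2 + 2 * n ^ 2 * (C₁ * B ^ 2) with hc
  set A : ℝ := 2 + 4 * n ^ 2 * δ₁ with hA
  have hc0 : 0 ≤ c := by positivity
  have hA0 : 0 ≤ A := by positivity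
  refine ⟨2 * A * C₀ + 2 * A * C₀ * c + 2 * c, by positivity, fun w dw hw hw2 hdw2 D hD => ?_⟩
  set V : Fin n → EuclideanSpace ℝ (Fin n) → ℝ := fun k x => χ x * w k x with hVd
  set dV : Fin n → Fin n → EuclideanSpace ℝ (Fin n) → ℝ :=
    fun k i x => χ x * dw k i x + pd i χ x * w k x with hdVd
  have hV : ∀ k, IsHalfW12 (V k) (dV k) := fun k =>
    isHalfW12_cutoff hχ hΩ (hw k) (hw2 k) (hdw2 k)
  obtain ⟨hcm, hcb⟩ := hcon V dV hV
  have hpm : ∀ k i, MemLp (fun x => pd i χ x * w k x) 2 μ := fun k i =>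
    memLp_cutoff (hχ.pd i) (isClosed_tsupport χ)
      (fun x hx => pd_eq_zero_of_notMem_tsupport i hx) (hw2 k)
  -- `dV + e = χ D`: the perturbation consists of the connection term and a commutator
  set e : Fin n → Fin n → EuclideanSpace ℝ (Fin n) → ℝ :=
    fun k i x => (∑ l, Γ' k i l x * V l x) - pd i χ x * w k x with he
  have hem : ∀ k i, MemLp (e k i) 2 μ := fun k i => (hcm k i).sub (hpm k i)
  have hdVm : ∀ i k, MemLp (dV k i) 2 μ := fun i k => (hV k).memLp_deriv i
  have key := hK γ hγm hγb V dV hV e hem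
  set X := ∫ x, ∑ i, ∑ k, dV k i x ^ 2 ∂μ with hX
  set Y := ∫ x, ∑ i, ∑ k, e k i x ^ 2 ∂μ with hY
  set L := ∫ x, ∑ i, ∑ j,
    killingMat (G + γ x) (fun i k => dV k i x + e k i x) i j ^ 2 ∂μ with hL
  set N := ∑ k, ∫ x in S, w k x ^ 2 with hN
  have hX0 : 0 ≤ X := integral_nonneg fun x => by positivity
  have hL0 : 0 ≤ L := integral_nonneg fun x => by positivity
  have hkN : ∀ k, ∫ x in S, w k x ^ 2 ≤ N := fun k =>
    Finset.single_le_sum (f := fun k => ∫ x in S, w k x ^ 2)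
      (fun k _ => integral_nonneg fun x => sq_nonneg _) (Finset.mem_univ k)
  have hN0 : 0 ≤ N := Finset.sum_nonneg fun k _ => integral_nonneg fun x => sq_nonneg _
  have hYb : Y ≤ c * N + 2 * n ^ 2 * δ₁ * X := by
    have h1 : ∀ i k, ∫ x, e k i x ^ 2 ∂μ ≤ 2 * (δ₁ * X + C₁ * (B ^ 2 * N)) + 2 * (B ^ 2 * N) := by
      intro i k
      have h2 := integral_sq_le_two_mul_add (hem k i) (hcm k i)
      have h3 : ∫ x, (e k i x - ∑ l, Γ' k i l x * V l x) ^ 2 ∂μ ≤ B ^ 2 * N := by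
        have h4 := integral_cutoff_sq_le (isClosed_tsupport χ)
          (fun x hx => pd_eq_zero_of_notMem_tsupport i hx) (hB.2 i) (hw2 k)
        refine (le_of_eq (integral_congr_ae (Eventually.of_forall fun x => ?_))).trans
          (h4.trans (mul_le_mul_of_nonneg_left (hkN k) (sq_nonneg _)))
        simp only [he]
        ring
      have h5 : ∑ k, ∫ x, V k x ^ 2 ∂μ ≤ B ^ 2 * N := by
        rw [hN, Finset.mul_sum]
        exact Finset.sum_le_sum fun k _ =>
          integral_cutoff_sq_le (isClosed_tsupport χ) hχ0 hB.1 (hw2 k)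
      have h6 := hcb k i
      have h7 := mul_le_mul_of_nonneg_left h5 hC₁
      linarith
    rw [hY, ← sum_integral_sq fun i k => hem k i]
    refine (Finset.sum_le_sum fun i _ => Finset.sum_le_sum fun k _ => h1 i k).trans (le_of_eq ?_)
    simp only [Finset.sum_const, Finset.card_univ, Fintype.card_fin, nsmul_eq_mul]
    rw [hc]
    ring
  have hXb : X ≤ 2 * C₀ * L + 2 * C₀ * c * N := by
    have h1 := mul_le_mul_of_nonneg_left hYb hC₀
    have h2 := mul_le_mul_of_nonneg_right habs hX0
    linarith
  have ham : ∀ i k, MemLp (fun x => dV k i x + e k i x) 2 μ := fun i k => (hdVm i k).add (hem k i)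
  have hab : ∫ x, ∑ i, ∑ k, (dV k i x + e k i x) ^ 2 ∂μ
      ≤ (2 * A * C₀ + 2 * A * C₀ * c + 2 * c) * (L + N) := by
    have h1 : ∫ x, ∑ i, ∑ k, (dV k i x + e k i x) ^ 2 ∂μ ≤ 2 * X + 2 * Y := by
      rw [hX, hY, ← sum_integral_sq ham, ← sum_integral_sq hdVm,
        ← sum_integral_sq fun i k => hem k i]
      simp only [Finset.mul_sum, ← Finset.sum_add_distrib]
      refine Finset.sum_le_sum fun i _ => Finset.sum_le_sum fun k _ => ?_
      have h2 := integral_sq_le_two_mul_add (ham i k) (hdVm i k)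
      simpa using h2
    have h3 := mul_le_mul_of_nonneg_left hXb hA0
    have h4 : 0 ≤ 2 * A * C₀ * N := by positivity
    have h5 : 0 ≤ 2 * A * C₀ * c * L := by positivity
    have h6 : 0 ≤ 2 * c * L := by positivity
    have h7 : 2 * X + 2 * Y ≤ A * X + 2 * (c * N) := by
      rw [hA]
      linarith
    linarith
  -- off the support of the cutoff everything vanishes, on it the cut off gradient is `χ D`
  have hoff : ∀ x ∉ tsupport χ, ∀ k i, dV k i x + e k i x = 0 := by
    intro x hx k i
    simp only [hdVd, he, hVd, hχ0 x hx]
    simp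
  have hon : ∀ᵐ x ∂(volume.restrict S), ∀ k i, dV k i x + e k i x = χ x * D k i x := by
    have h1 : ∀ᵐ x ∂(volume.restrict S), ∀ k i, D k i x = dw k i x + ∑ l, Γ k i l x * w l x :=
      ae_all_iff.2 fun k => ae_all_iff.2 fun i => hD k i
    filter_upwards [h1, ae_restrict_mem hSm] with x hx hxS k i
    have h2 : ∀ l, Γ' k i l x = Γ k i l x := fun l => indicator_of_mem hxS.1 _
    simp only [hdVd, he, hVd, h2, hx k i, mul_add, Finset.mul_sum, mul_left_comm (χ x)]
    ring
  have hred : ∀ F : EuclideanSpace ℝ (Fin n) → ℝ≥0∞, (∀ x ∉ tsupport χ, F x = 0) →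
      ∫⁻ x, F x ∂μ = ∫⁻ x in S, F x := by
    intro F hF
    rw [← hSμ, ← lintegral_indicator htm]
    refine lintegral_congr fun x => ?_
    by_cases hx : x ∈ tsupport χ
    · simp [hx]
    · simp [hx, hF x hx]
  have hLm : ∀ i j, MemLp
      (fun x => killingMat (G + γ x) (fun i k => dV k i x + e k i x) i j) 2 μ := by
    obtain ⟨b, hb⟩ := (Set.finite_range fun p : Fin n × Fin n => |G p.1 p.2|).bddAbove
    exact memLp_killingMat_of_bounded (b := b + δ)
      (fun i j => aestronglyMeasurable_const.add (hγm i j))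
      (Eventually.of_forall fun x i j =>
        (abs_add_le _ _).trans (add_le_add (hb ⟨(i, j), rfl⟩) (hγb x i j))) ham
  have e1 : ENNReal.ofReal (∫ x, ∑ i, ∑ k, (dV k i x + e k i x) ^ 2 ∂μ)
      = ∫⁻ x in S, ENNReal.ofReal (∑ i, ∑ k, (χ x * D k i x) ^ 2) := by
    rw [ofReal_integral_eq_lintegral_ofReal (integrable_sum_sq ham)
      (Eventually.of_forall fun x => by positivity), hred _ fun x hx => by simp [hoff x hx]]
    refine lintegral_congr_ae ?_
    filter_upwards [hon] with x hx
    simp only [hx]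
  have e2 : ENNReal.ofReal L = ∫⁻ x in S,
      ENNReal.ofReal (∑ i, ∑ j, (χ x * killingMat (g x) (fun i k => D k i x) i j) ^ 2) := by
    rw [hL, ofReal_integral_eq_lintegral_ofReal (integrable_sum_sq hLm)
      (Eventually.of_forall fun x => by positivity),
      hred _ fun x hx => by simp [hoff x hx, killingMat]]
    refine lintegral_congr_ae ?_
    filter_upwards [hon, ae_restrict_mem hSm] with x hx hxS
    have hg' : G + γ x = g x := by
      rw [hγ, indicator_of_mem hxS, add_sub_cancel]
    simp only [hx, hg', killingMat_smul]
  have e3 : ENNReal.ofReal N = ∫⁻ x in S, ENNReal.ofReal (∑ k, w k x ^ 2) := by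
    rw [hN, ← integral_finsetSum _ fun k _ => (hw2 k).integrable_sq]
    exact ofReal_integral_eq_lintegral_ofReal
      (integrable_finsetSum _ fun k _ => (hw2 k).integrable_sq)
      (Eventually.of_forall fun x => by positivity)
  rw [← e1, ← e2, ← e3, ← ENNReal.ofReal_add hL0 hN0, ← ENNReal.ofReal_mul (by positivity)]
  exact ENNReal.ofReal_le_ofReal hab

end LocalKorn

/-! ### Derivatives of charts and components of the metric -/

section Coordinates

open Filter

variable {n : ℕ} [NeZero n] {M : Type*} [TopologicalSpace M]

lemma measurableSet_extend_target (e : OpenPartialHomeomorph M (EuclideanHalfSpace n)) :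
    MeasurableSet (e.extend (𝓡∂ n)).target := by
  rw [OpenPartialHomeomorph.extend_target]
  exact (e.open_target.preimage (𝓡∂ n).continuous_symm).measurableSet.inter
    (𝓡∂ n).isClosed_range.measurableSet

lemma extend_target_mem_nhdsWithin' {e : OpenPartialHomeomorph M (EuclideanHalfSpace n)}
    {y : EuclideanSpace ℝ (Fin n)} (hy : y ∈ (e.extend (𝓡∂ n)).target) :
    (e.extend (𝓡∂ n)).target ∈ 𝓝[range (𝓡∂ n)] y := by
  rw [OpenPartialHomeomorph.extend_target] at hy ⊢
  exact inter_mem (mem_nhdsWithin_of_mem_nhds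
    ((e.open_target.preimage (𝓡∂ n).continuous_symm).mem_nhds hy.1)) self_mem_nhdsWithin

lemma uniqueMDiffOn_extend_target (e : OpenPartialHomeomorph M (EuclideanHalfSpace n)) :
    UniqueMDiffOn 𝓘(ℝ, EuclideanSpace ℝ (Fin n)) (e.extend (𝓡∂ n)).target := by
  rw [uniqueMDiffOn_iff_uniqueDiffOn, OpenPartialHomeomorph.extend_target, inter_comm]
  exact (𝓡∂ n).uniqueDiffOn.inter (e.open_target.preimage (𝓡∂ n).continuous_symm)

variable [ChartedSpace (EuclideanHalfSpace n) M]

/-- The derivative of the inverse of the chart `e` at the point with coordinates `y`, as an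
endomorphism of `ℝⁿ`. -/
def symmDeriv (e : OpenPartialHomeomorph M (EuclideanHalfSpace n))
    (y : EuclideanSpace ℝ (Fin n)) : EuclideanSpace ℝ (Fin n) →L[ℝ] EuclideanSpace ℝ (Fin n) :=
  mfderivWithin 𝓘(ℝ, EuclideanSpace ℝ (Fin n)) (𝓡∂ n) (e.extend (𝓡∂ n)).symm (range (𝓡∂ n)) y

/-- The derivative of the chart `e` at the point `x`, as an endomorphism of `ℝⁿ`. -/
def chartDeriv (e : OpenPartialHomeomorph M (EuclideanHalfSpace n)) (x : M) :
    EuclideanSpace ℝ (Fin n) →L[ℝ] EuclideanSpace ℝ (Fin n) :=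
  mfderiv (𝓡∂ n) 𝓘(ℝ, EuclideanSpace ℝ (Fin n)) (e.extend (𝓡∂ n)) x

lemma vecCoord_eq (e : OpenPartialHomeomorph M (EuclideanHalfSpace n)) (k : Fin n) (x : M)
    (w : EuclideanSpace ℝ (Fin n)) : vecCoord e k x w = chartDeriv e x w k :=
  rfl

variable {e e' : OpenPartialHomeomorph M (EuclideanHalfSpace n)}

lemma contMDiffOn_extend_symm_target (he : e ∈ IsManifold.maximalAtlas (𝓡∂ n) ∞ M) :
    ContMDiffOn 𝓘(ℝ, EuclideanSpace ℝ (Fin n)) (𝓡∂ n) ∞ (e.extend (𝓡∂ n)).symm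
      (e.extend (𝓡∂ n)).target := by
  have := contMDiffOn_extend_symm he
  rwa [(𝓡∂ n).image_eq, ← OpenPartialHomeomorph.extend_target] at this

lemma mdifferentiableWithinAt_extend_symm (he : e ∈ IsManifold.maximalAtlas (𝓡∂ n) ∞ M)
    {y : EuclideanSpace ℝ (Fin n)} (hy : y ∈ (e.extend (𝓡∂ n)).target) :
    MDifferentiableWithinAt 𝓘(ℝ, EuclideanSpace ℝ (Fin n)) (𝓡∂ n) (e.extend (𝓡∂ n)).symm
      (range (𝓡∂ n)) y :=
  (((contMDiffOn_extend_symm_target he) y hy).mdifferentiableWithinAt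
    (by simp)).mono_of_mem_nhdsWithin
    (extend_target_mem_nhdsWithin' hy)

lemma mdifferentiableAt_extend' (he : e ∈ IsManifold.maximalAtlas (𝓡∂ n) ∞ M)
    {x : M} (hx : x ∈ (e.extend (𝓡∂ n)).source) :
    MDifferentiableAt (𝓡∂ n) 𝓘(ℝ, EuclideanSpace ℝ (Fin n)) (e.extend (𝓡∂ n)) x := by
  rw [OpenPartialHomeomorph.extend_source] at hx
  exact (e.contMDiffAt_extend he hx).mdifferentiableAt (by simp)

/-- The derivative of the change of coordinates is the composition of the derivatives. -/
lemma hasFDerivWithinAt_transition (he : e ∈ IsManifold.maximalAtlas (𝓡∂ n) ∞ M)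
    (he' : e' ∈ IsManifold.maximalAtlas (𝓡∂ n) ∞ M)
    {y : EuclideanSpace ℝ (Fin n)} (hy : y ∈ (e.extend (𝓡∂ n)).target)
    (hy' : (e.extend (𝓡∂ n)).symm y ∈ (e'.extend (𝓡∂ n)).source) :
    HasFDerivWithinAt (e'.extend (𝓡∂ n) ∘ (e.extend (𝓡∂ n)).symm)
      (chartDeriv e' ((e.extend (𝓡∂ n)).symm y) ∘L symmDeriv e y) (range (𝓡∂ n)) y :=
  ((mdifferentiableAt_extend' he' hy').hasMFDerivAt.comp_hasMFDerivWithinAt y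
    (mdifferentiableWithinAt_extend_symm he hy).hasMFDerivWithinAt).hasFDerivWithinAt

lemma chartDeriv_comp_symmDeriv (he : e ∈ IsManifold.maximalAtlas (𝓡∂ n) ∞ M)
    {y : EuclideanSpace ℝ (Fin n)} (hy : y ∈ (e.extend (𝓡∂ n)).target) :
    chartDeriv e ((e.extend (𝓡∂ n)).symm y) ∘L symmDeriv e y = ContinuousLinearMap.id ℝ _ := by
  have hU : UniqueDiffWithinAt ℝ (range (𝓡∂ n)) y :=
    (𝓡∂ n).uniqueDiffOn _ (e.extend_target_subset_range hy)
  refine hU.eq (hasFDerivWithinAt_transition he he hy ((e.extend (𝓡∂ n)).map_target hy)) ?_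
  refine (hasFDerivWithinAt_id y _).congr_of_eventuallyEq ?_ ?_
  · filter_upwards [extend_target_mem_nhdsWithin' hy] with z hz
    exact (e.extend (𝓡∂ n)).right_inv hz
  · exact (e.extend (𝓡∂ n)).right_inv hy

lemma symmDeriv_comp_chartDeriv (he : e ∈ IsManifold.maximalAtlas (𝓡∂ n) ∞ M)
    {y : EuclideanSpace ℝ (Fin n)} (hy : y ∈ (e.extend (𝓡∂ n)).target) :
    symmDeriv e y ∘L chartDeriv e ((e.extend (𝓡∂ n)).symm y) = ContinuousLinearMap.id ℝ _ := by
  have h := congrArg ContinuousLinearMap.toLinearMap (chartDeriv_comp_symmDeriv he hy)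
  have h2 := (LinearMap.comp_eq_id_comm ℝ (EuclideanSpace ℝ (Fin n))).1 h
  ext1 v
  exact congrArg (fun f => f v) h2

lemma chartDeriv_symmDeriv (he : e ∈ IsManifold.maximalAtlas (𝓡∂ n) ∞ M)
    {y : EuclideanSpace ℝ (Fin n)} (hy : y ∈ (e.extend (𝓡∂ n)).target)
    (v : EuclideanSpace ℝ (Fin n)) :
    chartDeriv e ((e.extend (𝓡∂ n)).symm y) (symmDeriv e y v) = v :=
  congrArg (fun f => f v) (chartDeriv_comp_symmDeriv he hy)

lemma symmDeriv_chartDeriv (he : e ∈ IsManifold.maximalAtlas (𝓡∂ n) ∞ M)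
    {y : EuclideanSpace ℝ (Fin n)} (hy : y ∈ (e.extend (𝓡∂ n)).target)
    (v : EuclideanSpace ℝ (Fin n)) :
    symmDeriv e y (chartDeriv e ((e.extend (𝓡∂ n)).symm y) v) = v :=
  congrArg (fun f => f v) (symmDeriv_comp_chartDeriv he hy)

variable [IsManifold (𝓡∂ n) ∞ M]

/-- The metric at a point, as a bilinear form on `ℝⁿ`. -/
def metricForm (g : Metric n M) (x : M) :
    EuclideanSpace ℝ (Fin n) →L[ℝ] EuclideanSpace ℝ (Fin n) →L[ℝ] ℝ :=
  g.inner x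

/-- The matrix of the components of the metric in the chart `e`. -/
def metricMat (g : Metric n M) (e : OpenPartialHomeomorph M (EuclideanHalfSpace n))
    (y : EuclideanSpace ℝ (Fin n)) : Matrix (Fin n) (Fin n) ℝ :=
  Matrix.of fun i j => metricCoord g e i j y

lemma metricMat_apply (g : Metric n M) (e : OpenPartialHomeomorph M (EuclideanHalfSpace n))
    (y : EuclideanSpace ℝ (Fin n)) (i j : Fin n) :
    metricMat g e y i j = metricForm g ((e.extend (𝓡∂ n)).symm y)
      (symmDeriv e y (EuclideanSpace.single i 1)) (symmDeriv e y (EuclideanSpace.single j 1)) :=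
  rfl

lemma continuousOn_metricCoord (g : Metric n M) (he : e ∈ IsManifold.maximalAtlas (𝓡∂ n) ∞ M)
    (i j : Fin n) : ContinuousOn (metricCoord g e i j) (e.extend (𝓡∂ n)).target := by
  set φ := e.extend (𝓡∂ n) with hφ
  have hsymm : ContinuousOn φ.symm φ.target := e.continuousOn_extend_symm
  have hv : ∀ i, ContinuousOn (fun y => Bundle.TotalSpace.mk' (EuclideanSpace ℝ (Fin n))
      (E := fun x : M => TangentSpace (𝓡∂ n) x) (φ.symm y) (coordVec e i y)) φ.target := by
    intro i
    have h1 := (contMDiffOn_extend_symm_target he).continuousOn_tangentMapWithin (by simp)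
      (uniqueMDiffOn_extend_target e)
    have h2 : ContinuousOn (fun y => (⟨y, EuclideanSpace.single i 1⟩ :
        TangentBundle 𝓘(ℝ, EuclideanSpace ℝ (Fin n)) (EuclideanSpace ℝ (Fin n)))) φ.target := by
      refine Continuous.continuousOn ?_
      exact ((tangentBundleModelSpaceHomeomorph 𝓘(ℝ, EuclideanSpace ℝ (Fin n))).symm.continuous.comp
        (continuous_id.prodMk continuous_const) :)
    refine (h1.comp h2 fun y hy => hy).congr fun y hy => ?_
    simp only [Function.comp, tangentMapWithin, coordVec]
    have h3 : (e.extend (𝓡∂ n)).target =ᶠ[𝓝 y] range (𝓡∂ n) :=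
      (e.extend_target_subset_range).eventuallyLE.antisymm
        (mem_nhdsWithin_iff_eventually.1 (extend_target_mem_nhdsWithin' hy))
    rw [mfderivWithin_congr_set h3]
  have hg : ContinuousOn (fun y => Bundle.TotalSpace.mk'
      (EuclideanSpace ℝ (Fin n) →L[ℝ] EuclideanSpace ℝ (Fin n) →L[ℝ] ℝ)
      (E := fun x : M => TangentSpace (𝓡∂ n) x →L[ℝ] TangentSpace (𝓡∂ n) x →L[ℝ] ℝ)
      (φ.symm y) (g.inner (φ.symm y))) φ.target :=
    g.continuous.comp_continuousOn hsymm
  have h3 : ContinuousOn (fun y => Bundle.TotalSpace.mk' ℝ (E := Bundle.Trivial M ℝ) (φ.symm y)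
      (g.inner (φ.symm y) (coordVec e i y) (coordVec e j y))) φ.target :=
    ContinuousOn.clm_bundle_apply₂ (F₁ := EuclideanSpace ℝ (Fin n))
      (F₂ := EuclideanSpace ℝ (Fin n)) hg (hv i) (hv j)
  intro y hy
  have h4 := h3 y hy
  simp only [FiberBundle.continuousWithinAt_totalSpace] at h4
  exact h4.2

lemma metricForm_symm (g : Metric n M) (x : M) (v w : EuclideanSpace ℝ (Fin n)) :
    metricForm g x v w = metricForm g x w v :=
  g.symm x v w

lemma metricForm_pos (g : Metric n M) (x : M) {v : EuclideanSpace ℝ (Fin n)} (hv : v ≠ 0) :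
    0 < metricForm g x v v :=
  g.pos x v hv

end Coordinates

/-! ### Matrices of bilinear forms and of endomorphisms -/

section Gram

variable {n : ℕ}

/-- The matrix of a bilinear form on `ℝⁿ` in the basis obtained from the standard one by `L`. -/
def formMat (β : EuclideanSpace ℝ (Fin n) → EuclideanSpace ℝ (Fin n) → ℝ)
    (L : EuclideanSpace ℝ (Fin n) →L[ℝ] EuclideanSpace ℝ (Fin n)) : Matrix (Fin n) (Fin n) ℝ :=
  Matrix.of fun i j => β (L (EuclideanSpace.single i 1)) (L (EuclideanSpace.single j 1))

/-- The matrix of an endomorphism of `ℝⁿ`. -/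
def endMat (L : EuclideanSpace ℝ (Fin n) →L[ℝ] EuclideanSpace ℝ (Fin n)) :
    Matrix (Fin n) (Fin n) ℝ :=
  Matrix.of fun a i => L (EuclideanSpace.single i 1) a

lemma endMat_eq_toMatrix (L : EuclideanSpace ℝ (Fin n) →L[ℝ] EuclideanSpace ℝ (Fin n)) :
    endMat L = LinearMap.toMatrix (EuclideanSpace.basisFun (Fin n) ℝ).toBasis
      (EuclideanSpace.basisFun (Fin n) ℝ).toBasis L.toLinearMap := by
  ext a i
  simp [endMat, LinearMap.toMatrix_apply]

lemma det_endMat (L : EuclideanSpace ℝ (Fin n) →L[ℝ] EuclideanSpace ℝ (Fin n)) :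
    (endMat L).det = L.det := by
  rw [endMat_eq_toMatrix, LinearMap.det_toMatrix]

lemma endMat_comp (L L' : EuclideanSpace ℝ (Fin n) →L[ℝ] EuclideanSpace ℝ (Fin n)) :
    endMat (L ∘L L') = endMat L * endMat L' := by
  simp only [endMat_eq_toMatrix]
  exact LinearMap.toMatrix_comp _ _ _ _ _

lemma endMat_id : endMat (ContinuousLinearMap.id ℝ (EuclideanSpace ℝ (Fin n))) = 1 := by
  rw [endMat_eq_toMatrix]
  exact LinearMap.toMatrix_id _

lemma euclidean_eq_sum (v : EuclideanSpace ℝ (Fin n)) :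
    v = ∑ i, v i • (EuclideanSpace.single i (1 : ℝ)) := by
  have := (EuclideanSpace.basisFun (Fin n) ℝ).sum_repr v
  simpa using this.symm

/-- Change of basis for bilinear forms. -/
lemma formMat_comp {f : EuclideanSpace ℝ (Fin n) → EuclideanSpace ℝ (Fin n) → ℝ}
    {β : EuclideanSpace ℝ (Fin n) →ₗ[ℝ] EuclideanSpace ℝ (Fin n) →ₗ[ℝ] ℝ}
    (hf : ∀ v w, f v w = β v w)
    (L P : EuclideanSpace ℝ (Fin n) →L[ℝ] EuclideanSpace ℝ (Fin n)) :
    formMat f (L ∘L P) = (endMat P).transpose * formMat f L * endMat P := by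
  ext i j
  have h1 : ∀ i, L (P (EuclideanSpace.single i 1))
      = ∑ a, endMat P a i • L (EuclideanSpace.single a 1) := by
    intro i
    conv_lhs => rw [euclidean_eq_sum (P (EuclideanSpace.single i 1)), map_sum]
    simp [endMat]
  simp only [formMat, Matrix.of_apply, ContinuousLinearMap.comp_apply, hf, h1, map_sum, map_smul,
    LinearMap.sum_apply, LinearMap.smul_apply, smul_eq_mul, Matrix.mul_apply,
    Matrix.transpose_apply, Finset.sum_mul, Finset.mul_sum]
  refine Finset.sum_congr rfl fun a _ => Finset.sum_congr rfl fun b _ => ?_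
  ring

end Gram

/-! ### The Riemannian measure in a chart -/

section Volume

open Filter

variable {n : ℕ} [NeZero n] {M : Type*} [TopologicalSpace M]

lemma measurableSet_extend_preimage [MeasurableSpace M] [BorelSpace M]
    {e : OpenPartialHomeomorph M (EuclideanHalfSpace n)}
    {s : Set (EuclideanSpace ℝ (Fin n))} (hs : MeasurableSet s) :
    MeasurableSet (e.source ∩ e.extend (𝓡∂ n) ⁻¹' s) := by
  have hc : ContinuousOn (e.extend (𝓡∂ n)) e.source :=
    e.continuousOn_extend (I := 𝓡∂ n) |>.mono (by rw [e.extend_source])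
  have h1 : MeasurableSet ((e.source.domRestrict (e.extend (𝓡∂ n))) ⁻¹' s) :=
    (continuousOn_iff_continuous_domRestrict.1 hc).measurable hs
  have h2 := e.open_source.measurableSet.subtype_image h1
  rwa [domRestrict_eq, preimage_comp, Subtype.image_preimage_coe] at h2

lemma image_extend_inter_preimage {e : OpenPartialHomeomorph M (EuclideanHalfSpace n)}
    (s : Set (EuclideanSpace ℝ (Fin n))) :
    e.extend (𝓡∂ n) '' (e.source ∩ e.extend (𝓡∂ n) ⁻¹' s) = s ∩ (e.extend (𝓡∂ n)).target := by
  set φ := e.extend (𝓡∂ n) with hφ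
  have hs : φ.source = e.source := e.extend_source
  rw [← hs]
  ext y
  constructor
  · rintro ⟨x, ⟨hx, hxs⟩, rfl⟩
    exact ⟨hxs, φ.map_source hx⟩
  · rintro ⟨hys, hy⟩
    exact ⟨φ.symm y, ⟨φ.map_target hy, by rwa [mem_preimage, φ.right_inv hy]⟩, φ.right_inv hy⟩

variable [ChartedSpace (EuclideanHalfSpace n) M]

variable {e e' : OpenPartialHomeomorph M (EuclideanHalfSpace n)}

lemma symmDeriv_transition (he' : e' ∈ IsManifold.maximalAtlas (𝓡∂ n) ∞ M) {x : M}
    (hx : x ∈ (e'.extend (𝓡∂ n)).source) (y : EuclideanSpace ℝ (Fin n)) :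
    symmDeriv e' (e'.extend (𝓡∂ n) x) ∘L (chartDeriv e' x ∘L symmDeriv e y) = symmDeriv e y := by
  ext1 v
  have h := symmDeriv_chartDeriv he' ((e'.extend (𝓡∂ n)).map_source hx) (symmDeriv e y v)
  rw [(e'.extend (𝓡∂ n)).left_inv hx] at h
  exact h

variable [IsManifold (𝓡∂ n) ∞ M]

lemma metricMat_transition (g : Metric n M) (he' : e' ∈ IsManifold.maximalAtlas (𝓡∂ n) ∞ M)
    {y : EuclideanSpace ℝ (Fin n)}
    (hy' : (e.extend (𝓡∂ n)).symm y ∈ (e'.extend (𝓡∂ n)).source) :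
    metricMat g e y
      = (endMat (chartDeriv e' ((e.extend (𝓡∂ n)).symm y) ∘L symmDeriv e y)).transpose
        * metricMat g e' (e'.extend (𝓡∂ n) ((e.extend (𝓡∂ n)).symm y))
        * endMat (chartDeriv e' ((e.extend (𝓡∂ n)).symm y) ∘L symmDeriv e y) := by
  set x := (e.extend (𝓡∂ n)).symm y with hx
  have h1 : metricMat g e' (e'.extend (𝓡∂ n) x)
      = formMat (fun v w => metricForm g x v w) (symmDeriv e' (e'.extend (𝓡∂ n) x)) := by
    ext i j
    rw [metricMat_apply, (e'.extend (𝓡∂ n)).left_inv hy']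
    rfl
  rw [h1, ← formMat_comp (f := fun v w => metricForm g x v w)
      (β := (metricForm g x).toLinearMap₁₂) (fun v w => rfl),
    symmDeriv_transition he' hy']
  rfl

/-- The Riemannian density `√(det gᵢⱼ)` in the chart `e`. -/
def density (g : Metric n M) (e : OpenPartialHomeomorph M (EuclideanHalfSpace n))
    (y : EuclideanSpace ℝ (Fin n)) : ℝ≥0∞ :=
  ENNReal.ofReal (Real.sqrt (metricMat g e y).det)

lemma density_transition (g : Metric n M) (he' : e' ∈ IsManifold.maximalAtlas (𝓡∂ n) ∞ M)
    {y : EuclideanSpace ℝ (Fin n)}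
    (hy' : (e.extend (𝓡∂ n)).symm y ∈ (e'.extend (𝓡∂ n)).source) :
    density g e y = ENNReal.ofReal
        |(chartDeriv e' ((e.extend (𝓡∂ n)).symm y) ∘L symmDeriv e y).det|
      * density g e' ((e'.extend (𝓡∂ n) ∘ (e.extend (𝓡∂ n)).symm) y) := by
  rw [density, metricMat_transition g he' hy', Matrix.det_mul, Matrix.det_mul,
    Matrix.det_transpose, det_endMat, mul_right_comm, ← sq, Real.sqrt_mul (sq_nonneg _),
    Real.sqrt_sq_eq_abs, ENNReal.ofReal_mul (abs_nonneg _)]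
  rfl

lemma coordVol_eq (g : Metric n M) (A : Set M) :
    coordVol g e A = ∫⁻ y in e.extend (𝓡∂ n) '' A, density g e y :=
  rfl

/-- Coordinate volumes do not depend on the chart. As `A` need not be measurable, its image is
enlarged to a measurable set before changing variables. -/
lemma coordVol_le_coordVol (g : Metric n M) (he : e ∈ IsManifold.maximalAtlas (𝓡∂ n) ∞ M)
    (he' : e' ∈ IsManifold.maximalAtlas (𝓡∂ n) ∞ M) {A : Set M} (hA : A ⊆ e.source)
    (hA' : A ⊆ e'.source) : coordVol g e' A ≤ coordVol g e A := by
  rw [coordVol_eq, coordVol_eq]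
  set φ := e.extend (𝓡∂ n) with hφ
  set φ' := e'.extend (𝓡∂ n) with hφ'
  have hs : φ.source = e.source := e.extend_source
  have hs' : φ'.source = e'.source := e'.extend_source
  -- the coordinates in `e` of the points in both charts
  set P : Set (EuclideanSpace ℝ (Fin n)) := φ.target ∩ φ.symm ⁻¹' φ'.source with hP
  have hPm : MeasurableSet P := by
    have : P = (𝓡∂ n).symm ⁻¹' (e.target ∩ e.symm ⁻¹' e'.source) ∩ range (𝓡∂ n) := by
      rw [hP, hs', hφ, OpenPartialHomeomorph.extend_target]
      ext y
      simp only [mem_inter_iff, mem_preimage, OpenPartialHomeomorph.extend_coe_symm,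
        Function.comp_apply]
      tauto
    rw [this]
    exact ((e.isOpen_inter_preimage_symm e'.open_source).preimage
      (𝓡∂ n).continuous_symm).measurableSet.inter (𝓡∂ n).isClosed_range.measurableSet
  set Q : Set (EuclideanSpace ℝ (Fin n)) := toMeasurable volume (φ '' A) ∩ P with hQ
  have hQm : MeasurableSet Q := (measurableSet_toMeasurable _ _).inter hPm
  set τ : EuclideanSpace ℝ (Fin n) → EuclideanSpace ℝ (Fin n) := φ' ∘ φ.symm with hτ
  have hsub : φ' '' A ⊆ τ '' Q := by
    rintro _ ⟨x, hx, rfl⟩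
    have hxs : x ∈ φ.source := hs ▸ hA hx
    have hl : φ.symm (φ x) = x := φ.left_inv hxs
    refine ⟨φ x, ⟨subset_toMeasurable _ _ ⟨x, hx, rfl⟩, φ.map_source hxs, ?_⟩, ?_⟩
    · rw [mem_preimage, hl, hs']
      exact hA' hx
    · simp only [hτ, Function.comp_apply, hl]
  have hinj : InjOn τ Q := by
    intro y hy z hz hyz
    have h1 : φ.symm y = φ.symm z := φ'.injOn hy.2.2 hz.2.2 hyz
    exact φ.symm.injOn hy.2.1 hz.2.1 h1
  have hder : ∀ y ∈ Q, HasFDerivWithinAt τ (chartDeriv e' (φ.symm y) ∘L symmDeriv e y) Q y :=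
    fun y hy => (hasFDerivWithinAt_transition he he' hy.2.1 hy.2.2).mono fun z hz =>
      e.extend_target_subset_range hz.2.1
  calc ∫⁻ y in φ' '' A, density g e' y ≤ ∫⁻ y in τ '' Q, density g e' y :=
        lintegral_mono_set hsub
    _ = ∫⁻ y in Q, ENNReal.ofReal |(chartDeriv e' (φ.symm y) ∘L symmDeriv e y).det|
          * density g e' (τ y) :=
        lintegral_image_eq_lintegral_abs_det_fderiv_mul volume hQm hder hinj _
    _ = ∫⁻ y in Q, density g e y :=
        setLIntegral_congr_fun hQm fun y hy => (density_transition g he' hy.2.2).symm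
    _ ≤ ∫⁻ y in toMeasurable volume (φ '' A), density g e y :=
        lintegral_mono_set inter_subset_left
    _ = ∫⁻ y in φ '' A, density g e y := by
        rw [Measure.restrict_toMeasurable_of_sFinite]

/-- In the domain of a chart, the outer measure defining the Riemannian measure is the coordinate
volume. -/
lemma outerVol_eq_coordVol (g : Metric n M) (he : e ∈ IsManifold.maximalAtlas (𝓡∂ n) ∞ M)
    {A : Set M} (hA : A ⊆ e.source) : outerVol g A = coordVol g e A := by
  refine le_antisymm ?_ ?_
  · exact (OuterMeasure.boundedBy_le _).trans (iInf₂_le_of_le e he (iInf_le_of_le hA le_rfl))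
  · let m : OuterMeasure M :=
      { measureOf := fun B => coordVol g e (B ∩ e.source)
        empty := by simp [coordVol]
        mono := fun {B B'} h => lintegral_mono_set (image_mono (inter_subset_inter_left _ h))
        iUnion_nat := fun B _ => by
          rw [iUnion_inter, coordVol, image_iUnion]
          exact lintegral_iUnion_le _ _ }
    have hm : m ≤ outerVol g := by
      refine OuterMeasure.le_boundedBy.2 fun B => le_iInf₂ fun e' he' => le_iInf fun hB => ?_
      exact (coordVol_le_coordVol g he' he (inter_subset_left.trans hB) inter_subset_right).trans
        (lintegral_mono_set (image_mono inter_subset_left))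
    have h1 := hm A
    have h2 : m A = coordVol g e A := by
      show coordVol g e (A ∩ e.source) = _
      rw [inter_eq_left.2 hA]
    rwa [h2] at h1

lemma continuousOn_metricMat_det (g : Metric n M)
    (he : e ∈ IsManifold.maximalAtlas (𝓡∂ n) ∞ M) :
    ContinuousOn (fun y => (metricMat g e y).det) (e.extend (𝓡∂ n)).target := by
  simp only [Matrix.det_apply]
  exact continuousOn_finsetSum _ fun σ _ => continuousOn_const.smul
    (continuousOn_finsetProd _ fun i _ => continuousOn_metricCoord g he _ _)

lemma aemeasurable_density (g : Metric n M) (he : e ∈ IsManifold.maximalAtlas (𝓡∂ n) ∞ M) :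
    AEMeasurable (density g e) (volume.restrict (e.extend (𝓡∂ n)).target) :=
  (((Real.continuous_sqrt.comp_continuousOn (continuousOn_metricMat_det g he)).aemeasurable
    (measurableSet_extend_target e))).ennreal_ofReal

variable [MeasurableSpace M] [BorelSpace M]

lemma riemVol_apply (g : Metric n M) (he : e ∈ IsManifold.maximalAtlas (𝓡∂ n) ∞ M)
    {A : Set M} (hA : A ⊆ e.source) (hAm : MeasurableSet A) : riemVol g A = coordVol g e A := by
  rw [riemVol, toMeasure_apply _ _ hAm, outerVol_eq_coordVol g he hA]

lemma aemeasurable_extend (g : Metric n M) : AEMeasurable (e.extend (𝓡∂ n))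
    ((riemVol g).restrict e.source) :=
  (e.continuousOn_extend (I := 𝓡∂ n) |>.mono (by rw [e.extend_source])).aemeasurable
    e.open_source.measurableSet

/-- The image of the Riemannian measure under a chart has density `√(det gᵢⱼ)`. -/
lemma map_extend_riemVol (g : Metric n M) (he : e ∈ IsManifold.maximalAtlas (𝓡∂ n) ∞ M)
    {s : Set (EuclideanSpace ℝ (Fin n))} (hs : MeasurableSet s)
    (hsub : s ⊆ (e.extend (𝓡∂ n)).target) :
    Measure.map (e.extend (𝓡∂ n)) ((riemVol g).restrict (e.source ∩ e.extend (𝓡∂ n) ⁻¹' s))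
      = (volume.restrict s).withDensity (density g e) := by
  ext t ht
  rw [Measure.map_apply_of_aemeasurable
      ((aemeasurable_extend g).mono_measure (Measure.restrict_mono inter_subset_left le_rfl)) ht,
    Measure.restrict_apply' (measurableSet_extend_preimage hs), inter_comm, inter_assoc,
    ← preimage_inter, riemVol_apply g he inter_subset_left
      (measurableSet_extend_preimage (hs.inter ht)),
    withDensity_apply _ ht, Measure.restrict_restrict ht, coordVol_eq,
    image_extend_inter_preimage, inter_eq_left.2 (inter_subset_left.trans hsub), inter_comm]

/-- Integration in a chart over the points with coordinates in `s`. -/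
lemma setLIntegral_riemVol (g : Metric n M) (he : e ∈ IsManifold.maximalAtlas (𝓡∂ n) ∞ M)
    {s : Set (EuclideanSpace ℝ (Fin n))} (hs : MeasurableSet s)
    (hsub : s ⊆ (e.extend (𝓡∂ n)).target) {F : M → ℝ≥0∞}
    (hF : AEMeasurable (fun y => F ((e.extend (𝓡∂ n)).symm y)) (volume.restrict s)) :
    ∫⁻ x in e.source ∩ e.extend (𝓡∂ n) ⁻¹' s, F x ∂(riemVol g)
      = ∫⁻ y in s, density g e y * F ((e.extend (𝓡∂ n)).symm y) := by
  have hφ := (aemeasurable_extend (e := e) g).mono_measure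
    (Measure.restrict_mono (inter_subset_left (t := e.extend (𝓡∂ n) ⁻¹' s)) le_rfl)
  have hmap := map_extend_riemVol g he hs hsub
  have hF' : AEMeasurable (fun y => F ((e.extend (𝓡∂ n)).symm y))
      ((volume.restrict s).withDensity (density g e)) :=
    hF.mono_ac (withDensity_absolutelyContinuous _ _)
  have hd : AEMeasurable (density g e) (volume.restrict s) :=
    (aemeasurable_density g he).mono_measure (Measure.restrict_mono hsub le_rfl)
  calc _ = ∫⁻ x in e.source ∩ e.extend (𝓡∂ n) ⁻¹' s,
        F ((e.extend (𝓡∂ n)).symm (e.extend (𝓡∂ n) x)) ∂(riemVol g) := by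
        refine setLIntegral_congr_fun (measurableSet_extend_preimage hs) fun x hx => ?_
        rw [(e.extend (𝓡∂ n)).left_inv (by rw [e.extend_source]; exact hx.1)]
    _ = ∫⁻ y, F ((e.extend (𝓡∂ n)).symm y)
          ∂((volume.restrict s).withDensity (density g e)) := by
        rw [← hmap] at hF' ⊢
        exact (lintegral_map' hF' hφ).symm
    _ = _ := lintegral_withDensity_eq_lintegral_mul₀' hd hF'

lemma ae_riemVol_of_ae (g : Metric n M) (he : e ∈ IsManifold.maximalAtlas (𝓡∂ n) ∞ M)
    {s : Set (EuclideanSpace ℝ (Fin n))} (hs : MeasurableSet s)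
    (hsub : s ⊆ (e.extend (𝓡∂ n)).target) {p : M → Prop}
    (hp : ∀ᵐ y ∂(volume.restrict s), p ((e.extend (𝓡∂ n)).symm y)) :
    ∀ᵐ x ∂((riemVol g).restrict (e.source ∩ e.extend (𝓡∂ n) ⁻¹' s)), p x := by
  have hφ := (aemeasurable_extend (e := e) g).mono_measure
    (Measure.restrict_mono (inter_subset_left (t := e.extend (𝓡∂ n) ⁻¹' s)) le_rfl)
  have h1 : ∀ᵐ y ∂(Measure.map (e.extend (𝓡∂ n))
      ((riemVol g).restrict (e.source ∩ e.extend (𝓡∂ n) ⁻¹' s))), p ((e.extend (𝓡∂ n)).symm y) := by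
    rw [map_extend_riemVol g he hs hsub]
    exact (withDensity_absolutelyContinuous _ _).ae_le hp
  filter_upwards [ae_of_ae_map hφ h1, ae_restrict_mem (measurableSet_extend_preimage hs)]
    with x hx hxs
  rwa [(e.extend (𝓡∂ n)).left_inv (by rw [e.extend_source]; exact hxs.1)] at hx

lemma aemeasurable_riemVol (g : Metric n M) (he : e ∈ IsManifold.maximalAtlas (𝓡∂ n) ∞ M)
    {s : Set (EuclideanSpace ℝ (Fin n))} (hs : MeasurableSet s)
    (hsub : s ⊆ (e.extend (𝓡∂ n)).target) {F : M → ℝ}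
    (hF : AEMeasurable (fun y => F ((e.extend (𝓡∂ n)).symm y)) (volume.restrict s)) :
    AEMeasurable F ((riemVol g).restrict (e.source ∩ e.extend (𝓡∂ n) ⁻¹' s)) := by
  have hφ := (aemeasurable_extend (e := e) g).mono_measure
    (Measure.restrict_mono (inter_subset_left (t := e.extend (𝓡∂ n) ⁻¹' s)) le_rfl)
  have h1 : AEMeasurable (fun y => F ((e.extend (𝓡∂ n)).symm y)) (Measure.map (e.extend (𝓡∂ n))
      ((riemVol g).restrict (e.source ∩ e.extend (𝓡∂ n) ⁻¹' s))) := by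
    rw [map_extend_riemVol g he hs hsub]
    exact hF.mono_ac (withDensity_absolutelyContinuous _ _)
  refine (h1.comp_aemeasurable hφ).congr ?_
  filter_upwards [ae_restrict_mem (measurableSet_extend_preimage hs)] with x hxs
  rw [Function.comp_apply, (e.extend (𝓡∂ n)).left_inv (by rw [e.extend_source]; exact hxs.1)]

end Volume

/-! ### Norms of bilinear forms -/

section FormNorm

variable {n : ℕ}

/-- `gⁱᵏ gʲˡ Tᵢⱼ Tₖₗ`, for matrices of components. -/
def formSq (G T : Matrix (Fin n) (Fin n) ℝ) : ℝ :=
  ∑ i, ∑ j, ∑ k, ∑ l, G⁻¹ i k * G⁻¹ j l * T i j * T k l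

lemma formSq_eq_trace (G T : Matrix (Fin n) (Fin n) ℝ) :
    formSq G T = (G⁻¹ * T * G⁻¹.transpose * T.transpose).trace := by
  simp only [formSq, Matrix.trace, Matrix.diag, Matrix.mul_apply, Matrix.transpose_apply,
    Finset.sum_mul]
  refine Finset.sum_congr rfl fun i _ => Finset.sum_congr rfl fun j _ => ?_
  rw [Finset.sum_comm]
  refine Finset.sum_congr rfl fun l _ => Finset.sum_congr rfl fun k _ => ?_
  ring

/-- The norm of a bilinear form does not depend on the basis. -/
lemma formSq_congr {P : Matrix (Fin n) (Fin n) ℝ} (hP : IsUnit P.det)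
    (G T : Matrix (Fin n) (Fin n) ℝ) :
    formSq (P.transpose * G * P) (P.transpose * T * P) = formSq G T := by
  have hPt : IsUnit P.transpose.det := by rwa [Matrix.det_transpose]
  have h1 : P * P⁻¹ = 1 := Matrix.mul_nonsing_inv _ hP
  have h2 : P.transpose⁻¹ * P.transpose = 1 := Matrix.nonsing_inv_mul _ hPt
  have h3 : P * P⁻¹ = 1 := h1
  rw [formSq_eq_trace, formSq_eq_trace, Matrix.mul_inv_rev, Matrix.mul_inv_rev]
  simp only [Matrix.transpose_mul, Matrix.transpose_transpose, Matrix.transpose_nonsing_inv,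
    Matrix.mul_assoc]
  rw [Matrix.trace_mul_comm]
  simp only [Matrix.mul_assoc, Matrix.nonsing_inv_mul_cancel_left _ _ hPt,
    Matrix.mul_nonsing_inv_cancel_left _ _ hP, h1, Matrix.mul_one]

lemma formSq_one (T : Matrix (Fin n) (Fin n) ℝ) : formSq 1 T = ∑ i, ∑ j, T i j ^ 2 := by
  simp [formSq, Matrix.one_apply, sq]

open scoped MatrixOrder Matrix.Norms.L2Operator in
lemma formSq_pos {G T : Matrix (Fin n) (Fin n) ℝ} (hG : G.PosDef) (hT : T ≠ 0) :
    0 < formSq G T := by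
  obtain ⟨B, hB⟩ := CStarAlgebra.nonneg_iff_eq_star_mul_self.mp hG.posSemidef.nonneg
  have hBu : IsUnit B.det := by
    have h := hG.det_pos
    rw [hB, Matrix.det_mul] at h
    exact isUnit_iff_ne_zero.2 (right_ne_zero_of_mul h.ne')
  have hBt : IsUnit B.transpose.det := by rwa [Matrix.det_transpose]
  set S : Matrix (Fin n) (Fin n) ℝ := B.transpose⁻¹ * T * B⁻¹ with hS
  have h1 : T = B.transpose * S * B := by
    rw [hS, ← Matrix.mul_assoc, ← Matrix.mul_assoc, Matrix.mul_nonsing_inv _ hBt, Matrix.one_mul,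
      Matrix.mul_assoc, Matrix.nonsing_inv_mul _ hBu, Matrix.mul_one]
  have h2 : G = B.transpose * 1 * B := by
    rw [Matrix.mul_one, hB, Matrix.star_eq_conjTranspose,
      Matrix.conjTranspose_eq_transpose_of_trivial]
  rw [h2, h1, formSq_congr hBu, formSq_one]
  have hS0 : S ≠ 0 := fun h => hT (by rw [h1, h, Matrix.mul_zero, Matrix.zero_mul])
  obtain ⟨i, j, hij⟩ : ∃ i j, S i j ≠ 0 := by
    by_contra! h
    exact hS0 (Matrix.ext h)
  calc 0 < S i j ^ 2 := by positivity
    _ ≤ ∑ j, S i j ^ 2 :=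
      Finset.single_le_sum (f := fun j => S i j ^ 2) (fun _ _ => sq_nonneg _) (Finset.mem_univ j)
    _ ≤ _ := Finset.single_le_sum (f := fun i => ∑ j, S i j ^ 2)
      (fun _ _ => Finset.sum_nonneg fun _ _ => sq_nonneg _) (Finset.mem_univ i)

lemma formSq_nonneg {G : Matrix (Fin n) (Fin n) ℝ} (hG : G.PosDef)
    (T : Matrix (Fin n) (Fin n) ℝ) : 0 ≤ formSq G T := by
  by_cases hT : T = 0
  · simp [hT, formSq]
  · exact (formSq_pos hG hT).le

/-- A continuous family of positive definite quadratic forms is uniformly equivalent to the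
Euclidean one on compact sets. -/
lemma exists_bounds_of_homogeneous {X ι : Type*} [TopologicalSpace X] [Fintype ι] {K : Set X}
    (hK : IsCompact K) {q : X → EuclideanSpace ℝ ι → ℝ}
    (hq : ContinuousOn (fun p : X × EuclideanSpace ℝ ι => q p.1 p.2) (K ×ˢ univ))
    (hpos : ∀ x ∈ K, ∀ v, v ≠ 0 → 0 < q x v) (hhom : ∀ x t v, q x (t • v) = t ^ 2 * q x v) :
    ∃ c C : ℝ, 0 < c ∧ 0 < C ∧ ∀ x ∈ K, ∀ v : ι → ℝ,
      c * ∑ i, v i ^ 2 ≤ q x (WithLp.toLp 2 v) ∧ q x (WithLp.toLp 2 v) ≤ C * ∑ i, v i ^ 2 := by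
  have hcpt : IsCompact (K ×ˢ Metric.sphere (0 : EuclideanSpace ℝ ι) 1) :=
    hK.prod (isCompact_sphere _ _)
  have hq' := hq.mono (prod_mono (subset_refl K)
    (subset_univ (Metric.sphere (0 : EuclideanSpace ℝ ι) 1)))
  have hne : ∀ v ∈ Metric.sphere (0 : EuclideanSpace ℝ ι) 1, v ≠ 0 := fun v hv h => by
    simp [h] at hv
  obtain ⟨c, hc0, hc⟩ : ∃ c : ℝ, 0 < c ∧
      ∀ p ∈ K ×ˢ Metric.sphere (0 : EuclideanSpace ℝ ι) 1, c ≤ q p.1 p.2 := by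
    rcases (K ×ˢ Metric.sphere (0 : EuclideanSpace ℝ ι) 1).eq_empty_or_nonempty with h | h
    · exact ⟨1, one_pos, by simp [h]⟩
    · obtain ⟨p, hp, hmin⟩ := hcpt.exists_isMinOn h hq'
      exact ⟨q p.1 p.2, hpos _ hp.1 _ (hne _ hp.2), fun p' hp' => hmin hp'⟩
  obtain ⟨C, hC⟩ := hcpt.bddAbove_image hq'
  have key : ∀ x ∈ K, ∀ v : EuclideanSpace ℝ ι,
      c * ‖v‖ ^ 2 ≤ q x v ∧ q x v ≤ max C 1 * ‖v‖ ^ 2 := by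
    intro x hx v
    by_cases hv : v = 0
    · have h0 : q x 0 = 0 := by
        have := hhom x 0 0
        simpa using this
      simp [hv, h0]
    · have hv0 : ‖v‖ ≠ 0 := norm_ne_zero_iff.2 hv
      have h1 : q x v = ‖v‖ ^ 2 * q x (‖v‖⁻¹ • v) := by
        rw [← hhom, smul_smul, mul_inv_cancel₀ hv0, one_smul]
      have hmem : (x, ‖v‖⁻¹ • v) ∈ K ×ˢ Metric.sphere (0 : EuclideanSpace ℝ ι) 1 := by
        refine ⟨hx, ?_⟩
        simp [norm_smul, hv0]
      have h2 := hc _ hmem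
      have h3 : q x (‖v‖⁻¹ • v) ≤ C := hC ⟨_, hmem, rfl⟩
      rw [h1, mul_comm c, mul_comm (max C 1)]
      exact ⟨mul_le_mul_of_nonneg_left h2 (sq_nonneg _),
        mul_le_mul_of_nonneg_left (h3.trans (le_max_left _ _)) (sq_nonneg _)⟩
  refine ⟨c, max C 1, hc0, by positivity, fun x hx v => ?_⟩
  have h := key x hx (WithLp.toLp 2 v)
  rwa [EuclideanSpace.norm_sq_eq, show ∑ i, ‖WithLp.toLp 2 v i‖ ^ 2 = ∑ i, v i ^ 2 by simp] at h

end FormNorm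

/-! ### Invariant norms in components -/

section Components

open Filter

variable {n : ℕ} [NeZero n] {M : Type*} [TopologicalSpace M]
  [ChartedSpace (EuclideanHalfSpace n) M]

variable {e : OpenPartialHomeomorph M (EuclideanHalfSpace n)}

lemma tangent_eq_sum (he : e ∈ IsManifold.maximalAtlas (𝓡∂ n) ∞ M)
    {y : EuclideanSpace ℝ (Fin n)} (hy : y ∈ (e.extend (𝓡∂ n)).target)
    (v : EuclideanSpace ℝ (Fin n)) :
    v = ∑ k, vecCoord e k ((e.extend (𝓡∂ n)).symm y) v
      • symmDeriv e y (EuclideanSpace.single k 1) := by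
  conv_lhs => rw [← symmDeriv_chartDeriv he hy v,
    euclidean_eq_sum (chartDeriv e ((e.extend (𝓡∂ n)).symm y) v), map_sum]
  simp only [map_smul]
  rfl

lemma isUnit_det_endMat_symmDeriv (he : e ∈ IsManifold.maximalAtlas (𝓡∂ n) ∞ M)
    {y : EuclideanSpace ℝ (Fin n)} (hy : y ∈ (e.extend (𝓡∂ n)).target) :
    IsUnit (endMat (symmDeriv e y)).det := by
  have h := congrArg Matrix.det (congrArg endMat (chartDeriv_comp_symmDeriv he hy))
  rw [endMat_comp, endMat_id, Matrix.det_mul, Matrix.det_one] at h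
  exact IsUnit.of_mul_eq_one_right _ h

/-- The endomorphism `D x`, as an endomorphism of `ℝⁿ`. -/
def fieldEnd (D : ∀ x : M, TangentSpace (𝓡∂ n) x →L[ℝ] TangentSpace (𝓡∂ n) x) (x : M) :
    EuclideanSpace ℝ (Fin n) →L[ℝ] EuclideanSpace ℝ (Fin n) :=
  D x

lemma trace_eq_sum_endCoord (D : ∀ x : M, TangentSpace (𝓡∂ n) x →L[ℝ] TangentSpace (𝓡∂ n) x)
    (he : e ∈ IsManifold.maximalAtlas (𝓡∂ n) ∞ M)
    {y : EuclideanSpace ℝ (Fin n)} (hy : y ∈ (e.extend (𝓡∂ n)).target) :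
    LinearMap.trace ℝ (EuclideanSpace ℝ (Fin n))
        (fieldEnd D ((e.extend (𝓡∂ n)).symm y)).toLinearMap = ∑ k, endCoord e D k k y := by
  set x := (e.extend (𝓡∂ n)).symm y with hx
  set L := fieldEnd D x with hL
  have h1 : ∑ k, endCoord e D k k y = (endMat (chartDeriv e x ∘L (L ∘L symmDeriv e y))).trace := rfl
  have h2 : (endMat L).trace = LinearMap.trace ℝ (EuclideanSpace ℝ (Fin n)) L.toLinearMap := by
    rw [endMat_eq_toMatrix, LinearMap.trace_eq_matrix_trace ℝ
      (EuclideanSpace.basisFun (Fin n) ℝ).toBasis]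
  rw [h1, ← h2, endMat_comp, Matrix.trace_mul_comm, ← endMat_comp, ContinuousLinearMap.comp_assoc,
    symmDeriv_comp_chartDeriv he hy, ContinuousLinearMap.comp_id]

variable [IsManifold (𝓡∂ n) ∞ M]

lemma metricMat_isSymm (g : Metric n M) (y : EuclideanSpace ℝ (Fin n)) :
    (metricMat g e y).IsSymm :=
  Matrix.IsSymm.ext fun _ _ => metricForm_symm g _ _ _

/-- The square of the length of a tangent vector in components. -/
lemma inner_self_eq_sum (g : Metric n M) (he : e ∈ IsManifold.maximalAtlas (𝓡∂ n) ∞ M)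
    {y : EuclideanSpace ℝ (Fin n)} (hy : y ∈ (e.extend (𝓡∂ n)).target)
    (v : EuclideanSpace ℝ (Fin n)) :
    metricForm g ((e.extend (𝓡∂ n)).symm y) v v
      = ∑ i, ∑ j, metricMat g e y i j * vecCoord e i ((e.extend (𝓡∂ n)).symm y) v
        * vecCoord e j ((e.extend (𝓡∂ n)).symm y) v := by
  conv_lhs => rw [tangent_eq_sum he hy v]
  simp only [map_sum, map_smul, sum_apply, smul_apply, smul_eq_mul, Finset.mul_sum,
    metricMat_apply]
  rw [Finset.sum_comm]
  refine Finset.sum_congr rfl fun i _ => Finset.sum_congr rfl fun j _ => ?_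
  ring

lemma metricMat_posDef (g : Metric n M) (he : e ∈ IsManifold.maximalAtlas (𝓡∂ n) ∞ M)
    {y : EuclideanSpace ℝ (Fin n)} (hy : y ∈ (e.extend (𝓡∂ n)).target) :
    (metricMat g e y).PosDef := by
  refine Matrix.PosDef.of_dotProduct_mulVec_pos ?_ fun w hw => ?_
  · rw [Matrix.IsHermitian, Matrix.conjTranspose_eq_transpose_of_trivial]
    exact metricMat_isSymm g y
  · set v : EuclideanSpace ℝ (Fin n) := symmDeriv e y (WithLp.toLp 2 w) with hv
    have hc : ∀ k, vecCoord e k ((e.extend (𝓡∂ n)).symm y) v = w k := fun k => by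
      rw [vecCoord_eq, hv, chartDeriv_symmDeriv he hy]
    have hv0 : v ≠ 0 := by
      intro h
      refine hw (funext fun k => ?_)
      rw [← hc k, h, vecCoord_eq, map_zero]
      rfl
    have h := metricForm_pos g ((e.extend (𝓡∂ n)).symm y) hv0
    rw [inner_self_eq_sum g he hy] at h
    simp only [hc] at h
    refine h.trans_le (le_of_eq ?_)
    simp only [dotProduct, Matrix.mulVec, Finset.mul_sum, Pi.star_apply, star_trivial]
    refine Finset.sum_congr rfl fun i _ => Finset.sum_congr rfl fun j _ => ?_
    ring

/-- The norm of a bilinear form on a tangent space, in the components of any chart. -/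
lemma formNormSq_eq_formSq (g : Metric n M) (he : e ∈ IsManifold.maximalAtlas (𝓡∂ n) ∞ M)
    {y : EuclideanSpace ℝ (Fin n)} (hy : y ∈ (e.extend (𝓡∂ n)).target)
    {T : EuclideanSpace ℝ (Fin n) → EuclideanSpace ℝ (Fin n) → ℝ}
    {β : EuclideanSpace ℝ (Fin n) →ₗ[ℝ] EuclideanSpace ℝ (Fin n) →ₗ[ℝ] ℝ}
    (hT : ∀ v w, T v w = β v w) :
    formNormSq g ((e.extend (𝓡∂ n)).symm y) T
      = formSq (metricMat g e y) (formMat T (symmDeriv e y)) := by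
  set x := (e.extend (𝓡∂ n)).symm y with hx
  have h1 : formNormSq g x T
      = formSq (formMat (fun v w => metricForm g x v w) (ContinuousLinearMap.id ℝ _))
        (formMat T (ContinuousLinearMap.id ℝ _)) := rfl
  have h2 : metricMat g e y = (endMat (symmDeriv e y)).transpose
      * formMat (fun v w => metricForm g x v w) (ContinuousLinearMap.id ℝ _)
      * endMat (symmDeriv e y) := by
    rw [← formMat_comp (f := fun v w => metricForm g x v w)
      (β := (metricForm g x).toLinearMap₁₂) fun v w => rfl]
    rfl
  have h3 : formMat T (symmDeriv e y) = (endMat (symmDeriv e y)).transpose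
      * formMat T (ContinuousLinearMap.id ℝ _) * endMat (symmDeriv e y) := by
    rw [← formMat_comp hT]
    rfl
  rw [h1, h2, h3, formSq_congr (isUnit_det_endMat_symmDeriv he hy)]

/-- The conformal Killing form `𝕃` of a field `D` of endomorphisms in the place of `∇W`. -/
def killingForm (g : Metric n M)
    (D : ∀ x : M, TangentSpace (𝓡∂ n) x →L[ℝ] TangentSpace (𝓡∂ n) x)
    (x : M) (X Y : TangentSpace (𝓡∂ n) x) : ℝ :=
  lowered g D x X Y + lowered g D x Y X
    - 2 / (n : ℝ) * LinearMap.trace ℝ (TangentSpace (𝓡∂ n) x) (D x).toLinearMap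
      * g.inner x X Y

/-- The matrix with the components `∇ᵢWⱼ = gⱼₖ Dᵏᵢ`. -/
def loweredMat (G : Matrix (Fin n) (Fin n) ℝ) (a : Fin n → Fin n → ℝ) :
    Matrix (Fin n) (Fin n) ℝ :=
  Matrix.of fun i j => ∑ k, G j k * a i k

variable (D : ∀ x : M, TangentSpace (𝓡∂ n) x →L[ℝ] TangentSpace (𝓡∂ n) x)

/-- `D` with the index lowered, as a bilinear form on `ℝⁿ`. -/
def loweredBilin (g : Metric n M) (x : M) :
    EuclideanSpace ℝ (Fin n) →ₗ[ℝ] EuclideanSpace ℝ (Fin n) →ₗ[ℝ] ℝ :=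
  (metricForm g x ∘L fieldEnd D x).toLinearMap₁₂

lemma lowered_eq (g : Metric n M) (x : M) (v w : EuclideanSpace ℝ (Fin n)) :
    lowered g D x v w = loweredBilin D g x v w := rfl

lemma formMat_lowered (g : Metric n M) (he : e ∈ IsManifold.maximalAtlas (𝓡∂ n) ∞ M)
    {y : EuclideanSpace ℝ (Fin n)} (hy : y ∈ (e.extend (𝓡∂ n)).target) :
    formMat (lowered g D ((e.extend (𝓡∂ n)).symm y)) (symmDeriv e y)
      = loweredMat (metricMat g e y) fun i k => endCoord e D k i y := by
  ext i j
  set x := (e.extend (𝓡∂ n)).symm y with hx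
  have h1 : formMat (lowered g D x) (symmDeriv e y) i j
      = metricForm g x (fieldEnd D x (symmDeriv e y (EuclideanSpace.single i 1)))
        (symmDeriv e y (EuclideanSpace.single j 1)) := rfl
  rw [h1, tangent_eq_sum he hy (fieldEnd D x (symmDeriv e y (EuclideanSpace.single i 1)))]
  simp only [map_sum, map_smul, sum_apply, smul_apply, smul_eq_mul, loweredMat, Matrix.of_apply]
  refine Finset.sum_congr rfl fun k _ => ?_
  rw [metricForm_symm]
  exact mul_comm _ _

lemma formMat_killingForm (g : Metric n M) (he : e ∈ IsManifold.maximalAtlas (𝓡∂ n) ∞ M)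
    {y : EuclideanSpace ℝ (Fin n)} (hy : y ∈ (e.extend (𝓡∂ n)).target) :
    formMat (killingForm g D ((e.extend (𝓡∂ n)).symm y)) (symmDeriv e y)
      = Matrix.of (killingMat (metricMat g e y) fun i k => endCoord e D k i y) := by
  ext i j
  set x := (e.extend (𝓡∂ n)).symm y with hx
  have h1 : formMat (killingForm g D x) (symmDeriv e y) i j
      = formMat (lowered g D x) (symmDeriv e y) i j + formMat (lowered g D x) (symmDeriv e y) j i
        - 2 / (n : ℝ) * LinearMap.trace ℝ (EuclideanSpace ℝ (Fin n)) (fieldEnd D x).toLinearMap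
          * metricMat g e y i j := rfl
  rw [h1, formMat_lowered D g he hy, trace_eq_sum_endCoord D he hy]
  rfl

lemma killingForm_eq (g : Metric n M) (x : M) : ∃ β : EuclideanSpace ℝ (Fin n) →ₗ[ℝ]
    EuclideanSpace ℝ (Fin n) →ₗ[ℝ] ℝ, ∀ v w : EuclideanSpace ℝ (Fin n),
      killingForm g D x v w = β v w :=
  ⟨loweredBilin D g x + (loweredBilin D g x).flip
    - (2 / (n : ℝ) * LinearMap.trace ℝ (EuclideanSpace ℝ (Fin n)) (fieldEnd D x).toLinearMap)
      • (metricForm g x).toLinearMap₁₂, fun _ _ => rfl⟩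

/-- `|∇W|²` in components. -/
lemma formNormSq_lowered (g : Metric n M) (he : e ∈ IsManifold.maximalAtlas (𝓡∂ n) ∞ M)
    {y : EuclideanSpace ℝ (Fin n)} (hy : y ∈ (e.extend (𝓡∂ n)).target) :
    formNormSq g ((e.extend (𝓡∂ n)).symm y) (lowered g D ((e.extend (𝓡∂ n)).symm y))
      = formSq (metricMat g e y) (loweredMat (metricMat g e y) fun i k => endCoord e D k i y) := by
  rw [← formMat_lowered D g he hy]
  exact formNormSq_eq_formSq g he hy (lowered_eq D g _)

/-- `|𝕃W|²` in components. -/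
lemma formNormSq_killingForm (g : Metric n M) (he : e ∈ IsManifold.maximalAtlas (𝓡∂ n) ∞ M)
    {y : EuclideanSpace ℝ (Fin n)} (hy : y ∈ (e.extend (𝓡∂ n)).target) :
    formNormSq g ((e.extend (𝓡∂ n)).symm y) (killingForm g D ((e.extend (𝓡∂ n)).symm y))
      = formSq (metricMat g e y)
        (Matrix.of (killingMat (metricMat g e y) fun i k => endCoord e D k i y)) := by
  rw [← formMat_killingForm D g he hy]
  obtain ⟨β, hβ⟩ := killingForm_eq D g ((e.extend (𝓡∂ n)).symm y)
  exact formNormSq_eq_formSq g he hy hβ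

end Components

/-! ### Weak derivatives -/

section WeakDerivatives

variable {n : ℕ}

lemma integrable_mul_isTest {Ω : Set (EuclideanSpace ℝ (Fin n))}
    {v η : EuclideanSpace ℝ (Fin n) → ℝ} (hv : LocallyIntegrableOn v Ω) (hη : IsTest η)
    (hs : tsupport η ⊆ Ω) : Integrable fun y => v y * η y := by
  have h1 : IntegrableOn v (tsupport η) := hv.integrableOn_compact_subset hs hη.2
  obtain ⟨C, hC⟩ := hη.1.continuous.bounded_above_of_compact_support hη.2
  have h2 : IntegrableOn (fun y => v y * η y) (tsupport η) :=
    h1.mul_bdd hη.1.continuous.aestronglyMeasurable (Filter.Eventually.of_forall hC)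
  refine (integrableOn_iff_integrable_of_support_subset fun y hy => ?_).1 h2
  exact subset_tsupport η (right_ne_zero_of_mul hy)

/-- Weak partial derivatives are unique almost everywhere. -/
lemma IsWeakPartial.ae_eq {Ω : Set (EuclideanSpace ℝ (Fin n))} (hΩ : IsOpen Ω) {i : Fin n}
    {u v v' : EuclideanSpace ℝ (Fin n) → ℝ} (h : IsWeakPartial Ω i u v)
    (h' : IsWeakPartial Ω i u v') : ∀ᵐ y, y ∈ Ω → v y = v' y := by
  have h1 := hΩ.ae_eq_zero_of_integral_contDiff_smul_eq_zero (h.2.1.sub h'.2.1)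
    fun η hη hc hs => by
      have e1 : (fun y => η y • (v - v') y) = fun y => v y * η y - v' y * η y := by
        funext y
        simp only [Pi.sub_apply, smul_eq_mul]
        ring
      rw [e1, integral_sub (integrable_mul_isTest h.2.1 ⟨hη, hc⟩ hs)
        (integrable_mul_isTest h'.2.1 ⟨hη, hc⟩ hs)]
      linarith [h.2.2 η hη hc hs, h'.2.2 η hη hc hs]
  filter_upwards [h1] with y hy hyΩ
  exact sub_eq_zero.1 (hy hyΩ)

lemma isWeakPartial_weakPartial {Ω : Set (EuclideanSpace ℝ (Fin n))} {i : Fin n}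
    {u v : EuclideanSpace ℝ (Fin n) → ℝ} (h : IsWeakPartial Ω i u v) :
    IsWeakPartial Ω i u (weakPartial Ω i u) := by
  have h' : ∃ v, IsWeakPartial Ω i u v := ⟨v, h⟩
  rw [weakPartial, dif_pos h']
  exact h'.choose_spec

lemma MemW1pLoc.isWeakPartial {p : ℝ≥0∞} {T : Set (EuclideanSpace ℝ (Fin n))}
    {u : EuclideanSpace ℝ (Fin n) → ℝ} (h : MemW1pLoc p T u) (i : Fin n) :
    IsWeakPartial (interior T) i u (weakPartial (interior T) i u) := by
  obtain ⟨v, hv, -⟩ := h.2 i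
  exact isWeakPartial_weakPartial hv

lemma MemW1pLoc.memLp_weakPartial {p : ℝ≥0∞} {T K : Set (EuclideanSpace ℝ (Fin n))}
    {u : EuclideanSpace ℝ (Fin n) → ℝ} (h : MemW1pLoc p T u) (hT : volume (T \ interior T) = 0)
    (hKT : K ⊆ T) (hK : IsCompact K) (i : Fin n) :
    MemLp (weakPartial (interior T) i u) p (volume.restrict K) := by
  obtain ⟨v, hv, hvp⟩ := h.2 i
  refine (hvp K hKT hK).ae_eq ?_
  rw [Filter.EventuallyEq, ae_restrict_iff' hK.measurableSet]
  filter_upwards [hv.ae_eq isOpen_interior (h.isWeakPartial i),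
    (measure_eq_zero_iff_ae_notMem.1 hT)] with y h1 h2 hy
  exact h1 (by_contra fun h3 => h2 ⟨hKT hy, h3⟩)

lemma memLp_continuousOn_mul {p : ℝ≥0∞} {K : Set (EuclideanSpace ℝ (Fin n))} (hK : IsCompact K)
    {a f : EuclideanSpace ℝ (Fin n) → ℝ} (ha : ContinuousOn a K)
    (hf : MemLp f p (volume.restrict K)) : MemLp (fun y => a y * f y) p (volume.restrict K) := by
  obtain ⟨C, hC⟩ := hK.exists_bound_of_continuousOn ha
  refine hf.of_le_mul (c := C)
    ((ha.aestronglyMeasurable hK.measurableSet).mul hf.aestronglyMeasurable) ?_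
  filter_upwards [ae_restrict_mem hK.measurableSet] with y hy
  rw [norm_mul]
  exact mul_le_mul_of_nonneg_right (hC y hy) (norm_nonneg _)

lemma aemeasurable_formSq {X : Type*} [MeasurableSpace X] {μ : Measure X}
    {G B : X → Matrix (Fin n) (Fin n) ℝ} (hG : ∀ i j, AEMeasurable (fun x => (G x)⁻¹ i j) μ)
    (hB : ∀ i j, AEMeasurable (fun x => B x i j) μ) :
    AEMeasurable (fun x => formSq (G x) (B x)) μ := by
  simp only [formSq]
  exact Finset.aemeasurable_fun_sum _ fun i _ => Finset.aemeasurable_fun_sum _ fun j _ =>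
    Finset.aemeasurable_fun_sum _ fun k _ => Finset.aemeasurable_fun_sum _ fun l _ =>
      (((hG i k).mul (hG j l)).mul (hB i j)).mul (hB k l)

lemma loweredMat_eq_mul (G : Matrix (Fin n) (Fin n) ℝ) (a : Fin n → Fin n → ℝ) :
    loweredMat G a = Matrix.of a * G.transpose := by
  ext i j
  simp only [loweredMat, Matrix.of_apply, Matrix.mul_apply, Matrix.transpose_apply]
  exact Finset.sum_congr rfl fun k _ => mul_comm _ _

end WeakDerivatives

/-! ### Compact parts of a chart -/

section ChartAnalysis

variable {n : ℕ} [NeZero n]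

lemma subset_range_of_mem_halfSpace : halfSpace n ⊆ range (𝓡∂ n) := by
  rw [range_modelWithCornersEuclideanHalfSpace]
  exact fun y hy => le_of_lt (show (0 : ℝ) < y 0 from hy)

/-- The boundary hyperplane is a null set. -/
lemma restrict_inter_halfSpace {s : Set (EuclideanSpace ℝ (Fin n))} (hs : s ⊆ range (𝓡∂ n)) :
    volume.restrict (s ∩ halfSpace n) = volume.restrict s := by
  refine Measure.restrict_congr_set ?_
  filter_upwards [ae_coord_zero_ne (n := n)] with y hy
  refine propext ⟨fun h => h.1, fun h => ⟨h, ?_⟩⟩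
  have h0 := hs h
  rw [range_modelWithCornersEuclideanHalfSpace] at h0
  exact lt_of_le_of_ne h0 (Ne.symm hy)

variable {M : Type*} [TopologicalSpace M]

/-- The interior of the range of a chart contains all its points off the boundary hyperplane. -/
lemma target_inter_halfSpace_subset_interior (e : OpenPartialHomeomorph M (EuclideanHalfSpace n)) :
    (e.extend (𝓡∂ n)).target ∩ halfSpace n ⊆ interior (e.extend (𝓡∂ n)).target := by
  rw [OpenPartialHomeomorph.extend_target]
  rintro y ⟨⟨hy, -⟩, hy0⟩
  refine mem_interior.2 ⟨(𝓡∂ n).symm ⁻¹' e.target ∩ halfSpace n, ?_,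
    (e.open_target.preimage (𝓡∂ n).continuous_symm).inter isOpen_halfSpace, ⟨hy, hy0⟩⟩
  exact inter_subset_inter_right _ subset_range_of_mem_halfSpace

lemma volume_target_sdiff_interior (e : OpenPartialHomeomorph M (EuclideanHalfSpace n)) :
    volume ((e.extend (𝓡∂ n)).target \ interior (e.extend (𝓡∂ n)).target) = 0 := by
  rw [measure_eq_zero_iff_ae_notMem]
  filter_upwards [ae_coord_zero_ne (n := n)] with y hy h
  have h0 := e.extend_target_subset_range h.1
  rw [range_modelWithCornersEuclideanHalfSpace] at h0
  exact h.2 (target_inter_halfSpace_subset_interior e ⟨h.1, lt_of_le_of_ne h0 (Ne.symm hy)⟩)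

variable [ChartedSpace (EuclideanHalfSpace n) M] [IsManifold (𝓡∂ n) ∞ M]
  {e : OpenPartialHomeomorph M (EuclideanHalfSpace n)}

lemma continuousOn_metricMat_inv (g : Metric n M)
    (he : e ∈ IsManifold.maximalAtlas (𝓡∂ n) ∞ M) (i j : Fin n) :
    ContinuousOn (fun y => (metricMat g e y)⁻¹ i j) (e.extend (𝓡∂ n)).target := by
  have h1 : ContinuousOn (metricMat g e) (e.extend (𝓡∂ n)).target :=
    continuousOn_pi.2 fun a => continuousOn_pi.2 fun b => continuousOn_metricCoord g he a b
  have h2 : Continuous fun A : Matrix (Fin n) (Fin n) ℝ => A.adjugate i j :=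
    (continuous_id.matrix_adjugate).matrix_elem i j
  simp only [Matrix.inv_def, Ring.inverse_eq_inv', Matrix.smul_apply, smul_eq_mul]
  exact ((continuousOn_metricMat_det g he).inv₀ fun y hy =>
    (metricMat_posDef g he hy).det_pos.ne').mul (h2.comp_continuousOn h1)

/-- As `g ∈ W^{1,p}` with `p ≥ n`, and the inverse of `g` is locally bounded, the Christoffel
symbols are in `Lⁿ` on compact sets. -/
lemma memLp_christoffel {p : ℝ≥0∞} (hp : (n : ℝ≥0∞) ≤ p) {g : Metric n M} (hg : IsW1p g p)
    (he : e ∈ IsManifold.maximalAtlas (𝓡∂ n) ∞ M) {K : Set (EuclideanSpace ℝ (Fin n))}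
    (hKT : K ⊆ (e.extend (𝓡∂ n)).target) (hK : IsCompact K) (k i j : Fin n) :
    MemLp (christoffel g e k i j) n (volume.restrict K) := by
  have : IsFiniteMeasure (volume.restrict K) := isFiniteMeasure_restrict.2 hK.measure_lt_top.ne
  have h1 : ∀ a b c, MemLp (weakPartial (interior (e.extend (𝓡∂ n)).target) a
      (metricCoord g e b c)) n (volume.restrict K) := fun a b c =>
    ((hg e he b c).memLp_weakPartial (volume_target_sdiff_interior e) hKT hK a).mono_exponent hp
  exact (memLp_finsetSum _ fun l _ => memLp_continuousOn_mul hK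
    ((continuousOn_metricMat_inv g he k l).mono hKT)
    (((h1 i l j).add (h1 j i l)).sub (h1 l i j))).const_mul (1 / 2)

/-- On compact sets `|W|²` is equivalent to the sum of the squares of the components of `W`. -/
lemma exists_bounds_metricMat (g : Metric n M) (he : e ∈ IsManifold.maximalAtlas (𝓡∂ n) ∞ M)
    {K : Set (EuclideanSpace ℝ (Fin n))} (hKT : K ⊆ (e.extend (𝓡∂ n)).target)
    (hK : IsCompact K) :
    ∃ c C : ℝ, 0 < c ∧ 0 < C ∧ ∀ y ∈ K, ∀ w : Fin n → ℝ,
      c * ∑ i, w i ^ 2 ≤ ∑ i, ∑ j, metricMat g e y i j * w i * w j ∧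
      ∑ i, ∑ j, metricMat g e y i j * w i * w j ≤ C * ∑ i, w i ^ 2 := by
  refine exists_bounds_of_homogeneous hK
    (q := fun y v => ∑ i, ∑ j, metricMat g e y i j * v i * v j) ?_ ?_ ?_
  · refine continuousOn_finsetSum _ fun i _ => continuousOn_finsetSum _ fun j _ => ?_
    refine ContinuousOn.mul (ContinuousOn.mul ?_ ?_) ?_
    · exact ((continuousOn_metricCoord g he i j).mono hKT).comp continuousOn_fst fun p hp => hp.1
    · exact (by fun_prop : Continuous fun p : EuclideanSpace ℝ (Fin n) × EuclideanSpace ℝ (Fin n)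
        => p.2 i).continuousOn
    · exact (by fun_prop : Continuous fun p : EuclideanSpace ℝ (Fin n) × EuclideanSpace ℝ (Fin n)
        => p.2 j).continuousOn
  · intro y hy v hv
    have h := (metricMat_posDef g he (hKT hy)).dotProduct_mulVec_pos
      (x := (v : Fin n → ℝ)) (fun h => hv (by ext i; exact congrFun h i))
    refine h.trans_le (le_of_eq ?_)
    simp only [dotProduct, Matrix.mulVec, Finset.mul_sum, Pi.star_apply, star_trivial]
    refine Finset.sum_congr rfl fun i _ => Finset.sum_congr rfl fun j _ => ?_
    ring
  · intro y t v
    simp only [Finset.mul_sum, PiLp.smul_apply, smul_eq_mul]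
    refine Finset.sum_congr rfl fun i _ => Finset.sum_congr rfl fun j _ => ?_
    ring

/-- On compact sets, for a continuous family of injective linear maps `A`, the form `|A a|²` is
equivalent to the sum of the squares of the entries of `a`. -/
lemma exists_bounds_formSq (g : Metric n M) (he : e ∈ IsManifold.maximalAtlas (𝓡∂ n) ∞ M)
    {K : Set (EuclideanSpace ℝ (Fin n))} (hKT : K ⊆ (e.extend (𝓡∂ n)).target)
    (hK : IsCompact K)
    {A : EuclideanSpace ℝ (Fin n) → (Fin n → Fin n → ℝ) → Matrix (Fin n) (Fin n) ℝ}
    (hA : ∀ i j, ContinuousOn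
      (fun p : EuclideanSpace ℝ (Fin n) × (Fin n → Fin n → ℝ) => A p.1 p.2 i j) (K ×ˢ univ))
    (hinj : ∀ y ∈ K, ∀ a, A y a = 0 → a = 0) (hhom : ∀ y (t : ℝ) a, A y (t • a) = t • A y a) :
    ∃ c C : ℝ, 0 < c ∧ 0 < C ∧ ∀ y ∈ K, ∀ a : Fin n → Fin n → ℝ,
      c * ∑ i, ∑ j, a i j ^ 2 ≤ formSq (metricMat g e y) (A y a) ∧
      formSq (metricMat g e y) (A y a) ≤ C * ∑ i, ∑ j, a i j ^ 2 := by
  have key := exists_bounds_of_homogeneous hK (ι := Fin n × Fin n)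
    (q := fun y v => formSq (metricMat g e y) (A y fun i j => v (i, j))) ?_ ?_ ?_
  · obtain ⟨c, C, hc, hC, h⟩ := key
    refine ⟨c, C, hc, hC, fun y hy a => ?_⟩
    have := h y hy fun p => a p.1 p.2
    simpa only [Fintype.sum_prod_type] using this
  · have hAc : ∀ i j, ContinuousOn (fun p : EuclideanSpace ℝ (Fin n) ×
        EuclideanSpace ℝ (Fin n × Fin n) => A p.1 (fun i j => p.2 (i, j)) i j) (K ×ˢ univ) := by
      intro i j
      refine (hA i j).comp (f := fun p : EuclideanSpace ℝ (Fin n) ×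
        EuclideanSpace ℝ (Fin n × Fin n) => (p.1, fun i j => p.2 (i, j))) ?_ fun p hp =>
          ⟨hp.1, mem_univ _⟩
      exact Continuous.continuousOn (by fun_prop)
    have hGc : ∀ i j, ContinuousOn (fun p : EuclideanSpace ℝ (Fin n) ×
        EuclideanSpace ℝ (Fin n × Fin n) => (metricMat g e p.1)⁻¹ i j) (K ×ˢ univ) := fun i j =>
      ((continuousOn_metricMat_inv g he i j).mono hKT).comp continuousOn_fst fun p hp => hp.1
    exact continuousOn_finsetSum _ fun i _ => continuousOn_finsetSum _ fun j _ =>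
      continuousOn_finsetSum _ fun k _ => continuousOn_finsetSum _ fun l _ =>
        (((hGc i k).mul (hGc j l)).mul (hAc i j)).mul (hAc k l)
  · intro y hy v hv
    refine formSq_pos (metricMat_posDef g he (hKT hy)) fun h => hv ?_
    have h0 := hinj y hy _ h
    ext ⟨i, j⟩
    exact congrFun (congrFun h0 i) j
  · intro y t v
    have h1 : (fun i j => (t • v) (i, j)) = t • fun i j => v (i, j) := rfl
    rw [h1, hhom]
    simp only [formSq, Finset.mul_sum, Matrix.smul_apply, smul_eq_mul]
    refine Finset.sum_congr rfl fun i _ => Finset.sum_congr rfl fun j _ =>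
      Finset.sum_congr rfl fun k _ => Finset.sum_congr rfl fun l _ => ?_
    ring

lemma exists_bounds_form (g : Metric n M) (he : e ∈ IsManifold.maximalAtlas (𝓡∂ n) ∞ M)
    {K : Set (EuclideanSpace ℝ (Fin n))} (hKT : K ⊆ (e.extend (𝓡∂ n)).target)
    (hK : IsCompact K) :
    ∃ c C : ℝ, 0 < c ∧ 0 < C ∧ ∀ y ∈ K, ∀ a : Fin n → Fin n → ℝ,
      c * ∑ i, ∑ j, a i j ^ 2 ≤ formSq (metricMat g e y) (Matrix.of a) ∧
      formSq (metricMat g e y) (Matrix.of a) ≤ C * ∑ i, ∑ j, a i j ^ 2 :=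
  exists_bounds_formSq g he hKT hK (A := fun _ a => Matrix.of a)
    (fun i j => Continuous.continuousOn
      (by simp only [Matrix.of_apply]; fun_prop)) (fun _ _ _ h => h) fun _ _ _ => rfl

lemma exists_bounds_lowered (g : Metric n M) (he : e ∈ IsManifold.maximalAtlas (𝓡∂ n) ∞ M)
    {K : Set (EuclideanSpace ℝ (Fin n))} (hKT : K ⊆ (e.extend (𝓡∂ n)).target)
    (hK : IsCompact K) :
    ∃ c C : ℝ, 0 < c ∧ 0 < C ∧ ∀ y ∈ K, ∀ a : Fin n → Fin n → ℝ,
      c * ∑ i, ∑ j, a i j ^ 2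
        ≤ formSq (metricMat g e y) (loweredMat (metricMat g e y) a) ∧
      formSq (metricMat g e y) (loweredMat (metricMat g e y) a) ≤ C * ∑ i, ∑ j, a i j ^ 2 := by
  refine exists_bounds_formSq g he hKT hK (A := fun y a => loweredMat (metricMat g e y) a)
    (fun i j => ?_) (fun y hy a h => ?_) fun y t a => ?_
  · simp only [loweredMat, Matrix.of_apply]
    refine continuousOn_finsetSum _ fun k _ => ContinuousOn.mul ?_ ?_
    · exact ((continuousOn_metricCoord g he j k).mono hKT).comp continuousOn_fst fun p hp => hp.1
    · exact (by fun_prop : Continuous fun p : EuclideanSpace ℝ (Fin n) × (Fin n → Fin n → ℝ) =>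
        p.2 i k).continuousOn
  · rw [loweredMat_eq_mul] at h
    have hu : IsUnit (metricMat g e y).transpose.det := by
      rw [Matrix.det_transpose]
      exact isUnit_iff_ne_zero.2 (metricMat_posDef g he (hKT hy)).det_pos.ne'
    have h2 := congrArg (· * (metricMat g e y).transpose⁻¹) h
    simp only [Matrix.mul_assoc, Matrix.mul_nonsing_inv _ hu, Matrix.mul_one,
      Matrix.zero_mul] at h2
    exact h2
  · simp only [loweredMat_eq_mul]
    exact Matrix.smul_mul t (Matrix.of a) _

lemma exists_bounds_density (g : Metric n M) (he : e ∈ IsManifold.maximalAtlas (𝓡∂ n) ∞ M)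
    {K : Set (EuclideanSpace ℝ (Fin n))} (hKT : K ⊆ (e.extend (𝓡∂ n)).target)
    (hK : IsCompact K) :
    ∃ c C : ℝ, 0 < c ∧ 0 < C ∧ ∀ y ∈ K,
      ENNReal.ofReal c ≤ density g e y ∧ density g e y ≤ ENNReal.ofReal C := by
  rcases K.eq_empty_or_nonempty with rfl | hne
  · exact ⟨1, 1, one_pos, one_pos, by simp⟩
  have hc := (Real.continuous_sqrt.comp_continuousOn (continuousOn_metricMat_det g he)).mono hKT
  have hpos : ∀ y ∈ K, 0 < √(metricMat g e y).det := fun y hy =>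
    Real.sqrt_pos.2 (metricMat_posDef g he (hKT hy)).det_pos
  obtain ⟨y₁, h₁, h₁'⟩ := hK.exists_isMinOn hne hc
  obtain ⟨y₂, h₂, h₂'⟩ := hK.exists_isMaxOn hne hc
  exact ⟨_, _, hpos y₁ h₁, hpos y₂ h₂, fun y hy =>
    ⟨ENNReal.ofReal_le_ofReal (h₁' hy), ENNReal.ofReal_le_ofReal (h₂' hy)⟩⟩

end ChartAnalysis

/-! ### Integrals over a chart -/

section LocalEstimate

variable {n : ℕ} [NeZero n] {M : Type*} [TopologicalSpace M]
  [ChartedSpace (EuclideanHalfSpace n) M] [IsManifold (𝓡∂ n) ∞ M]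
  {e : OpenPartialHomeomorph M (EuclideanHalfSpace n)}

section Components

variable {p : ℝ≥0∞} {g : Metric n M} {W : ∀ x : M, TangentSpace (𝓡∂ n) x}
  {D : ∀ x : M, TangentSpace (𝓡∂ n) x →L[ℝ] TangentSpace (𝓡∂ n) x}
  {K : Set (EuclideanSpace ℝ (Fin n))}

lemma IsWeakCovDeriv.aemeasurable_endCoord (hD : IsWeakCovDeriv g W D) (hp : (n : ℝ≥0∞) ≤ p)
    (hg : IsW1p g p) (he : e ∈ IsManifold.maximalAtlas (𝓡∂ n) ∞ M)
    (hKT : K ⊆ (e.extend (𝓡∂ n)).target) (hK : IsCompact K) (k i : Fin n) :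
    AEMeasurable (endCoord e D k i) (volume.restrict K) := by
  obtain ⟨h1, h2⟩ := hD e he
  have h3 : AEMeasurable (fun y => weakPartial (interior (e.extend (𝓡∂ n)).target) i
      (fieldCoord e W k) y + ∑ l, christoffel g e k i l y * fieldCoord e W l y)
      (volume.restrict K) :=
    ((h1 k).memLp_weakPartial (volume_target_sdiff_interior e) hKT hK
      i).aestronglyMeasurable.aemeasurable.add (Finset.aemeasurable_fun_sum _ fun l _ =>
        (memLp_christoffel hp hg he hKT hK k i l).aestronglyMeasurable.aemeasurable.mul
          ((h1 l).1 K hKT hK).aestronglyMeasurable.aemeasurable)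
  exact h3.congr ((ae_restrict_of_ae_restrict_of_subset hKT (h2 k i)).mono fun y hy => hy.symm)

lemma aemeasurable_metricMat (g : Metric n M) (he : e ∈ IsManifold.maximalAtlas (𝓡∂ n) ∞ M)
    (hKT : K ⊆ (e.extend (𝓡∂ n)).target) (hK : IsCompact K) (i j : Fin n) :
    AEMeasurable (fun y => metricMat g e y i j) (volume.restrict K) :=
  ((continuousOn_metricCoord g he i j).mono hKT).aemeasurable hK.measurableSet

lemma aemeasurable_metricMat_inv (g : Metric n M) (he : e ∈ IsManifold.maximalAtlas (𝓡∂ n) ∞ M)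
    (hKT : K ⊆ (e.extend (𝓡∂ n)).target) (hK : IsCompact K) (i j : Fin n) :
    AEMeasurable (fun y => (metricMat g e y)⁻¹ i j) (volume.restrict K) :=
  ((continuousOn_metricMat_inv g he i j).mono hKT).aemeasurable hK.measurableSet

lemma IsWeakCovDeriv.aemeasurable_killingForm (hD : IsWeakCovDeriv g W D)
    (hp : (n : ℝ≥0∞) ≤ p) (hg : IsW1p g p) (he : e ∈ IsManifold.maximalAtlas (𝓡∂ n) ∞ M)
    (hKT : K ⊆ (e.extend (𝓡∂ n)).target) (hK : IsCompact K) :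
    AEMeasurable (fun y => formNormSq g ((e.extend (𝓡∂ n)).symm y)
      (killingForm g D ((e.extend (𝓡∂ n)).symm y))) (volume.restrict K) := by
  have hG := aemeasurable_metricMat g he hKT hK
  have ha := hD.aemeasurable_endCoord hp hg he hKT hK
  have h1 : AEMeasurable (fun y => formSq (metricMat g e y)
      (Matrix.of (killingMat (metricMat g e y) fun i k => endCoord e D k i y)))
      (volume.restrict K) := by
    refine aemeasurable_formSq (aemeasurable_metricMat_inv g he hKT hK) fun i j => ?_
    simp only [Matrix.of_apply, killingMat]
    exact ((Finset.aemeasurable_fun_sum _ fun k _ => (hG j k).mul (ha k i)).add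
      (Finset.aemeasurable_fun_sum _ fun k _ => (hG i k).mul (ha k j))).sub
      (((Finset.aemeasurable_fun_sum _ fun k _ => ha k k).const_mul _).mul (hG i j))
  refine h1.congr ?_
  filter_upwards [ae_restrict_mem hK.measurableSet] with y hy
  rw [formNormSq_killingForm D g he (hKT hy)]

lemma IsWeakCovDeriv.aemeasurable_lowered (hD : IsWeakCovDeriv g W D)
    (hp : (n : ℝ≥0∞) ≤ p) (hg : IsW1p g p) (he : e ∈ IsManifold.maximalAtlas (𝓡∂ n) ∞ M)
    (hKT : K ⊆ (e.extend (𝓡∂ n)).target) (hK : IsCompact K) :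
    AEMeasurable (fun y => formNormSq g ((e.extend (𝓡∂ n)).symm y)
      (lowered g D ((e.extend (𝓡∂ n)).symm y))) (volume.restrict K) := by
  have hG := aemeasurable_metricMat g he hKT hK
  have ha := hD.aemeasurable_endCoord hp hg he hKT hK
  have h1 : AEMeasurable (fun y => formSq (metricMat g e y)
      (loweredMat (metricMat g e y) fun i k => endCoord e D k i y)) (volume.restrict K) := by
    refine aemeasurable_formSq (aemeasurable_metricMat_inv g he hKT hK) fun i j => ?_
    simp only [loweredMat, Matrix.of_apply]
    exact Finset.aemeasurable_fun_sum _ fun k _ => (hG j k).mul (ha k i)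
  refine h1.congr ?_
  filter_upwards [ae_restrict_mem hK.measurableSet] with y hy
  rw [formNormSq_lowered D g he (hKT hy)]

lemma inner_self_eq_sum_fieldCoord (g : Metric n M)
    (he : e ∈ IsManifold.maximalAtlas (𝓡∂ n) ∞ M) (W : ∀ x : M, TangentSpace (𝓡∂ n) x)
    {y : EuclideanSpace ℝ (Fin n)} (hy : y ∈ (e.extend (𝓡∂ n)).target) :
    g.inner ((e.extend (𝓡∂ n)).symm y) (W ((e.extend (𝓡∂ n)).symm y))
        (W ((e.extend (𝓡∂ n)).symm y))
      = ∑ i, ∑ j, metricMat g e y i j * fieldCoord e W i y * fieldCoord e W j y :=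
  inner_self_eq_sum g he hy _

lemma IsWeakCovDeriv.aemeasurable_inner_self (hD : IsWeakCovDeriv g W D)
    (he : e ∈ IsManifold.maximalAtlas (𝓡∂ n) ∞ M)
    (hKT : K ⊆ (e.extend (𝓡∂ n)).target) (hK : IsCompact K) :
    AEMeasurable (fun y => g.inner ((e.extend (𝓡∂ n)).symm y) (W ((e.extend (𝓡∂ n)).symm y))
        (W ((e.extend (𝓡∂ n)).symm y))) (volume.restrict K) := by
  have hG := aemeasurable_metricMat g he hKT hK
  have hw : ∀ k, AEMeasurable (fieldCoord e W k) (volume.restrict K) := fun k =>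
    (((hD e he).1 k).1 K hKT hK).aestronglyMeasurable.aemeasurable
  have h1 : AEMeasurable (fun y => ∑ i, ∑ j, metricMat g e y i j * fieldCoord e W i y
      * fieldCoord e W j y) (volume.restrict K) :=
    Finset.aemeasurable_fun_sum _ fun i _ => Finset.aemeasurable_fun_sum _ fun j _ =>
      ((hG i j).mul (hw i)).mul (hw j)
  refine h1.congr ?_
  filter_upwards [ae_restrict_mem hK.measurableSet] with y hy
  rw [inner_self_eq_sum_fieldCoord g he W (hKT hy)]

end Components

/-- A bump function around a point with coordinates `y₀` such that the part of its support in the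
closed half space lies in the chart, and the metric is nearly constant there. -/
lemma exists_cutoff (g : Metric n M) (he : e ∈ IsManifold.maximalAtlas (𝓡∂ n) ∞ M)
    {y₀ : EuclideanSpace ℝ (Fin n)} (hy₀ : y₀ ∈ (e.extend (𝓡∂ n)).target) {δ : ℝ} (hδ : 0 < δ) :
    ∃ χ : ContDiffBump y₀,
      Metric.closedBall y₀ χ.rOut ∩ range (𝓡∂ n) ⊆ (e.extend (𝓡∂ n)).target ∧
      ∀ y ∈ Metric.closedBall y₀ χ.rOut ∩ range (𝓡∂ n), ∀ i j,
        |metricMat g e y i j - metricMat g e y₀ i j| ≤ δ := by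
  have hT : (e.extend (𝓡∂ n)).target ∈ 𝓝[range (𝓡∂ n)] y₀ := extend_target_mem_nhdsWithin' hy₀
  have h1 : ∀ᶠ y in 𝓝[range (𝓡∂ n)] y₀, ∀ i j,
      |metricMat g e y i j - metricMat g e y₀ i j| ≤ δ := by
    refine Filter.eventually_all.2 fun i => Filter.eventually_all.2 fun j => ?_
    have h2 := ((continuousOn_metricCoord g he i j) y₀ hy₀).mono_left (nhdsWithin_le_of_mem hT)
    have h3 := h2 (Metric.closedBall_mem_nhds _ hδ)
    filter_upwards [h3] with y hy
    rw [mem_preimage, Metric.mem_closedBall, Real.dist_eq] at hy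
    exact hy
  obtain ⟨r, hr, h⟩ := Metric.mem_nhdsWithin_iff.1 (Filter.inter_mem hT h1)
  have hsub : Metric.closedBall y₀ (r / 2) ∩ range (𝓡∂ n) ⊆ Metric.ball y₀ r ∩ range (𝓡∂ n) :=
    inter_subset_inter_left _ (Metric.closedBall_subset_ball (by linarith))
  exact ⟨⟨r / 4, r / 2, by linarith, by linarith⟩, fun y hy => (h (hsub hy)).1,
    fun y hy => (h (hsub hy)).2⟩

variable [MeasurableSpace M] [BorelSpace M]

/-- An upper bound for an integral over a chart, in coordinates. -/
lemma setLIntegral_riemVol_le (g : Metric n M) (he : e ∈ IsManifold.maximalAtlas (𝓡∂ n) ∞ M)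
    {s : Set (EuclideanSpace ℝ (Fin n))} (hs : MeasurableSet s)
    (hsub : s ⊆ (e.extend (𝓡∂ n)).target) {F : M → ℝ} {f : EuclideanSpace ℝ (Fin n) → ℝ}
    {C J : ℝ} (hC : 0 ≤ C) (hJ : 0 ≤ J)
    (hF : AEMeasurable (fun y => F ((e.extend (𝓡∂ n)).symm y)) (volume.restrict s))
    (hd : ∀ y ∈ s, density g e y ≤ ENNReal.ofReal J)
    (hf : ∀ y ∈ s, F ((e.extend (𝓡∂ n)).symm y) ≤ C * f y) :
    ∫⁻ x in e.source ∩ e.extend (𝓡∂ n) ⁻¹' s, ENNReal.ofReal (F x) ∂(riemVol g)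
      ≤ ENNReal.ofReal (J * C) * ∫⁻ y in s, ENNReal.ofReal (f y) := by
  rw [setLIntegral_riemVol g he hs hsub hF.ennreal_ofReal,
    ← lintegral_const_mul' _ _ ENNReal.ofReal_ne_top]
  refine setLIntegral_mono' hs fun y hy => ?_
  rw [ENNReal.ofReal_mul hJ, mul_assoc, ← ENNReal.ofReal_mul hC]
  exact mul_le_mul' (hd y hy) (ENNReal.ofReal_le_ofReal (hf y hy))

/-- A lower bound for an integral over the manifold, by an integral in coordinates. -/
lemma setLIntegral_le_riemVol (g : Metric n M) (he : e ∈ IsManifold.maximalAtlas (𝓡∂ n) ∞ M)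
    {s : Set (EuclideanSpace ℝ (Fin n))} (hs : MeasurableSet s)
    (hsub : s ⊆ (e.extend (𝓡∂ n)).target) {F : M → ℝ} {f : EuclideanSpace ℝ (Fin n) → ℝ}
    {c J : ℝ} (hc : 0 < c) (hJ : 0 < J)
    (hF : AEMeasurable (fun y => F ((e.extend (𝓡∂ n)).symm y)) (volume.restrict s))
    (hd : ∀ y ∈ s, ENNReal.ofReal J ≤ density g e y)
    (hf : ∀ y ∈ s, c * f y ≤ F ((e.extend (𝓡∂ n)).symm y)) :
    ∫⁻ y in s, ENNReal.ofReal (f y)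
      ≤ ENNReal.ofReal ((J * c)⁻¹) * ∫⁻ x, ENNReal.ofReal (F x) ∂(riemVol g) := by
  refine le_trans ?_ (mul_le_mul_right (setLIntegral_le_lintegral
    (e.source ∩ e.extend (𝓡∂ n) ⁻¹' s) _) _)
  rw [setLIntegral_riemVol g he hs hsub hF.ennreal_ofReal,
    ← lintegral_const_mul' _ _ ENNReal.ofReal_ne_top]
  refine setLIntegral_mono' hs fun y hy => ?_
  refine le_trans (le_of_eq ?_) (mul_le_mul_right (mul_le_mul' (hd y hy)
    (ENNReal.ofReal_le_ofReal (hf y hy))) _)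
  rw [← ENNReal.ofReal_mul hJ.le, ← ENNReal.ofReal_mul (by positivity)]
  congr 1
  field_simp

end LocalEstimate

/-! ### The local estimate on the manifold -/

section LocalEstimateOnManifold

variable {n : ℕ} [NeZero n] {M : Type*} [TopologicalSpace M]
  [ChartedSpace (EuclideanHalfSpace n) M] [IsManifold (𝓡∂ n) ∞ M]
  [MeasurableSpace M] [BorelSpace M]

/-- Every point has a neighbourhood on which `|∇W|²` is controlled in the mean by `|𝕃W|²` and
`|W|²`, while `|𝕃W|² ≤ C |∇W|²` holds pointwise, so that `|𝕃W|²` is integrable if `|∇W|²` is. -/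
theorem exists_korn_nhds (hn : 3 ≤ n) {p : ℝ≥0∞} (hp : (n : ℝ≥0∞) ≤ p) {g : Metric n M}
    (hg : IsW1p g p) (x₀ : M) :
    ∃ U : Set M, IsOpen U ∧ x₀ ∈ U ∧ ∃ C : ℝ, 0 ≤ C ∧
      ∀ (W : ∀ x : M, TangentSpace (𝓡∂ n) x)
        (D : ∀ x : M, TangentSpace (𝓡∂ n) x →L[ℝ] TangentSpace (𝓡∂ n) x),
      IsWeakCovDeriv g W D →
        AEMeasurable (fun x => formNormSq g x (killingForm g D x)) ((riemVol g).restrict U) ∧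
        (∀ x ∈ U, formNormSq g x (killingForm g D x) ≤ C * formNormSq g x (lowered g D x)) ∧
        ∫⁻ x in U, ENNReal.ofReal (formNormSq g x (lowered g D x)) ∂(riemVol g)
          ≤ ENNReal.ofReal C *
            ((∫⁻ x, ENNReal.ofReal (formNormSq g x (killingForm g D x)) ∂(riemVol g))
              + ∫⁻ x, ENNReal.ofReal (g.inner x (W x) (W x)) ∂(riemVol g)) := by
  set e := chartAt (EuclideanHalfSpace n) x₀ with he_def
  have he : e ∈ IsManifold.maximalAtlas (𝓡∂ n) ∞ M := IsManifold.chart_mem_maximalAtlas x₀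
  set φ := e.extend (𝓡∂ n) with hφ
  have hx₀ : x₀ ∈ e.source := mem_chart_source _ x₀
  have hsrc : φ.source = e.source := e.extend_source
  have hy₀ : φ x₀ ∈ φ.target := φ.map_source (by rwa [hsrc])
  have hG₀ := metricMat_posDef g he hy₀
  obtain ⟨δ, hδ, hkorn⟩ := exists_local_korn hn (metricMat_isSymm g (φ x₀))
    (isUnit_iff_ne_zero.2 hG₀.det_pos.ne')
  obtain ⟨χ, hKT, hχδ⟩ := exists_cutoff g he hy₀ hδ
  set K := Metric.closedBall (φ x₀) χ.rOut ∩ range (𝓡∂ n) with hK_def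
  have hK : IsCompact K := (isCompact_closedBall _ _).inter_right (𝓡∂ n).isClosed_range
  have hKm : MeasurableSet K := hK.measurableSet
  have hS : tsupport χ ∩ halfSpace n = K ∩ halfSpace n := by
    rw [χ.tsupport_eq, hK_def, inter_assoc, inter_eq_right.2 subset_range_of_mem_halfSpace]
  -- the boundary is a null set, so that the compact `K` may replace its part in the open half space
  have hSK : volume.restrict (tsupport χ ∩ halfSpace n) = volume.restrict K := by
    rw [hS, restrict_inter_halfSpace inter_subset_right]
  have hSint : tsupport χ ∩ halfSpace n ⊆ interior φ.target := by
    rw [hS]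
    exact (inter_subset_inter_left _ hKT).trans (target_inter_halfSpace_subset_interior e)
  obtain ⟨C, hC, hmain⟩ := hkorn χ ⟨χ.contDiff, χ.hasCompactSupport⟩ _ hSint (metricMat g e)
    (fun i j => by
      rw [hSK]
      exact (aemeasurable_metricMat g he hKT hK i j).aestronglyMeasurable)
    (fun y hy => hχδ y (hS ▸ hy).1)
    (fun k i l => christoffel g e k i l)
    (fun k i l => by
      rw [hSK]
      exact memLp_christoffel hp hg he hKT hK k i l)
  rw [hSK] at hmain
  obtain ⟨c₁, C₁, hc₁, hC₁, hD₁⟩ := exists_bounds_lowered g he hKT hK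
  obtain ⟨c₂, C₂, hc₂, hC₂, hL₂⟩ := exists_bounds_form g he hKT hK
  obtain ⟨c₃, C₃, hc₃, hC₃, hW₃⟩ := exists_bounds_metricMat g he hKT hK
  obtain ⟨c₄, C₄, hc₄, hC₄, hJ₄⟩ := exists_bounds_density g he hKT hK
  obtain ⟨b, hb⟩ : ∃ b : ℝ, ∀ y ∈ K, ∀ i j, |metricMat g e y i j| ≤ b := by
    have h1 : ContinuousOn (fun y => fun i j => metricCoord g e i j y) K :=
      continuousOn_pi.2 fun a => continuousOn_pi.2 fun b =>
        (continuousOn_metricCoord g he a b).mono hKT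
    obtain ⟨b, hb⟩ := hK.exists_bound_of_continuousOn h1
    exact ⟨b, fun y hy i j => ((norm_le_pi_norm (fun j => metricCoord g e i j y) j).trans
      (norm_le_pi_norm (fun i j => metricCoord g e i j y) i)).trans (hb y hy)⟩
  -- the neighbourhood is a part of the chart on which the cutoff function is `1`
  set s := K ∩ Metric.ball (φ x₀) χ.rIn with hs_def
  have hsm : MeasurableSet s := hKm.inter Metric.isOpen_ball.measurableSet
  have hsK : s ⊆ K := inter_subset_left
  have hχs : ∀ y ∈ s, χ y = 1 := fun y hy =>
    χ.one_of_mem_closedBall (Metric.ball_subset_closedBall hy.2)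
  set Cpt := C₂ * (16 * b ^ 2 * (n : ℝ) ^ 4 * c₁⁻¹) with hCpt
  set Cint := C₄ * C₁ * C * ((c₄ * c₂)⁻¹ + (c₄ * c₃)⁻¹) with hCint
  have hCpt0 : 0 ≤ Cpt := by positivity
  have hCint0 : 0 ≤ Cint := by positivity
  have hU : e.source ∩ φ ⁻¹' s = e.source ∩ φ ⁻¹' Metric.ball (φ x₀) χ.rIn := by
    ext x
    refine ⟨fun hx => ⟨hx.1, hx.2.2⟩, fun hx => ⟨hx.1, ⟨?_, ?_⟩, hx.2⟩⟩
    · exact Metric.ball_subset_closedBall (Metric.ball_subset_ball χ.rIn_lt_rOut.le hx.2)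
    · exact mem_range_self _
  refine ⟨e.source ∩ φ ⁻¹' s, ?_, ?_, Cpt + Cint, by positivity, fun W D hD => ?_⟩
  · rw [hU]
    exact (e.continuousOn_extend (I := 𝓡∂ n) |>.mono hsrc.ge).isOpen_inter_preimage e.open_source
      Metric.isOpen_ball
  · rw [hU]
    exact ⟨hx₀, Metric.mem_ball_self χ.rIn_pos⟩
  have hsT : s ⊆ φ.target := hsK.trans hKT
  have hLm := hD.aemeasurable_killingForm hp hg he hKT hK
  have hDm := hD.aemeasurable_lowered hp hg he hKT hK
  have hWm := hD.aemeasurable_inner_self he hKT hK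
  have hrest : volume.restrict s ≤ volume.restrict K := Measure.restrict_mono hsK le_rfl
  refine ⟨aemeasurable_riemVol g he hsm hsT (hLm.mono_measure hrest), fun x hx => ?_, ?_⟩
  · have hxy : φ.symm (φ x) = x := φ.left_inv (by rw [hsrc]; exact hx.1)
    have hy : φ x ∈ K := hsK hx.2
    have h1 := formNormSq_killingForm D g he (hKT hy)
    have h2 := formNormSq_lowered D g he (hKT hy)
    rw [hxy] at h1 h2
    have h3 := (hD₁ (φ x) hy fun i k => endCoord e D k i (φ x)).1
    have h4 := (hL₂ (φ x) hy (killingMat (metricMat g e (φ x)) fun i k => endCoord e D k i (φ x))).2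
    have h5 := sum_killingMat_sq_le (hb (φ x) hy) fun i k => endCoord e D k i (φ x)
    rw [← h2] at h3
    have h6 : 0 ≤ formNormSq g x (lowered g D x) := by
      rw [h2]
      exact formSq_nonneg (metricMat_posDef g he (hKT hy)) _
    have h7 : ∑ i, ∑ k, endCoord e D k i (φ x) ^ 2 ≤ c₁⁻¹ * formNormSq g x (lowered g D x) := by
      rw [inv_mul_eq_div, le_div_iff₀ hc₁, mul_comm]
      exact h3
    calc formNormSq g x (killingForm g D x)
        ≤ C₂ * (16 * b ^ 2 * (n : ℝ) ^ 4 * (c₁⁻¹ * formNormSq g x (lowered g D x))) := by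
          rw [h1]
          refine h4.trans (mul_le_mul_of_nonneg_left (h5.trans ?_) hC₂.le)
          exact mul_le_mul_of_nonneg_left h7 (by positivity)
      _ = Cpt * formNormSq g x (lowered g D x) := by rw [hCpt]; ring
      _ ≤ (Cpt + Cint) * formNormSq g x (lowered g D x) :=
          mul_le_mul_of_nonneg_right (by linarith) h6
  · set a : EuclideanSpace ℝ (Fin n) → Fin n → Fin n → ℝ := fun y i k => endCoord e D k i y with ha
    set L := ∫⁻ x, ENNReal.ofReal (formNormSq g x (killingForm g D x)) ∂(riemVol g) with hL
    set N := ∫⁻ x, ENNReal.ofReal (g.inner x (W x) (W x)) ∂(riemVol g) with hN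
    have h1 : ∫⁻ x in e.source ∩ φ ⁻¹' s, ENNReal.ofReal (formNormSq g x (lowered g D x))
          ∂(riemVol g)
        ≤ ENNReal.ofReal (C₄ * C₁) * ∫⁻ y in s, ENNReal.ofReal (∑ i, ∑ k, a y i k ^ 2) :=
      setLIntegral_riemVol_le g he hsm hsT hC₁.le hC₄.le (hDm.mono_measure hrest)
        (fun y hy => (hJ₄ y (hsK hy)).2) fun y hy => by
          rw [formNormSq_lowered D g he (hsT hy)]
          exact (hD₁ y (hsK hy) _).2
    have h2 : ∫⁻ y in s, ENNReal.ofReal (∑ i, ∑ k, a y i k ^ 2)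
        ≤ ∫⁻ y in K, ENNReal.ofReal (∑ i, ∑ k, (χ y * endCoord e D k i y) ^ 2) := by
      refine le_trans (setLIntegral_mono' hsm fun y hy => ?_) (lintegral_mono_set hsK)
      simp only [hχs y hy, one_mul, ha, le_refl]
    have h3 := hmain (fieldCoord e W)
      (fun k i => weakPartial (interior φ.target) i (fieldCoord e W k))
      (fun k i => ((hD e he).1 k).isWeakPartial i) (fun k => ((hD e he).1 k).1 K hKT hK)
      (fun k i => ((hD e he).1 k).memLp_weakPartial (volume_target_sdiff_interior e) hKT hK i)
      (endCoord e D) fun k i => ae_restrict_of_ae_restrict_of_subset hKT ((hD e he).2 k i)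
    have h4 : ∫⁻ y in K, ENNReal.ofReal (∑ i, ∑ j, (χ y * killingMat (metricMat g e y)
          (fun i k => endCoord e D k i y) i j) ^ 2)
        ≤ ENNReal.ofReal ((c₄ * c₂)⁻¹) * L := by
      refine le_trans (lintegral_mono fun y => ENNReal.ofReal_le_ofReal ?_)
        (setLIntegral_le_riemVol g he hKm hKT hc₂ hc₄ hLm (fun y hy => (hJ₄ y hy).1)
          (f := fun y => ∑ i, ∑ j, killingMat (metricMat g e y)
            (fun i k => endCoord e D k i y) i j ^ 2) fun y hy => ?_)
      · refine Finset.sum_le_sum fun i _ => Finset.sum_le_sum fun j _ => ?_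
        rw [mul_pow]
        exact mul_le_of_le_one_left (sq_nonneg _) (pow_le_one₀ χ.nonneg χ.le_one)
      · rw [formNormSq_killingForm D g he (hKT hy)]
        exact (hL₂ y hy _).1
    have h5 : ∫⁻ y in K, ENNReal.ofReal (∑ k, fieldCoord e W k y ^ 2)
        ≤ ENNReal.ofReal ((c₄ * c₃)⁻¹) * N :=
      setLIntegral_le_riemVol g he hKm hKT hc₃ hc₄ hWm (fun y hy => (hJ₄ y hy).1) fun y hy => by
        rw [inner_self_eq_sum_fieldCoord g he W (hKT hy)]
        exact (hW₃ y hy _).1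
    have h6 : ENNReal.ofReal ((c₄ * c₂)⁻¹) * L + ENNReal.ofReal ((c₄ * c₃)⁻¹) * N
        ≤ ENNReal.ofReal ((c₄ * c₂)⁻¹ + (c₄ * c₃)⁻¹) * (L + N) := by
      rw [mul_add]
      exact add_le_add
        (mul_le_mul_left (ENNReal.ofReal_le_ofReal (by linarith [inv_pos.2 (mul_pos hc₄ hc₃)])) _)
        (mul_le_mul_left (ENNReal.ofReal_le_ofReal (by linarith [inv_pos.2 (mul_pos hc₄ hc₂)])) _)
    calc _ ≤ ENNReal.ofReal (C₄ * C₁) * (ENNReal.ofReal C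
          * (ENNReal.ofReal ((c₄ * c₂)⁻¹ + (c₄ * c₃)⁻¹) * (L + N))) :=
          h1.trans (mul_le_mul_right ((h2.trans h3).trans
            (mul_le_mul_right ((add_le_add h4 h5).trans h6) _)) _)
      _ = ENNReal.ofReal Cint * (L + N) := by
          rw [← mul_assoc, ← mul_assoc, ← ENNReal.ofReal_mul (by positivity),
            ← ENNReal.ofReal_mul (by positivity)]
      _ ≤ _ := mul_le_mul_left (ENNReal.ofReal_le_ofReal (by linarith)) _

end LocalEstimateOnManifold

/-! ### The global estimate -/

section GlobalEstimate

variable {n : ℕ} [NeZero n] {M : Type*} [TopologicalSpace M]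
  [ChartedSpace (EuclideanHalfSpace n) M] [IsManifold (𝓡∂ n) ∞ M]

lemma inner_self_nonneg (g : Metric n M) (x : M) (v : TangentSpace (𝓡∂ n) x) :
    0 ≤ g.inner x v v := by
  by_cases hv : v = 0
  · rw [hv, map_zero]
  · exact (g.pos x v hv).le

section

variable (D : ∀ x : M, TangentSpace (𝓡∂ n) x →L[ℝ] TangentSpace (𝓡∂ n) x)

lemma formNormSq_lowered_nonneg (g : Metric n M) (x : M) :
    0 ≤ formNormSq g x (lowered g D x) := by
  have hx := mem_extChartAt_source (I := 𝓡∂ n) x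
  have hy := (extChartAt (𝓡∂ n) x).map_source hx
  have h := formNormSq_lowered D g (IsManifold.chart_mem_maximalAtlas x) hy
  rw [show ((chartAt (EuclideanHalfSpace n) x).extend (𝓡∂ n)).symm
    (extChartAt (𝓡∂ n) x x) = x from (extChartAt (𝓡∂ n) x).left_inv hx] at h
  rw [h]
  exact formSq_nonneg (metricMat_posDef g (IsManifold.chart_mem_maximalAtlas x) hy) _

lemma formNormSq_killingForm_nonneg (g : Metric n M) (x : M) :
    0 ≤ formNormSq g x (killingForm g D x) := by
  have hx := mem_extChartAt_source (I := 𝓡∂ n) x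
  have hy := (extChartAt (𝓡∂ n) x).map_source hx
  have h := formNormSq_killingForm D g (IsManifold.chart_mem_maximalAtlas x) hy
  rw [show ((chartAt (EuclideanHalfSpace n) x).extend (𝓡∂ n)).symm
    (extChartAt (𝓡∂ n) x x) = x from (extChartAt (𝓡∂ n) x).left_inv hx] at h
  rw [h]
  exact formSq_nonneg (metricMat_posDef g (IsManifold.chart_mem_maximalAtlas x) hy) _

end

lemma isWeakCovDeriv_weakCovDeriv {g : Metric n M} {W : ∀ x : M, TangentSpace (𝓡∂ n) x}
    (h : ∃ D, IsWeakCovDeriv g W D) : IsWeakCovDeriv g W (weakCovDeriv g W) := by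
  rw [weakCovDeriv, dif_pos h]
  exact h.choose_spec

variable [MeasurableSpace M] [BorelSpace M] [CompactSpace M]

/-- Any two weak covariant derivatives of a vector field have the same norm almost everywhere. -/
lemma IsWeakCovDeriv.formNormSq_ae_eq {g : Metric n M} {W : ∀ x : M, TangentSpace (𝓡∂ n) x}
    {D D' : ∀ x : M, TangentSpace (𝓡∂ n) x →L[ℝ] TangentSpace (𝓡∂ n) x}
    (hD : IsWeakCovDeriv g W D) (hD' : IsWeakCovDeriv g W D') :
    (fun x => formNormSq g x (lowered g D x)) =ᵐ[riemVol g]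
      fun x => formNormSq g x (lowered g D' x) := by
  have hloc : ∀ x₀ : M, ∀ᵐ x ∂((riemVol g).restrict (chartAt (EuclideanHalfSpace n) x₀).source),
      formNormSq g x (lowered g D x) = formNormSq g x (lowered g D' x) := by
    intro x₀
    set e := chartAt (EuclideanHalfSpace n) x₀ with he_def
    have he : e ∈ IsManifold.maximalAtlas (𝓡∂ n) ∞ M := IsManifold.chart_mem_maximalAtlas x₀
    have h1 : e.source ∩ e.extend (𝓡∂ n) ⁻¹' (e.extend (𝓡∂ n)).target = e.source := by
      refine inter_eq_left.2 fun x hx => (e.extend (𝓡∂ n)).map_source ?_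
      rwa [e.extend_source]
    have h2 := ae_riemVol_of_ae g he (measurableSet_extend_target e) subset_rfl
      (p := fun x => formNormSq g x (lowered g D x) = formNormSq g x (lowered g D' x)) ?_
    · rwa [h1] at h2
    · have h3 : ∀ᵐ y ∂(volume.restrict (e.extend (𝓡∂ n)).target), ∀ k i,
          endCoord e D k i y = endCoord e D' k i y := by
        refine ae_all_iff.2 fun k => ae_all_iff.2 fun i => ?_
        filter_upwards [(hD e he).2 k i, (hD' e he).2 k i] with y h4 h5
        rw [h4, h5]
      filter_upwards [h3, ae_restrict_mem (measurableSet_extend_target e)] with y hy hyT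
      rw [formNormSq_lowered D g he hyT, formNormSq_lowered D' g he hyT]
      simp only [hy]
  obtain ⟨t, -, ht⟩ := isCompact_univ.elim_nhds_subcover
    (fun x : M => (chartAt (EuclideanHalfSpace n) x).source) fun x _ =>
      (chartAt (EuclideanHalfSpace n) x).open_source.mem_nhds (mem_chart_source _ x)
  have h := (ae_restrict_biUnion_finset_iff (μ := riemVol g)
    (fun x : M => (chartAt (EuclideanHalfSpace n) x).source) t
    (fun x => formNormSq g x (lowered g D x) = formNormSq g x (lowered g D' x))).2
    fun x _ => hloc x
  rwa [univ_subset_iff.1 ht, Measure.restrict_univ] at h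

/-- The global estimate. Integrability of `|∇W|²`, for the representative `weakCovDeriv g W`, and of
`|𝕃W|²` is part of the proof, so that the Bochner integrals are the genuine ones. -/
theorem exists_korn (hn : 3 ≤ n) {p : ℝ≥0∞} (hp : (n : ℝ≥0∞) ≤ p) {g : Metric n M}
    (hg : IsW1p g p) : ∃ C : ℝ, 0 ≤ C ∧ ∀ W : ∀ x : M, TangentSpace (𝓡∂ n) x, MemW12 g W →
      ∫ x, formNormSq g x (lowered g (weakCovDeriv g W) x) ∂(riemVol g)
        ≤ C * ((∫ x, formNormSq g x (confKilling g W x) ∂(riemVol g))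
          + ∫ x, g.inner x (W x) (W x) ∂(riemVol g)) := by
  choose U hUo hxU C hC hmain using exists_korn_nhds (M := M) hn hp hg
  obtain ⟨t, -, ht⟩ := isCompact_univ.elim_nhds_subcover U fun x _ => (hUo x).mem_nhds (hxU x)
  refine ⟨∑ x ∈ t, C x, Finset.sum_nonneg fun x _ => hC x, fun W hW => ?_⟩
  obtain ⟨hWint, D', hD', hD'int⟩ := hW
  set D := weakCovDeriv g W with hD_def
  have hD : IsWeakCovDeriv g W D := isWeakCovDeriv_weakCovDeriv ⟨D', hD'⟩
  have hDint : Integrable (fun x => formNormSq g x (lowered g D x)) (riemVol g) :=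
    hD'int.congr (hD'.formNormSq_ae_eq hD)
  have hD0 := formNormSq_lowered_nonneg D g
  have hL0 := formNormSq_killingForm_nonneg D g
  have hCle : ∀ x ∈ t, C x ≤ ∑ x ∈ t, C x := fun x hx =>
    Finset.single_le_sum (fun y _ => hC y) hx
  have hcover : ∀ x, ∃ z ∈ t, x ∈ U z := fun x => by
    simpa using ht (mem_univ x)
  have hUt : (⋃ z : t, U z) = univ := eq_univ_of_forall fun x => by
    obtain ⟨z, hz, hx⟩ := hcover x
    exact mem_iUnion.2 ⟨⟨z, hz⟩, hx⟩
  have hLm : AEMeasurable (fun x => formNormSq g x (killingForm g D x)) (riemVol g) := by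
    rw [← Measure.restrict_univ (μ := riemVol g), ← hUt]
    exact aemeasurable_iUnion_iff.2 fun z => (hmain z W D hD).1
  -- by the pointwise bound `|𝕃W|² ≤ C |∇W|²`
  have hLint : Integrable (fun x => formNormSq g x (killingForm g D x)) (riemVol g) := by
    refine (hDint.const_mul (∑ x ∈ t, C x)).mono' hLm.aestronglyMeasurable
      (Filter.Eventually.of_forall fun x => ?_)
    obtain ⟨z, hz, hx⟩ := hcover x
    rw [Real.norm_of_nonneg (hL0 x)]
    exact ((hmain z W D hD).2.1 x hx).trans (mul_le_mul_of_nonneg_right (hCle z hz) (hD0 x))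
  have hW0 : ∀ x, 0 ≤ g.inner x (W x) (W x) := fun x => inner_self_nonneg g x _
  have key : ∫⁻ x, ENNReal.ofReal (formNormSq g x (lowered g D x)) ∂(riemVol g)
      ≤ ENNReal.ofReal (∑ x ∈ t, C x)
        * ((∫⁻ x, ENNReal.ofReal (formNormSq g x (killingForm g D x)) ∂(riemVol g))
          + ∫⁻ x, ENNReal.ofReal (g.inner x (W x) (W x)) ∂(riemVol g)) := by
    rw [ENNReal.ofReal_sum_of_nonneg fun x _ => hC x, Finset.sum_mul, ← setLIntegral_univ,
      ← hUt, ← Finset.sum_coe_sort t]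
    refine (lintegral_iUnion_le _ _).trans ?_
    rw [tsum_fintype]
    exact Finset.sum_le_sum fun z _ => (hmain z W D hD).2.2
  rw [← ofReal_integral_eq_lintegral_ofReal hDint (Filter.Eventually.of_forall hD0),
    ← ofReal_integral_eq_lintegral_ofReal hLint (Filter.Eventually.of_forall hL0),
    ← ofReal_integral_eq_lintegral_ofReal hWint (Filter.Eventually.of_forall hW0),
    ← ENNReal.ofReal_add (integral_nonneg hL0) (integral_nonneg hW0),
    ← ENNReal.ofReal_mul (Finset.sum_nonneg fun x _ => hC x)] at key
  exact (ENNReal.ofReal_le_ofReal_iff (mul_nonneg (Finset.sum_nonneg fun x _ => hC x)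
    (add_nonneg (integral_nonneg hL0) (integral_nonneg hW0)))).1 key

end GlobalEstimate

end LowRegKorn

end

theorem mainTheorem5 (n : ℕ) [NeZero n] (hn : 3 ≤ n)
    (M : Type*) [TopologicalSpace M] [T2Space M] [CompactSpace M]
    [ChartedSpace (EuclideanHalfSpace n) M] [IsManifold (𝓡∂ n) ∞ M]
    [MeasurableSpace M] [BorelSpace M]
    (p' : ℝ≥0∞) (hp' : (n : ℝ≥0∞) < p')
    (g : LowRegKorn.Metric n M) (hg : LowRegKorn.IsW1p g p') :
    ∃ c₁ c₂ : ℝ, 0 < c₁ ∧ 0 < c₂ ∧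
      ∀ W : (x : M) → TangentSpace (𝓡∂ n) x, LowRegKorn.MemW12 g W →
        c₁ * LowRegKorn.w12Norm g W ^ 2 - c₂ * LowRegKorn.vecL2Norm g W ^ 2
          ≤ LowRegKorn.formL2Norm g (LowRegKorn.confKilling g W) ^ 2 := by
  obtain ⟨C, hC, hkorn⟩ := LowRegKorn.exists_korn hn hp'.le hg
  refine ⟨1 / (C + 1), 1 / (C + 1) + 1, by positivity, by positivity, fun W hW => ?_⟩
  have h := hkorn W hW
  have hA : 0 ≤ ∫ x, LowRegKorn.formNormSq g x
      (LowRegKorn.lowered g (LowRegKorn.weakCovDeriv g W) x) ∂(LowRegKorn.riemVol g) :=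
    MeasureTheory.integral_nonneg fun x => LowRegKorn.formNormSq_lowered_nonneg _ g x
  have hL : 0 ≤ ∫ x, LowRegKorn.formNormSq g x (LowRegKorn.confKilling g W x)
      ∂(LowRegKorn.riemVol g) :=
    MeasureTheory.integral_nonneg fun x => LowRegKorn.formNormSq_killingForm_nonneg _ g x
  have hN : 0 ≤ ∫ x, g.inner x (W x) (W x) ∂(LowRegKorn.riemVol g) :=
    MeasureTheory.integral_nonneg fun x => LowRegKorn.inner_self_nonneg g x _
  rw [LowRegKorn.w12Norm, Real.sq_sqrt (by positivity), LowRegKorn.vecL2Norm,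
    LowRegKorn.formL2Norm, LowRegKorn.formL2Norm, Real.sq_sqrt hA, Real.sq_sqrt hL,
    Real.sq_sqrt hN]
  set A := ∫ x, LowRegKorn.formNormSq g x
    (LowRegKorn.lowered g (LowRegKorn.weakCovDeriv g W) x) ∂(LowRegKorn.riemVol g)
  set L := ∫ x, LowRegKorn.formNormSq g x (LowRegKorn.confKilling g W x)
    ∂(LowRegKorn.riemVol g)
  set N := ∫ x, g.inner x (W x) (W x) ∂(LowRegKorn.riemVol g)
  have h1 : 1 / (C + 1) * A ≤ L + N := by
    rw [one_div, inv_mul_le_iff₀ (by positivity)]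
    exact h.trans (mul_le_mul_of_nonneg_right (by linarith) (add_nonneg hL hN))
  linarith [mul_add (1 / (C + 1)) N A, add_mul (1 / (C + 1)) 1 N]
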